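/- Let $0<r<1$. For $a=\sum_n a_nT^n\in\mathbb Z((T))$ put $\|a\|_r=\sum_n|a_n|r^n$, and let $\mathbb Z((T))_r$ be the condensed ring whose $T'$-valued points ($T'$ compact Hausdorff) are the series $\sum_n a_nT^n$ with $a_n\in C(T',\mathbb Z)$ such that for some $c$ one has $\sum_n|a_n(t)|r^n\le c$ for all $t\in T'$. For a profinite set $S=\varprojlim_i S_i$ (limit over its finite discrete quotients) let $$\mathcal M(S,\mathbb Z((T))_r)=\bigcup_{c>0}\varprojlim_i\Big\{\sum_{s\in S_i}a_s[s]\in\mathbb Z((T))_r[S_i]\ :\ \sum_{s}\|a_s\|_r\le c\Big\},$$ where the sets on the right carry the topology of coefficientwise convergence; this is a condensed $\mathbb Z((T))_r$-module. For $0<p<1$ let $$\mathcal M_p(S)=\bigcup_{c>0}\varprojlim_i\Big\{\sum_{s\in S_i} x_s[s]\in\mathbb R[S_i]\ :\ \sum_s|x_s|^p\le c\Big\},$$ a condensed $\mathbb R$-module. For $x\in\mathbb R$ put $[x]=x|x|^X=\sum_{k\ge0}\frac{x(\log|x|)^k}{k!}X^k$ (with $[0]=0$). For $n\ge1$ and a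 finite set $I$ let $(\mathbb R[X]/X^n)[I]_{\ell^p\le c}$ be the set of all $\big(\sum_{i<n}[x_{i,s}]X^i\big)_{s\in I}$ with $\sum_{i,s}|x_{i,s}|^p\le c$, and let the subscript "stable" denote the subset of those elements whose images under all maps $I\to I'$ to finite sets $I'$ lie in $(\mathbb R[X]/X^n)[I']_{\ell^p\le c}$. Let $$\mathcal M_p(S,\mathbb R[X]/X^n)=\bigcup_{c>0}\varprojlim_i(\mathbb R[X]/X^n)[S_i]_{\ell^p\le c,\mathrm{stable}},$$ a condensed $\mathbb R[X]/X^n$-module. **Theorem.** Let $0<r'<r<1$, and consider the ring homomorphism $\theta_{r'}:\mathbb Z((T))_r\to\mathbb R$, $\sum a_kT^k\mapsto\sum a_k(r')^k$. It is surjective, both on underlying rings and as a map of condensed rings. Moreover: 1. There is a nonzerodivisor $f=f_{r'}\in\mathbb Z((T))_r$ generating the kernel of $\theta_{r'}$, both on underlying rings and as condensed rings (so $\mathbb Z((T))_r/(f)\cong\mathbb R$ as condensed rings). Let $0<p<1$ be the real number with $(r')^p=r$. 2. For every profinite set $S$ there is an isomorphism $$\mathcal M(S,\mathbb Z((T))_r)/(f)\cong\mathcal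 M_p(S)$$ of condensed $\mathbb Z((T))_r/(f)=\mathbb R$-modules, which is the canonical one: it sends the class of $\big(\sum_{s\in S_i}a_{i,s}[s]\big)_i$ to $\big(\sum_{s\in S_i}\theta_{r'}(a_{i,s})[s]\big)_i$. 3. More generally, for every $n\ge1$ let $\theta_n:\mathbb Z((T))_r\to\mathbb R[X]/X^n$ be the ring homomorphism $\sum a_kT^k\mapsto\sum a_k[r']^k$, so that $T\mapsto[r']=(r')^{1+X}$. It is surjective with kernel $(f)^n$, both on underlying rings and as a map of condensed rings, so $\mathbb Z((T))_r/(f)^n\cong\mathbb R[X]/X^n$. For every profinite set $S$ there is an isomorphism $$\mathcal M(S,\mathbb Z((T))_r)/(f)^n\cong\mathcal M_p(S,\mathbb R[X]/X^n)$$ of condensed $\mathbb Z((T))_r/(f)^n\cong\mathbb R[X]/X^n$-modules, sending the class of $\big(\sum_{s\in S_i}a_{i,s}[s]\big)_i$ to $\big(\sum_{s\in S_i}\theta_n(a_{i,s})[s]\big)_i$. -/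

import Mathlib

open CategoryTheory Limits Opposite Topology
open scoped Polynomial

universe u

namespace CondensedMeasures

/-! ### Ind-compact rings and the condensed rings they define -/

/-- A commutative ring `A` with a topology and an exhaustion by subsets `ball c`, such that addition
is continuous and multiplication is continuous on the sets `ball c × ball d`. -/
class BallRing (A : Type) [CommRing A] [TopologicalSpace A] where
  ball : ℝ → Set A
  mono : Monotone ball
  exists_mem : ∀ a, ∃ c, a ∈ ball c
  add_mem : ∀ c d, ∃ e, ∀ a ∈ ball c, ∀ b ∈ ball d, a + b ∈ ball e
  mul_mem : ∀ c d, ∃ e, ∀ a ∈ ball c, ∀ b ∈ ball d, a * b ∈ ball e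
  continuous_add : Continuous fun x : A × A => x.1 + x.2
  continuousOn_mul : ∀ c d, ContinuousOn (fun x : A × A => x.1 * x.2) (ball c ×ˢ ball d)

/-- A normed ring is exhausted by its closed balls; on a compact space `T` every continuous map to
it is bounded. -/
instance (A : Type) [NormedCommRing A] : BallRing A where
  ball c := {a | ‖a‖ ≤ c}
  mono _ _ h _ ha := le_trans ha h
  exists_mem a := ⟨‖a‖, le_refl ‖a‖⟩
  add_mem c d := ⟨c + d, fun _ ha _ hb => (norm_add_le _ _).trans (add_le_add ha hb)⟩
  mul_mem c d := ⟨c * d, fun _ ha _ hb => (norm_mul_le _ _).trans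
    (mul_le_mul ha hb (norm_nonneg _) ((norm_nonneg _).trans ha))⟩
  continuous_add := continuous_fst.add continuous_snd
  continuousOn_mul _ _ := (continuous_fst.mul continuous_snd).continuousOn

section Ring

variable (A : Type) [CommRing A] [TopologicalSpace A] [BallRing A]

/-- The ring of `T`-valued points of the condensed ring `⋃_c ball c`: the continuous maps `T → A`
with values in some `ball c`. -/
def secRing (T : Type u) [TopologicalSpace T] : Subring (T → A) where
  carrier := {a | Continuous a ∧ ∃ c, ∀ t, a t ∈ BallRing.ball c}
  zero_mem' := ⟨continuous_const, (BallRing.exists_mem (0 : A)).imp fun _ h _ => h⟩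
  one_mem' := ⟨continuous_const, (BallRing.exists_mem (1 : A)).imp fun _ h _ => h⟩
  add_mem' := by
    rintro a b ⟨ha, c, hc⟩ ⟨hb, d, hd⟩
    refine ⟨BallRing.continuous_add.comp (ha.prodMk hb), ?_⟩
    obtain ⟨e, he⟩ := BallRing.add_mem (A := A) c d
    exact ⟨e, fun t => he _ (hc t) _ (hd t)⟩
  mul_mem' := by
    rintro a b ⟨ha, c, hc⟩ ⟨hb, d, hd⟩
    refine ⟨(BallRing.continuousOn_mul c d).comp_continuous (ha.prodMk hb)
      fun t => ⟨hc t, hd t⟩, ?_⟩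
    obtain ⟨e, he⟩ := BallRing.mul_mem (A := A) c d
    exact ⟨e, fun t => he _ (hc t) _ (hd t)⟩
  neg_mem' := by
    rintro a ⟨ha, c, hc⟩
    obtain ⟨d, hd⟩ := BallRing.exists_mem (-1 : A)
    obtain ⟨e, he⟩ := BallRing.mul_mem (A := A) d c
    have h : -a = fun t => (-1) * a t := by ext t; simp
    rw [h]
    exact ⟨(BallRing.continuousOn_mul d c).comp_continuous (continuous_const.prodMk ha)
      fun t => ⟨hd, hc t⟩, e, fun t => he _ hd _ (hc t)⟩

/-- Pulling back sections along a continuous map. -/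
def secRing.comap {T T' : Type u} [TopologicalSpace T] [TopologicalSpace T'] (g : C(T', T)) :
    secRing A T →+* secRing A T' where
  toFun a := ⟨fun t => a.1 (g t), a.2.1.comp g.continuous, a.2.2.imp fun _ h t => h (g t)⟩
  map_one' := rfl
  map_mul' _ _ := rfl
  map_zero' := rfl
  map_add' _ _ := rfl

/-- The constant section with value `a`. -/
def secRing.const (T : Type u) [TopologicalSpace T] : A →+* secRing A T where
  toFun a := ⟨fun _ => a, continuous_const, (BallRing.exists_mem a).imp fun _ h _ => h⟩
  map_one' := rfl
  map_mul' _ _ := rfl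
  map_zero' := rfl
  map_add' _ _ := rfl

/-- A general gluing lemma: for a map `κ : X → Y` to a topological space and an increasing family
of subsets `B c` of `X`, the functions `f : T → X` with `κ ∘ f` continuous and with values in
some `B c` form a sheaf on compact Hausdorff spaces. -/
theorem isSheaf_of_ball {X Y : Type*} [TopologicalSpace Y] (κ : X → Y) (B : ℝ → Set X)
    (hB : Monotone B) (P : CompHaus.{u}ᵒᵖ ⥤ Type (u + 1))
    (ev : ∀ T : CompHaus.{u}, P.obj (op T) → T → X)
    (hinj : ∀ T, Function.Injective (ev T))
    (hrange : ∀ T f, f ∈ Set.range (ev T) ↔ (Continuous (κ ∘ f) ∧ ∃ c, ∀ t, f t ∈ B c))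
    (hmap : ∀ {T T' : CompHaus.{u}} (g : T' ⟶ T) (x : P.obj (op T)) (t : T'),
      ev T' (P.map g.op x) t = ev T x (g t)) :
    Presheaf.IsSheaf (coherentTopology CompHaus.{u}) P := by
  rw [isSheaf_iff_isSheaf_of_type]
  refine (Presieve.isSheaf_coverage _ _).2 ?_
  rintro T R ⟨α, hα, Z, π, rfl, hπ⟩
  have hsurj : ∀ b : T, ∃ (a : α) (x : Z a), π a x = b :=
    ((CompHaus.effectiveEpiFamily_tfae Z π).out 0 2).1 hπ
  rw [Presieve.isSheafFor_arrows_iff]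
  intro x hx
  have hcompat : ∀ (a b : α) (z : Z a) (w : Z b), π a z = π b w →
      ev _ (x a) z = ev _ (x b) w := by
    intro a b z w hzw
    let pt : CompHaus.{u} := CompHaus.of PUnit.{u + 1}
    let gz : pt ⟶ Z a := CompHausLike.ofHom _ ⟨fun _ => z, continuous_const⟩
    let gw : pt ⟶ Z b := CompHausLike.ofHom _ ⟨fun _ => w, continuous_const⟩
    have := hx a b pt gz gw (by
      ext t
      exact hzw)
    have h1 := hmap gz (x a) PUnit.unit
    have h2 := hmap gw (x b) PUnit.unit
    rw [this] at h1
    exact h1.symm.trans h2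
  choose ia iz hi using hsurj
  let f : T → X := fun t => ev _ (x (ia t)) (iz t)
  have hf : ∀ a (z : Z a), f (π a z) = ev _ (x a) z := fun a z => hcompat _ _ _ _ (hi _)
  have hmem : f ∈ Set.range (ev T) := by
    rw [hrange]
    constructor
    · have hq : Topology.IsQuotientMap (fun q : (Σ a, Z a) => π q.1 q.2) := by
        have hc : Continuous (fun q : (Σ a, Z a) => π q.1 q.2) :=
          continuous_sigma fun a => (π a).hom.hom.continuous
        refine hc.isClosedMap.isQuotientMap hc fun t => ⟨⟨ia t, iz t⟩, hi t⟩
      rw [hq.continuous_iff]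
      refine continuous_sigma fun a => ?_
      change Continuous (((κ ∘ f) ∘ fun q : (Σ a, Z a) => π q.1 q.2) ∘ Sigma.mk a)
      have : ((κ ∘ f) ∘ fun q : (Σ a, Z a) => π q.1 q.2) ∘ Sigma.mk a = κ ∘ ev _ (x a) := by
        ext z
        simp [hf]
      exact this.symm ▸ ((hrange _ _).1 ⟨x a, rfl⟩).1
    · have hc : ∀ a, ∃ c, ∀ z, ev _ (x a) z ∈ B c := fun a => ((hrange _ _).1 ⟨x a, rfl⟩).2
      choose c hc using hc
      obtain ⟨M, hM⟩ := (Set.finite_range c).bddAbove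
      exact ⟨M, fun t => hB (hM ⟨ia t, rfl⟩) (hc _ _)⟩
  obtain ⟨y, hy⟩ := hmem
  refine ⟨y, fun a => hinj _ ?_, fun y' hy' => hinj _ ?_⟩
  · ext z
    rw [hmap, hy, hf]
  · rw [hy]
    ext t
    have := congrFun (congrArg (ev _) (hy' (ia t))) (iz t)
    rw [hmap] at this
    rw [← hi t, this, hi]

/-- The condensed ring `T ↦ secRing A T`. -/
noncomputable def condRing : Condensed.{u} RingCat.{u + 1} where
  obj :=
    { obj T := RingCat.of (ULift.{u + 1} (secRing A T.unop))
      map g := RingCat.ofHom ((ULift.ringEquiv.symm.toRingHom.comp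
        (secRing.comap A g.unop.hom.hom)).comp ULift.ringEquiv.toRingHom) }
  property := by
    refine (Presheaf.isSheaf_iff_isSheaf_forget _ _ (forget RingCat.{u + 1})).2 ?_
    refine isSheaf_of_ball (id : A → A) BallRing.ball BallRing.mono _
      (fun T (x : ULift.{u + 1} (secRing A T)) t => x.down.1 t) ?_ ?_ ?_
    · intro T x y h
      exact ULift.ext _ _ (Subtype.ext h)
    · intro T f
      exact ⟨fun ⟨x, hx⟩ => hx ▸ x.down.2, fun h => ⟨⟨⟨f, h⟩⟩, rfl⟩⟩
    · intros
      rfl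

variable {A} {B : Type} [CommRing B] [TopologicalSpace B] [BallRing B]

/-- A ring homomorphism that is continuous and bounded on all `ball c` induces a morphism of
condensed rings, given on sections by composition. -/
noncomputable def condRing.map (φ : A →+* B)
    (hc : ∀ c, ContinuousOn φ (BallRing.ball c))
    (hb : ∀ c, ∃ d, Set.MapsTo φ (BallRing.ball c) (BallRing.ball d)) :
    condRing.{u} A ⟶ condRing.{u} B where
  hom :=
    { app T := RingCat.ofHom
        { toFun (a : ULift.{u + 1} (secRing A T.unop)) := (⟨⟨fun t => φ (a.down.1 t), by
              obtain ⟨h, c, ha⟩ := a.down.2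
              exact ⟨(hc c).comp_continuous h ha,
                (hb c).imp fun d hd t => hd (ha t)⟩⟩⟩ : ULift.{u + 1} (secRing B T.unop))
          map_one' := ULift.ext _ _ (Subtype.ext (funext fun _ => map_one φ))
          map_mul' _ _ := ULift.ext _ _ (Subtype.ext (funext fun _ => map_mul φ _ _))
          map_zero' := ULift.ext _ _ (Subtype.ext (funext fun _ => map_zero φ))
          map_add' _ _ := ULift.ext _ _ (Subtype.ext (funext fun _ => map_add φ _ _)) } }

end Ring

/-! ### Condensed modules of measures -/

section Module

variable (A : Type) [CommRing A] [TopologicalSpace A] [BallRing A]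

/-- Subsets `ball I c` of the free modules `A[I] = I →₀ A`, increasing in `c`, that are uniformly
in `I` compatible with addition and scalar multiplication and have bounded coordinates. -/
structure Gauge where
  ball : ∀ I : Type u, ℝ → Set (I →₀ A)
  mono : ∀ I, Monotone (ball I)
  zero_mem : ∃ c, ∀ I, 0 ∈ ball I c
  add_mem : ∀ c d, ∃ e, ∀ I, ∀ x ∈ ball I c, ∀ y ∈ ball I d, x + y ∈ ball I e
  coord_mem : ∀ c, ∃ d, ∀ I, [Finite I] → ∀ x ∈ ball I c, ∀ s, x s ∈ BallRing.ball d
  smul_mem : ∀ c d, ∃ e, ∀ I, ∀ a ∈ BallRing.ball (A := A) c, ∀ x ∈ ball I d, a • x ∈ ball I e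

/-- The inverse limit `lim_i A[S_i]` over the finite discrete quotients `S_i` of a profinite
set `S`. -/
def limFree (S : Profinite.{u}) : Submodule A (∀ i : DiscreteQuotient S, i →₀ A) where
  carrier := {μ | ∀ (i j : DiscreteQuotient S) (h : i ≤ j),
    Finsupp.mapDomain (DiscreteQuotient.ofLE h) (μ i) = μ j}
  zero_mem' _ _ _ := Finsupp.mapDomain_zero
  add_mem' hμ hν i j h := by
    simp only [Pi.add_apply, Finsupp.mapDomain_add, hμ i j h, hν i j h]
  smul_mem' a μ hμ i j h := by
    simp only [Pi.smul_apply, Finsupp.mapDomain_smul, hμ i j h]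

/-- The inverse limit `lim_i A[S_i]` as a type. -/
def LimFree (S : Profinite.{u}) : Type u := limFree A S

noncomputable instance (S : Profinite.{u}) : AddCommGroup (LimFree A S) :=
  inferInstanceAs (AddCommGroup (limFree A S))

noncomputable instance (S : Profinite.{u}) : Module A (LimFree A S) :=
  inferInstanceAs (Module A (limFree A S))

variable {A} (G : Gauge.{u} A) (S : Profinite.{u})

/-- The module of `T`-valued points of `⋃_c lim_i (ball S_i c)`: families over `T` of elements of
`lim_i A[S_i]`, with continuous coordinates, lying in `lim_i (ball S_i c)` for some `c`. -/
def secMod (T : Type u) [TopologicalSpace T] : Submodule (secRing A T) (T → LimFree A S) where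
  carrier := {μ | (∀ (i : DiscreteQuotient S) (s : i), Continuous fun t => (μ t).1 i s) ∧
    ∃ c, ∀ t (i : DiscreteQuotient S), (μ t).1 i ∈ G.ball i c}
  zero_mem' := ⟨fun _ _ => continuous_const, G.zero_mem.imp fun _ h _ _ => h _⟩
  add_mem' := by
    rintro μ ν ⟨hμ, c, hc⟩ ⟨hν, d, hd⟩
    obtain ⟨e, he⟩ := G.add_mem c d
    exact ⟨fun i s => BallRing.continuous_add.comp ((hμ i s).prodMk (hν i s)),
      e, fun t i => he _ _ (hc t i) _ (hd t i)⟩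
  smul_mem' := by
    rintro ⟨a, ha, c, hc⟩ μ ⟨hμ, d, hd⟩
    obtain ⟨e, he⟩ := G.smul_mem c d
    refine ⟨fun i s => ?_, e, fun t i => he _ _ (hc t) _ (hd t i)⟩
    obtain ⟨d', hd'⟩ := G.coord_mem d
    exact (BallRing.continuousOn_mul c d').comp_continuous (ha.prodMk (hμ i s))
      fun t => ⟨hc t, hd' _ _ (hd t i) s⟩

/-- The `T`-valued points, placed in the universe in which condensed objects live. -/
abbrev secMod' (T : CompHaus.{u}) : Type (u + 1) := ULift.{u + 1} (secMod G S T)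

/-- Pulling back families of measures along a continuous map. -/
def secMod.comap {T T' : Type u} [TopologicalSpace T] [TopologicalSpace T'] (g : C(T', T)) :
    secMod G S T →+ secMod G S T' where
  toFun μ := ⟨fun t => μ.1 (g t), fun i s => (μ.2.1 i s).comp g.continuous,
    μ.2.2.imp fun _ h t => h (g t)⟩
  map_zero' := rfl
  map_add' _ _ := rfl

/-- The underlying presheaf of abelian groups of the condensed module of measures. -/
noncomputable def measuresPresheaf : CompHaus.{u}ᵒᵖ ⥤ Ab.{u + 1} where
  obj T := AddCommGrpCat.of (secMod' G S T.unop)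
  map {T T'} g := AddCommGrpCat.ofHom
    { toFun := fun μ : secMod' G S T.unop =>
        (⟨secMod.comap G S g.unop.hom.hom μ.down⟩ : secMod' G S T'.unop)
      map_zero' := rfl
      map_add' := fun _ _ => rfl }

noncomputable instance (T : CompHaus.{u}ᵒᵖ) :
    Module ((condRing.{u} A).obj.obj T) ((measuresPresheaf G S).obj T) :=
  inferInstanceAs (Module (ULift.{u + 1} (secRing A T.unop)) (secMod' G S T.unop))

/-- The condensed `A`-module `T ↦ secMod G S T` of measures on `S`. -/
noncomputable def measures : SheafOfModules.{u + 1} (condRing.{u} A) where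
  val := PresheafOfModules.ofPresheaf (measuresPresheaf G S) (fun _ _ _ _ _ => rfl)
  isSheaf := by
    refine (Presheaf.isSheaf_iff_isSheaf_forget _ _ (forget AddCommGrpCat.{u + 1})).2 ?_
    refine isSheaf_of_ball
      (fun (μ : LimFree A S) (q : Σ i : DiscreteQuotient S, i) => μ.1 q.1 q.2)
      (fun c => {μ | ∀ i : DiscreteQuotient S, μ.1 i ∈ G.ball i c})
      (fun c d h μ hμ i => G.mono _ h (hμ i)) _
      (fun T (x : secMod' G S T) t => x.down.1 t) ?_ ?_ ?_
    · intro T x y h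
      exact ULift.ext x y (Subtype.ext h)
    · intro T f
      have : Continuous ((fun (μ : LimFree A S) (q : Σ i : DiscreteQuotient S, i) =>
          μ.1 q.1 q.2) ∘ f) ↔
          ∀ (i : DiscreteQuotient S) (s : i), Continuous fun t => (f t).1 i s := by
        rw [continuous_pi_iff]
        exact ⟨fun h i s => h ⟨i, s⟩, fun h q => h q.1 q.2⟩
      rw [this]
      exact ⟨fun ⟨x, hx⟩ => hx ▸ x.down.2, fun h => ⟨⟨⟨f, h⟩⟩, rfl⟩⟩
    · intros
      rfl

/-- Multiplication by an element `a` of the ring, as an endomorphism of the module of measures. -/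
noncomputable def mulEnd (a : A) : measures G S ⟶ measures G S where
  val := PresheafOfModules.homMk
    { app T := AddCommGrpCat.ofHom
        { toFun := fun μ : secMod' G S T.unop =>
            (⟨secRing.const A T.unop a • μ.down⟩ : secMod' G S T.unop)
          map_zero' := congrArg ULift.up (smul_zero (secRing.const A T.unop a))
          map_add' := fun μ ν =>
            congrArg ULift.up (smul_add (secRing.const A T.unop a) μ.down ν.down) }
      naturality _ _ _ := rfl }
    (fun T (b : ULift.{u + 1} (secRing A T.unop)) (μ : secMod' G S T.unop) =>
      congrArg ULift.up (smul_comm (secRing.const A T.unop a) b.down μ.down))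

end Module
/-! ### The ring `ℤ((T))_r` -/

section ZTr

/-- The coefficients of a product of Laurent series, as sums over all of `ℤ`. -/
theorem hasSum_coeff_mul (a b : LaurentSeries ℤ) (m : ℤ) :
    HasSum (fun k : ℤ => a.coeff k * b.coeff (m - k)) ((a * b).coeff m) := by
  classical
  rw [HahnSeries.coeff_mul]
  set P := Finset.antidiagonal a.isPWO_support b.isPWO_support m with hP
  have hinj : Set.InjOn Prod.fst (P : Set (ℤ × ℤ)) := by
    rintro ⟨i, j⟩ h ⟨i', j'⟩ h' (rfl : i = i')
    simp only [hP, Finset.mem_coe, Finset.mem_antidiagonal] at h h'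
    ext <;> simp; omega
  have hsum : ∑ ij ∈ P, a.coeff ij.1 * b.coeff ij.2
      = ∑ k ∈ P.image Prod.fst, a.coeff k * b.coeff (m - k) := by
    rw [Finset.sum_image hinj]
    refine Finset.sum_congr rfl fun ij h => ?_
    simp only [hP, Finset.mem_antidiagonal] at h
    rw [show m - ij.1 = ij.2 by omega]
  rw [hsum]
  refine hasSum_sum_of_ne_finset_zero fun k hk => ?_
  by_contra h
  refine hk (Finset.mem_image.2 ⟨(k, m - k), ?_, rfl⟩)
  simp only [hP, Finset.mem_antidiagonal]
  exact ⟨left_ne_zero_of_mul h, right_ne_zero_of_mul h, by omega⟩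

/-- The bijection `(m, k) ↦ (k, m - k)` of `ℤ × ℤ`. -/
def convEquiv : ℤ × ℤ ≃ ℤ × ℤ where
  toFun q := (q.2, q.1 - q.2)
  invFun q := (q.1 + q.2, q.1)
  left_inv q := by ext <;> simp
  right_inv q := by ext <;> simp

variable (r : Set.Ioo (0 : ℝ) 1)

/-- The terms `|a_n| r^n`. -/
noncomputable def normTerm (a : LaurentSeries ℤ) (n : ℤ) : ℝ := |(a.coeff n : ℝ)| * (r : ℝ) ^ n

theorem normTerm_nonneg (a : LaurentSeries ℤ) (n : ℤ) : 0 ≤ normTerm r a n :=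
  mul_nonneg (abs_nonneg _) (zpow_nonneg r.2.1.le _)

theorem normTerm_mul_le (a b : LaurentSeries ℤ) (ha : Summable (normTerm r a))
    (hb : Summable (normTerm r b)) :
    Summable (normTerm r (a * b)) ∧
      ∑' n, normTerm r (a * b) n ≤ (∑' n, normTerm r a n) * ∑' n, normTerm r b n := by
  have hr : (r : ℝ) ≠ 0 := r.2.1.ne'
  have h1 : Summable fun q : ℤ × ℤ => normTerm r a q.1 * normTerm r b q.2 :=
    ha.mul_of_nonneg hb (normTerm_nonneg r a) (normTerm_nonneg r b)
  have h2 := convEquiv.summable_iff.2 h1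
  have h3 : ∀ m, normTerm r (a * b) m ≤
      ∑' k, ((fun q : ℤ × ℤ => normTerm r a q.1 * normTerm r b q.2) ∘ convEquiv) (m, k) := by
    intro m
    have hs := h2.prod_factor m
    have hm : HasSum (fun k : ℤ => ((a.coeff k * b.coeff (m - k) : ℤ) : ℝ))
        (((a * b).coeff m : ℤ) : ℝ) :=
      (hasSum_coeff_mul a b m).map (Int.castAddHom ℝ) continuous_of_discreteTopology
    have hm' := hm.mul_right ((r : ℝ) ^ m)
    have habs : ∀ k, ‖((a.coeff k * b.coeff (m - k) : ℤ) : ℝ) * (r : ℝ) ^ m‖ =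
        ((fun q : ℤ × ℤ => normTerm r a q.1 * normTerm r b q.2) ∘ convEquiv) (m, k) := by
      intro k
      simp only [normTerm, convEquiv, Function.comp, Equiv.coe_fn_mk, Int.cast_mul, norm_mul,
        Real.norm_eq_abs]
      rw [abs_of_pos (zpow_pos r.2.1 m), zpow_sub₀ hr]
      field_simp
    calc normTerm r (a * b) m = ‖((a * b).coeff m : ℝ) * (r : ℝ) ^ m‖ := by
          rw [norm_mul, Real.norm_eq_abs, Real.norm_eq_abs, abs_of_pos (zpow_pos r.2.1 m), normTerm]
      _ = ‖∑' k, ((a.coeff k * b.coeff (m - k) : ℤ) : ℝ) * (r : ℝ) ^ m‖ := by rw [hm'.tsum_eq]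
      _ ≤ ∑' k, ‖((a.coeff k * b.coeff (m - k) : ℤ) : ℝ) * (r : ℝ) ^ m‖ :=
          norm_tsum_le_tsum_norm (by simpa only [habs] using hs)
      _ = _ := by simp only [habs]
  have h4 : Summable (normTerm r (a * b)) :=
    Summable.of_nonneg_of_le (normTerm_nonneg r _) h3 h2.prod
  refine ⟨h4, (h4.tsum_le_tsum h3 h2.prod).trans (le_of_eq ?_)⟩
  rw [ha.tsum_mul_tsum hb h1, ← h2.tsum_prod]
  exact convEquiv.tsum_eq fun q : ℤ × ℤ => normTerm r a q.1 * normTerm r b q.2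

/-- The subring of all Laurent series `∑ a_n T^n` over `ℤ` with `∑ |a_n| r^n < ∞`. -/
def ztrSubring : Subring (LaurentSeries ℤ) where
  carrier := {a | Summable fun n : ℤ => |(a.coeff n : ℝ)| * (r : ℝ) ^ n}
  zero_mem' := by simp
  one_mem' := by
    refine summable_of_ne_finset_zero (s := {0}) fun n hn => ?_
    simp only [Finset.mem_singleton] at hn
    simp [HahnSeries.coeff_one, hn]
  neg_mem' {a} ha := by simpa using ha
  add_mem' {a b} ha hb := by
    refine Summable.of_nonneg_of_le (fun n => normTerm_nonneg r (a + b) n) (fun n => ?_)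
      (Summable.add ha hb)
    simp only [HahnSeries.coeff_add, Int.cast_add, ← add_mul]
    exact mul_le_mul_of_nonneg_right (abs_add_le _ _) (zpow_nonneg r.2.1.le _)
  mul_mem' {a b} ha hb := (normTerm_mul_le r a b ha hb).1

/-- The ring `ℤ((T))_r`. -/
def ZTr : Type := ztrSubring r

namespace ZTr

noncomputable instance : CommRing (ZTr r) := inferInstanceAs (CommRing (ztrSubring r))

variable {r}

/-- The coefficient of `T^n`. -/
def coeff (a : ZTr r) (n : ℤ) : ℤ := a.1.coeff n

/-- The norm `∑ |a_n| r^n`. -/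
noncomputable def norm (a : ZTr r) : ℝ := ∑' n : ℤ, |(a.coeff n : ℝ)| * (r : ℝ) ^ n

theorem summable (a : ZTr r) : Summable fun n : ℤ => |(a.coeff n : ℝ)| * (r : ℝ) ^ n := a.2

theorem norm_nonneg (a : ZTr r) : 0 ≤ a.norm := tsum_nonneg fun n => normTerm_nonneg r a.1 n

theorem coeff_add (a b : ZTr r) (n : ℤ) : (a + b).coeff n = a.coeff n + b.coeff n := rfl

theorem hasSum_mul (a b : ZTr r) (m : ℤ) :
    HasSum (fun k : ℤ => a.coeff k * b.coeff (m - k)) ((a * b).coeff m) :=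
  hasSum_coeff_mul a.1 b.1 m

theorem norm_zero : (0 : ZTr r).norm = 0 := by
  have : ∀ n, (0 : ZTr r).coeff n = 0 := fun _ => rfl
  simp [norm, this]

theorem norm_add_le (a b : ZTr r) : (a + b).norm ≤ a.norm + b.norm := by
  rw [norm, norm, norm, ← a.summable.tsum_add b.summable]
  refine (a + b).summable.tsum_le_tsum (fun n => ?_) (a.summable.add b.summable)
  rw [coeff_add, Int.cast_add, ← add_mul]
  exact mul_le_mul_of_nonneg_right (abs_add_le _ _) (zpow_nonneg r.2.1.le _)

theorem norm_mul_le (a b : ZTr r) : (a * b).norm ≤ a.norm * b.norm :=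
  (normTerm_mul_le r a.1 b.1 a.2 b.2).2

theorem abs_coeff_mul_le (a : ZTr r) (n : ℤ) : |(a.coeff n : ℝ)| * (r : ℝ) ^ n ≤ a.norm :=
  a.summable.le_tsum n fun m _ => normTerm_nonneg r a.1 m

theorem coeff_eq_zero {a : ZTr r} {c : ℝ} (ha : a.norm ≤ c) {n : ℤ} (hn : c < (r : ℝ) ^ n) :
    a.coeff n = 0 := by
  by_contra h
  have h1 : (1 : ℝ) ≤ |(a.coeff n : ℝ)| := by exact_mod_cast Int.one_le_abs h
  have h2 := (abs_coeff_mul_le a n).trans ha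
  nlinarith [zpow_pos r.2.1 n]

/-- The coefficients of elements of norm at most `c` vanish uniformly in low degrees. -/
theorem exists_bound (r : Set.Ioo (0 : ℝ) 1) (c : ℝ) :
    ∃ N : ℕ, ∀ n : ℤ, n < -N → c < (r : ℝ) ^ n := by
  obtain ⟨N, hN⟩ := pow_unbounded_of_one_lt c ((one_lt_inv₀ r.2.1).2 r.2.2)
  refine ⟨N, fun n hn => hN.trans_le ?_⟩
  rw [inv_pow, ← zpow_natCast, ← zpow_neg]
  exact zpow_le_zpow_right_of_le_one₀ r.2.1 r.2.2.le hn.le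

/-- The topology of coefficientwise convergence. -/
instance : TopologicalSpace (ZTr r) := TopologicalSpace.induced (fun a n => a.coeff n) inferInstance

theorem continuous_coeff (n : ℤ) : Continuous fun a : ZTr r => a.coeff n :=
  (continuous_apply n).comp (continuous_induced_dom (f := fun (a : ZTr r) (n : ℤ) => a.coeff n))

instance : BallRing (ZTr r) where
  ball c := {a | a.norm ≤ c}
  mono _ _ h _ ha := le_trans ha h
  exists_mem a := ⟨a.norm, le_refl a.norm⟩
  add_mem c d := ⟨c + d, fun a ha b hb => (norm_add_le a b).trans (add_le_add ha hb)⟩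
  mul_mem c d := ⟨c * d, fun a ha b hb => (norm_mul_le a b).trans
    (mul_le_mul ha hb b.norm_nonneg (a.norm_nonneg.trans ha))⟩
  continuous_add := by
    refine continuous_induced_rng.2 (continuous_pi fun n => ?_)
    exact ((continuous_coeff n).comp continuous_fst).add ((continuous_coeff n).comp continuous_snd)
  continuousOn_mul c d := by
    refine (Topology.IsInducing.mk rfl).continuousOn_iff.2 (continuousOn_pi.2 fun m => ?_)
    obtain ⟨N, hN⟩ := exists_bound r c
    obtain ⟨N', hN'⟩ := exists_bound r d
    have : ContinuousOn (fun x : ZTr r × ZTr r =>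
        ∑ k ∈ Finset.Icc (-(N : ℤ)) (m + N'), x.1.coeff k * x.2.coeff (m - k))
        ({a | a.norm ≤ c} ×ˢ {a | a.norm ≤ d}) := by
      refine Continuous.continuousOn (continuous_finsetSum _ fun k _ => ?_)
      exact ((continuous_coeff k).comp continuous_fst).mul
        ((continuous_coeff (m - k)).comp continuous_snd)
    refine this.congr fun x hx => ?_
    refine (hasSum_mul x.1 x.2 m).unique (hasSum_sum_of_ne_finset_zero fun k hk => ?_)
    rw [Finset.mem_Icc, not_and_or, not_le, not_le] at hk
    rcases hk with hk | hk
    · rw [coeff_eq_zero hx.1 (hN k hk), zero_mul]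
    · rw [coeff_eq_zero hx.2 (hN' (m - k) (by omega)), mul_zero]

/-! #### Evaluation homomorphisms -/

section Eval

variable {A : Type} [NormedCommRing A]

/-- A summable bound for the terms of `∑ a_k x^k`, for all `a` of norm at most `c`. -/
noncomputable def evalBound (r : Set.Ioo (0 : ℝ) 1) (x : Aˣ) (c : ℝ) (k : ℤ) : ℝ :=
  open Classical in
  if c < (r : ℝ) ^ k then 0 else |c| * ((r : ℝ) ^ (-k) * ‖((x ^ k : Aˣ) : A)‖)

theorem norm_term_le (x : Aˣ) {a : ZTr r} {c : ℝ} (ha : a.norm ≤ c) (k : ℤ) :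
    ‖a.coeff k • ((x ^ k : Aˣ) : A)‖ ≤ evalBound r x c k := by
  unfold evalBound
  split_ifs with h
  · rw [coeff_eq_zero ha h, zero_smul, _root_.norm_zero]
  · refine (norm_zsmul_le _ _).trans ?_
    rw [← mul_assoc]
    refine mul_le_mul_of_nonneg_right ?_ (_root_.norm_nonneg _)
    have h2 := ((abs_coeff_mul_le a k).trans ha).trans (le_abs_self c)
    rw [zpow_neg, ← div_eq_mul_inv, le_div_iff₀ (zpow_pos r.2.1 k)]
    simpa [Int.norm_eq_abs] using h2

theorem summable_evalBound {x : Aˣ}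
    (hx : Summable fun k : ℕ => ‖(x : A) ^ k‖ * ((r : ℝ)⁻¹) ^ k) (c : ℝ) :
    Summable (evalBound r x c) := by
  refine Summable.of_nat_of_neg ?_ ?_
  · refine Summable.of_nonneg_of_le (fun k => ?_) (fun k => ?_) (hx.mul_left |c|)
    · unfold evalBound
      split_ifs
      · exact le_rfl
      · have := zpow_nonneg r.2.1.le (-(k : ℤ))
        positivity
    · unfold evalBound
      split_ifs
      · have := inv_nonneg.2 r.2.1.le
        positivity
      · rw [zpow_neg, zpow_natCast, zpow_natCast, inv_pow, Units.val_pow_eq_pow_val]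
        exact le_of_eq (by ring)
  · obtain ⟨N, hN⟩ := exists_bound r c
    refine summable_of_ne_finset_zero (s := Finset.range (N + 1)) fun k hk => ?_
    rw [Finset.mem_range, not_lt] at hk
    unfold evalBound
    rw [if_pos (hN _ (by omega))]

theorem summable_eval (x : Aˣ) (hx : Summable fun k : ℕ => ‖(x : A) ^ k‖ * ((r : ℝ)⁻¹) ^ k)
    (a : ZTr r) : Summable fun k : ℤ => ‖a.coeff k • ((x ^ k : Aˣ) : A)‖ :=
  Summable.of_nonneg_of_le (fun _ => _root_.norm_nonneg _) (norm_term_le x (le_refl a.norm))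
    (summable_evalBound hx _)

variable [CompleteSpace A] (x : Aˣ)
  (hx : Summable fun k : ℕ => ‖(x : A) ^ k‖ * ((r : ℝ)⁻¹) ^ k)

/-- The ring homomorphism `∑ a_k T^k ↦ ∑ a_k x^k` to a complete normed ring. -/
noncomputable def eval : ZTr r →+* A where
  toFun a := ∑' k : ℤ, a.coeff k • ((x ^ k : Aˣ) : A)
  map_one' := by
    rw [tsum_eq_single 0]
    · have : (1 : ZTr r).coeff 0 = 1 := HahnSeries.coeff_one.trans (if_pos rfl)
      simp [this]
    · intro k hk
      have : (1 : ZTr r).coeff k = 0 := HahnSeries.coeff_one.trans (if_neg hk)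
      simp [this]
  map_zero' := by
    have : ∀ n, (0 : ZTr r).coeff n = 0 := fun _ => rfl
    simp [this]
  map_add' a b := by
    rw [← (summable_eval x hx a).of_norm.tsum_add (summable_eval x hx b).of_norm]
    simp only [coeff_add, add_smul]
  map_mul' a b := by
    have ha := summable_eval x hx a
    have hb := summable_eval x hx b
    rw [tsum_mul_tsum_of_summable_norm ha hb, ← convEquiv.tsum_eq]
    have hs := convEquiv.summable_iff.2 (summable_mul_of_summable_norm ha hb)
    refine Eq.trans ?_ hs.tsum_prod.symm
    refine tsum_congr fun m => ?_
    have hm := (hasSum_mul a b m).map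
      ((smulAddHom ℤ A).flip ((x ^ m : Aˣ) : A)) continuous_of_discreteTopology
    refine hm.tsum_eq.symm.trans (tsum_congr fun k => ?_)
    simp only [convEquiv, Function.comp, Equiv.coe_fn_mk, AddMonoidHom.flip_apply,
      smulAddHom_apply]
    rw [smul_mul_smul_comm, ← Units.val_mul, ← zpow_add, add_sub_cancel]

theorem eval_continuousOn (c : ℝ) : ContinuousOn (eval x hx) (BallRing.ball c) := by
  refine continuousOn_tsum (fun k => ?_) (summable_evalBound hx c)
    (fun k a (ha : a.norm ≤ c) => norm_term_le x ha k)
  refine Continuous.continuousOn ?_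
  exact (continuous_of_discreteTopology (f := fun n : ℤ => n • ((x ^ k : Aˣ) : A))).comp
    (continuous_coeff k)

theorem eval_mapsTo (c : ℝ) :
    ∃ d, Set.MapsTo (eval x hx) (BallRing.ball c) (BallRing.ball (A := A) d) := by
  refine ⟨∑' k, evalBound r x c k, fun a (ha : a.norm ≤ c) => ?_⟩
  exact tsum_of_norm_bounded (summable_evalBound hx c).hasSum (norm_term_le x ha)

/-- The morphism of condensed rings given by `∑ a_k T^k ↦ ∑ a_k x^k`. -/
noncomputable def condEval : condRing.{u} (ZTr r) ⟶ condRing.{u} A :=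
  condRing.map (eval x hx) (eval_continuousOn x hx) (eval_mapsTo x hx)

end Eval

end ZTr

end ZTr
/-! ### The truncated polynomial rings `ℝ[X]/X^n` -/

/-- The ring `ℝ[X]/X^n`. -/
def TruncPoly (n : ℕ) : Type := ℝ[X] ⧸ Ideal.span {(Polynomial.X : ℝ[X]) ^ n}

/-- The power series `[x] = x |x|^X = ∑ x (log |x|)^k / k! X^k`. -/
noncomputable def teichSeries (x : ℝ) : PowerSeries ℝ :=
  PowerSeries.mk fun k => x * Real.log |x| ^ k / (k.factorial : ℝ)

theorem teichSeries_eq (x : ℝ) :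
    teichSeries x = PowerSeries.C x * PowerSeries.rescale (Real.log |x|) (PowerSeries.exp ℝ) := by
  ext k
  simp [teichSeries, PowerSeries.coeff_rescale, PowerSeries.coeff_exp]
  ring

theorem teichSeries_zero : teichSeries 0 = 0 := by
  ext k
  simp [teichSeries]

theorem teichSeries_one : teichSeries 1 = 1 := by
  ext k
  rcases k with _ | k <;> simp [teichSeries, PowerSeries.coeff_one]

theorem teichSeries_mul (x y : ℝ) : teichSeries (x * y) = teichSeries x * teichSeries y := by
  rcases eq_or_ne x 0 with rfl | hx
  · simp [teichSeries_zero]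
  rcases eq_or_ne y 0 with rfl | hy
  · simp [teichSeries_zero]
  rw [teichSeries_eq, teichSeries_eq, teichSeries_eq, abs_mul,
    Real.log_mul (abs_ne_zero.2 hx) (abs_ne_zero.2 hy), ← PowerSeries.exp_mul_exp_eq_exp_add,
    map_mul]
  ring

theorem continuous_mul_log_pow (k : ℕ) : Continuous fun x : ℝ => x * Real.log |x| ^ k := by
  rcases Nat.eq_zero_or_pos k with rfl | hk
  · simpa using continuous_id'
  have hk' : (k : ℝ) ≠ 0 := by positivity
  rw [continuous_iff_continuousAt]
  intro x
  rcases eq_or_ne x 0 with rfl | hx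
  · have h1 : Continuous fun x : ℝ => |(k : ℝ) * (|x| ^ (1 / k : ℝ) *
        Real.log (|x| ^ (1 / k : ℝ)))| ^ k := by
      refine (Continuous.abs (continuous_const.mul (Real.continuous_mul_log.comp ?_))).pow k
      exact continuous_abs.rpow_const fun _ => Or.inr (by positivity)
    have h2 : ∀ x : ℝ, |(k : ℝ) * (|x| ^ (1 / k : ℝ) * Real.log (|x| ^ (1 / k : ℝ)))| ^ k =
        |x * Real.log |x| ^ k| := by
      intro x
      rcases eq_or_ne x 0 with rfl | hx
      · simp [hk.ne', hk']
      · have hx' := abs_pos.2 hx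
        rw [Real.log_rpow hx', show (k : ℝ) * (|x| ^ (1 / k : ℝ) * (1 / k * Real.log |x|)) =
          |x| ^ (1 / k : ℝ) * Real.log |x| by field_simp, abs_mul, mul_pow, abs_mul, abs_pow,
          abs_of_pos (Real.rpow_pos_of_pos hx' _), ← Real.rpow_natCast, ← Real.rpow_mul hx'.le]
        simp [hk']
    have h3 := h1.tendsto 0
    simp only [h2] at h3
    have h4 : |(0 : ℝ) * Real.log |(0 : ℝ)| ^ k| = 0 := by simp
    rw [h4] at h3
    have h5 := (tendsto_zero_iff_abs_tendsto_zero _).2 h3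
    unfold ContinuousAt
    simpa using h5
  · refine continuousAt_id.mul (ContinuousAt.pow ?_ k)
    exact (Real.continuousAt_log (abs_ne_zero.2 hx)).comp continuous_abs.continuousAt

/-- The `k`-th coefficient of `[x]`, as a function of `x`. -/
noncomputable def teichCoeff (k : ℕ) (x : ℝ) : ℝ := x * Real.log |x| ^ k / (k.factorial : ℝ)

theorem continuous_teichCoeff (k : ℕ) : Continuous (teichCoeff k) :=
  (continuous_mul_log_pow k).div_const _

/-- The coordinates `x_i` in the expansion `∑ [x_i] X^i` of a power series with coefficients `f`. -/
noncomputable def teichCoord (f : ℕ → ℝ) (j : ℕ) : ℝ :=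
  f j - ∑ i : Fin j, teichCoeff (j - i) (teichCoord f i)
termination_by j
decreasing_by exact i.2

theorem continuous_teichCoord {T : Type*} [TopologicalSpace T] {f : T → ℕ → ℝ}
    (hf : ∀ j, Continuous fun t => f t j) (j : ℕ) : Continuous fun t => teichCoord (f t) j := by
  induction j using Nat.strong_induction_on with
  | _ j ih =>
    have : (fun t => teichCoord (f t) j) =
        fun t => f t j - ∑ i : Fin j, teichCoeff (j - i) (teichCoord (f t) i) := by
      funext t
      rw [teichCoord]
    rw [this]
    exact (hf j).sub (continuous_finsetSum _ fun i _ =>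
      (continuous_teichCoeff _).comp (ih i i.2))

namespace TruncPoly

variable {n : ℕ}

noncomputable instance : CommRing (TruncPoly n) :=
  inferInstanceAs (CommRing (ℝ[X] ⧸ Ideal.span {(Polynomial.X : ℝ[X]) ^ n}))

/-- The projection `ℝ[X] → ℝ[X]/X^n`. -/
noncomputable def mk (n : ℕ) : ℝ[X] →+* TruncPoly n :=
  Ideal.Quotient.mk (Ideal.span {(Polynomial.X : ℝ[X]) ^ n})

theorem mk_surjective : Function.Surjective (mk n) := Ideal.Quotient.mk_surjective

theorem mk_eq_mk {P Q : ℝ[X]} : mk n P = mk n Q ↔ ∀ j < n, P.coeff j = Q.coeff j := by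
  refine Ideal.Quotient.eq.trans ?_
  rw [Ideal.mem_span_singleton, Polynomial.X_pow_dvd_iff]
  simp only [Polynomial.coeff_sub, sub_eq_zero]

/-- The coefficient of `X^j`, for `j < n`. -/
noncomputable def coeff (j : Fin n) : TruncPoly n →+ ℝ :=
  QuotientAddGroup.lift (Ideal.span {(Polynomial.X : ℝ[X]) ^ n}).toAddSubgroup
    (Polynomial.lcoeff ℝ j).toAddMonoidHom (by
      intro P hP
      exact Polynomial.X_pow_dvd_iff.1 (Ideal.mem_span_singleton.1 hP) j j.2)

theorem coeff_mk (j : Fin n) (P : ℝ[X]) : coeff j (mk n P) = P.coeff j := rfl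

theorem ext {z w : TruncPoly n} (h : ∀ j, coeff j z = coeff j w) : z = w := by
  obtain ⟨P, rfl⟩ := mk_surjective z
  obtain ⟨Q, rfl⟩ := mk_surjective w
  exact mk_eq_mk.2 fun j hj => h ⟨j, hj⟩

/-- The projection `ℝ⟦X⟧ → ℝ[X]/X^n`. -/
noncomputable def ofPowerSeries (n : ℕ) : PowerSeries ℝ →+* TruncPoly n where
  toFun f := mk n (PowerSeries.trunc n f)
  map_one' := by
    rw [← map_one (mk n), mk_eq_mk]
    intro j hj
    rw [PowerSeries.coeff_trunc, if_pos hj, PowerSeries.coeff_one, Polynomial.coeff_one]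
  map_zero' := by simp
  map_add' f g := by simp
  map_mul' f g := by
    rw [← map_mul, mk_eq_mk]
    intro j hj
    rw [PowerSeries.coeff_trunc, if_pos hj, PowerSeries.coeff_mul, Polynomial.coeff_mul]
    refine Finset.sum_congr rfl fun q hq => ?_
    rw [Finset.HasAntidiagonal.mem_antidiagonal] at hq
    rw [PowerSeries.coeff_trunc, PowerSeries.coeff_trunc, if_pos (by omega), if_pos (by omega)]

theorem coeff_ofPowerSeries (j : Fin n) (f : PowerSeries ℝ) :
    coeff j (ofPowerSeries n f) = PowerSeries.coeff j f := by
  change coeff j (mk n _) = _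
  rw [coeff_mk, PowerSeries.coeff_trunc, if_pos j.2]

/-- The power series with coefficients `a_j` for `j < n` and `0` for `j ≥ n`. -/
noncomputable def series (a : Fin n → ℝ) : PowerSeries ℝ :=
  PowerSeries.mk fun j => if h : j < n then a ⟨j, h⟩ else 0

theorem coeff_series (a : Fin n → ℝ) (j : Fin n) : PowerSeries.coeff j (series a) = a j := by
  simp [series]

theorem ofPowerSeries_series (z : TruncPoly n) :
    ofPowerSeries n (series fun j => coeff j z) = z :=
  ext fun j => by rw [coeff_ofPowerSeries, coeff_series]

/-- The coefficients identify `ℝ[X]/X^n` with `ℝ^n`. -/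
noncomputable def toPiLp (n : ℕ) : TruncPoly n →+ PiLp 1 (fun _ : Fin n => ℝ) where
  toFun z := WithLp.toLp 1 fun j => coeff j z
  map_zero' := by ext; simp
  map_add' _ _ := by ext; simp

theorem toPiLp_injective : Function.Injective (toPiLp n) := fun _ _ h =>
  ext fun j => congrArg (fun v : PiLp 1 (fun _ : Fin n => ℝ) => v j) h

theorem toPiLp_surjective : Function.Surjective (toPiLp n) := fun v =>
  ⟨ofPowerSeries n (series fun j => v j), by
    ext j
    change coeff j _ = _
    rw [coeff_ofPowerSeries, coeff_series]⟩

theorem sum_antidiagonal_le (n : ℕ) (F : ℕ × ℕ → ℝ) (hF : ∀ q, 0 ≤ F q) :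
    ∑ j ∈ Finset.range n, ∑ q ∈ Finset.HasAntidiagonal.antidiagonal j, F q ≤
      ∑ q ∈ Finset.range n ×ˢ Finset.range n, F q := by
  rw [← Finset.sum_biUnion]
  · refine Finset.sum_le_sum_of_subset_of_nonneg (fun q hq => ?_) fun q _ _ => hF q
    simp only [Finset.mem_biUnion, Finset.mem_range, Finset.HasAntidiagonal.mem_antidiagonal] at hq
    obtain ⟨j, hj, hq⟩ := hq
    simp only [Finset.mem_product, Finset.mem_range]
    omega
  · intro i _ j _ hij
    refine Finset.disjoint_left.2 fun q hq hq' => hij ?_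
    rw [Finset.HasAntidiagonal.mem_antidiagonal] at hq hq'
    omega

/-- The norm `∑ |z_j|` of the coefficients, which defines the usual topology of the
finite-dimensional real vector space `ℝ[X]/X^n`. -/
noncomputable instance : NormedAddCommGroup (TruncPoly n) :=
  NormedAddCommGroup.induced _ _ (toPiLp n) toPiLp_injective

theorem norm_eq (z : TruncPoly n) : ‖z‖ = ∑ j, |coeff j z| :=
  PiLp.norm_eq_of_L1 (toPiLp n z)

theorem norm_mul_le' (z w : TruncPoly n) : ‖z * w‖ ≤ ‖z‖ * ‖w‖ := by
  set f := series fun j => coeff j z with hf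
  set g := series fun j => coeff j w with hg
  have h1 : ∀ u : PowerSeries ℝ, ‖ofPowerSeries n u‖ =
      ∑ j ∈ Finset.range n, |PowerSeries.coeff j u| := by
    intro u
    rw [norm_eq, Finset.sum_range]
    simp only [coeff_ofPowerSeries]
  rw [← ofPowerSeries_series z, ← ofPowerSeries_series w, ← map_mul, h1, h1, h1,
    Finset.sum_mul_sum, ← Finset.sum_product']
  refine le_trans (Finset.sum_le_sum fun j _ => ?_)
    (sum_antidiagonal_le n (fun q => |PowerSeries.coeff q.1 f| * |PowerSeries.coeff q.2 g|)
      fun q => by positivity)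
  rw [PowerSeries.coeff_mul]
  refine (Finset.abs_sum_le_sum_abs _ _).trans (le_of_eq ?_)
  simp only [abs_mul, hf, hg]

noncomputable instance : NormedCommRing (TruncPoly n) :=
  { (inferInstance : NormedAddCommGroup (TruncPoly n)),
    (inferInstance : CommRing (TruncPoly n)) with
    norm_mul_le := norm_mul_le' }

instance : CompleteSpace (TruncPoly n) :=
  ((IsUniformInducing.mk rfl : IsUniformInducing (toPiLp n)).completeSpace_congr
    toPiLp_surjective).2 inferInstance

end TruncPoly
/-! ### Gauges given by norms on the ring -/

theorem sum_norm_add_le {A I : Type*} [CommRing A] (N : A → ℝ) (h0 : N 0 = 0)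
    (hadd : ∀ a b, N (a + b) ≤ N a + N b) (x y : I →₀ A) :
    ((x + y).sum fun _ a => N a) ≤ (x.sum fun _ a => N a) + y.sum fun _ a => N a := by
  classical
  rw [Finsupp.sum_of_support_subset (x + y) Finsupp.support_add _ fun _ _ => h0,
    Finsupp.sum_of_support_subset x Finset.subset_union_left _ fun _ _ => h0,
    Finsupp.sum_of_support_subset y Finset.subset_union_right _ fun _ _ => h0,
    ← Finset.sum_add_distrib]
  exact Finset.sum_le_sum fun i _ => hadd _ _

theorem sum_norm_smul_le {A I : Type*} [CommRing A] (N : A → ℝ) (h0 : N 0 = 0) {a : A} {K : ℝ}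
    (hmul : ∀ b, N (a * b) ≤ K * N b) (x : I →₀ A) :
    ((a • x).sum fun _ b => N b) ≤ K * x.sum fun _ b => N b := by
  rw [Finsupp.sum_of_support_subset (a • x) Finsupp.support_smul _ fun _ _ => h0,
    Finsupp.sum, Finset.mul_sum]
  exact Finset.sum_le_sum fun i _ => hmul _

theorem le_sum_norm {A I : Type*} [CommRing A] (N : A → ℝ) (h0 : N 0 = 0) (hN : ∀ a, 0 ≤ N a)
    (x : I →₀ A) (s : I) : N (x s) ≤ x.sum fun _ a => N a := by
  by_cases hs : s ∈ x.support
  · exact Finset.single_le_sum (f := fun s => N (x s)) (fun i _ => hN _) hs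
  · rw [Finsupp.notMem_support_iff.1 hs, h0]
    exact Finset.sum_nonneg fun i _ => hN _

/-- The gauge with `ball I c = {∑ a_s [s] | ∑ N(a_s) ≤ c}`. -/
def Gauge.ofNorm {A : Type} [CommRing A] [TopologicalSpace A] [BallRing A] (N : A → ℝ)
    (h0 : N 0 = 0) (hN : ∀ a, 0 ≤ N a) (hadd : ∀ a b, N (a + b) ≤ N a + N b)
    (hmul : ∀ c, ∃ K, 0 ≤ K ∧ ∀ a ∈ BallRing.ball (A := A) c, ∀ b, N (a * b) ≤ K * N b)
    (hcoord : ∀ c, ∃ d, ∀ a, N a ≤ c → a ∈ BallRing.ball (A := A) d) : Gauge.{u} A where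
  ball I c := {x | (x.sum fun _ a => N a) ≤ c}
  mono _ _ _ h _ hx := le_trans hx h
  zero_mem := ⟨0, fun _ => le_of_eq (Finsupp.sum_zero_index (h := fun _ a => N a))⟩
  add_mem c d := ⟨c + d, fun _ x hx y hy =>
    (sum_norm_add_le N h0 hadd x y).trans (add_le_add hx hy)⟩
  coord_mem c := (hcoord c).imp fun _ h _ _ x hx s => h _ ((le_sum_norm N h0 hN x s).trans hx)
  smul_mem c d := by
    obtain ⟨K, hK, h⟩ := hmul c
    exact ⟨K * d, fun _ a ha x hx => (sum_norm_smul_le N h0 (h a ha) x).trans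
      (mul_le_mul_of_nonneg_left hx hK)⟩

/-- The gauge `ℤ((T))_r[I]_{≤ c} = {∑ a_s [s] | ∑ ‖a_s‖ ≤ c}` with `‖∑ a_n T^n‖ = ∑ |a_n| r^n`. -/
noncomputable def ztrGauge (r : Set.Ioo (0 : ℝ) 1) : Gauge.{u} (ZTr r) :=
  Gauge.ofNorm ZTr.norm ZTr.norm_zero ZTr.norm_nonneg ZTr.norm_add_le
    (fun c => ⟨|c|, abs_nonneg c, fun a ha b => (ZTr.norm_mul_le a b).trans
      (mul_le_mul_of_nonneg_right (le_trans ha (le_abs_self c)) b.norm_nonneg)⟩)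
    (fun c => ⟨c, fun _ h => h⟩)

/-- The gauge `ℝ[I]_{ℓ^p ≤ c} = {∑ a_s [s] | ∑ |a_s|^p ≤ c}`. -/
noncomputable def lpGauge (p : Set.Ioo (0 : ℝ) 1) : Gauge.{u} ℝ :=
  Gauge.ofNorm (fun a => |a| ^ (p : ℝ)) (by simp [p.2.1.ne'])
    (fun a => by positivity)
    (fun a b => (Real.rpow_le_rpow (abs_nonneg _) (abs_add_le a b) p.2.1.le).trans
      (Real.rpow_add_le_add_rpow (abs_nonneg a) (abs_nonneg b) p.2.1.le p.2.2.le))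
    (fun c => ⟨|c| ^ (p : ℝ), by positivity, fun a (ha : |a| ≤ c) b => by
      rw [abs_mul, Real.mul_rpow (abs_nonneg a) (abs_nonneg b)]
      exact mul_le_mul_of_nonneg_right (Real.rpow_le_rpow (abs_nonneg a)
        (ha.trans (le_abs_self c)) p.2.1.le) (by positivity)⟩)
    (fun c => ⟨c ^ (1 / p : ℝ), fun a ha => by
      change |a| ≤ _
      rw [← Real.rpow_inv_rpow (abs_nonneg a) p.2.1.ne', one_div]
      rw [Real.rpow_inv_rpow (abs_nonneg a) p.2.1.ne', ← Real.rpow_rpow_inv (abs_nonneg a) p.2.1.ne']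
      exact Real.rpow_le_rpow (by positivity) ha (inv_nonneg.2 p.2.1.le)⟩)

/-! ### The gauge of `ℝ[X]/X^n` -/

namespace TruncPoly

variable {n : ℕ}

/-- The element `[x] = x |x|^X` of `ℝ[X]/X^n`. -/
noncomputable def teich (n : ℕ) (x : ℝ) : TruncPoly n := ofPowerSeries n (teichSeries x)

/-- The element `∑ [x_i] X^i` of `ℝ[X]/X^n`. -/
noncomputable def expand (x : Fin n → ℝ) : TruncPoly n :=
  ∑ i : Fin n, teich n (x i) * mk n Polynomial.X ^ (i : ℕ)

/-- The subset `{(∑ [x_{i,s}] X^i)_s | ∑ |x_{i,s}|^p ≤ c}` of `(ℝ[X]/X^n)[I]`, for `I` finite. -/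
def lpBall (n : ℕ) (p : ℝ) (I : Type*) [Fintype I] (c : ℝ) : Set (I →₀ TruncPoly n) :=
  {z | ∃ x : I → Fin n → ℝ, (∀ s, z s = expand (x s)) ∧ ∑ s, ∑ i, |x s i| ^ p ≤ c}

/-- The elements of `(ℝ[X]/X^n)[I]` whose images under all maps from `I` to finite sets
lie in the `ℓ^p ≤ c`-subsets. -/
def stableBall (n : ℕ) (p : ℝ) (I : Type*) (c : ℝ) : Set (I →₀ TruncPoly n) :=
  {z | ∀ (m : ℕ) (g : I → Fin m), z.mapDomain g ∈ lpBall n p (Fin m) c}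

theorem coeff_expand (x : Fin n → ℝ) (j : Fin n) :
    coeff j (expand x) = ∑ i : Fin n, if i ≤ j then teichCoeff (j - i) (x i) else 0 := by
  rw [expand, map_sum]
  refine Finset.sum_congr rfl fun i _ => ?_
  have hX : mk n Polynomial.X ^ (i : ℕ) = ofPowerSeries n (PowerSeries.X ^ (i : ℕ)) := by
    rw [← map_pow]
    refine ext fun k => ?_
    rw [coeff_mk, coeff_ofPowerSeries, Polynomial.coeff_X_pow, PowerSeries.coeff_X_pow]
  rw [teich, hX, ← map_mul, coeff_ofPowerSeries, PowerSeries.coeff_mul_X_pow']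
  simp only [teichSeries, PowerSeries.coeff_mk, teichCoeff, Fin.le_iff_val_le_val]

theorem expand_teichCoord (f : ℕ → ℝ) :
    expand (fun i : Fin n => teichCoord f i) = ofPowerSeries n (PowerSeries.mk f) := by
  refine ext fun j => ?_
  rw [coeff_expand, coeff_ofPowerSeries, PowerSeries.coeff_mk]
  have h1 : ∑ i : Fin n, (if i ≤ j then teichCoeff (j - i) (teichCoord f i) else 0) =
      ∑ i ∈ Finset.range n, if i ≤ (j : ℕ) then teichCoeff (j - i) (teichCoord f i) else 0 := by
    rw [Finset.sum_range]
    simp only [Fin.le_iff_val_le_val]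
  have h2 : ∑ i ∈ Finset.range n, (if i ≤ (j : ℕ) then teichCoeff (j - i) (teichCoord f i) else 0) =
      ∑ i ∈ Finset.range (j + 1), teichCoeff (j - i) (teichCoord f i) := by
    rw [← Finset.sum_filter]
    refine Finset.sum_congr ?_ fun _ _ => rfl
    ext i
    simp only [Finset.mem_filter, Finset.mem_range]
    have := j.2
    omega
  rw [h1, h2, Finset.sum_range_succ, Finset.sum_range, Nat.sub_self]
  have h3 : teichCoeff 0 (teichCoord f j) = teichCoord f j := by simp [teichCoeff]
  rw [h3]
  conv_lhs => rw [teichCoord.eq_def f j]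
  exact add_sub_cancel _ _

theorem teich_mul_expand (l : ℝ) (x : Fin n → ℝ) :
    teich n l * expand x = expand fun i => l * x i := by
  rw [expand, expand, Finset.mul_sum]
  refine Finset.sum_congr rfl fun i _ => ?_
  rw [← mul_assoc, teich, teich, teich, ← map_mul, teichSeries_mul]

theorem expand_zero : expand (0 : Fin n → ℝ) = 0 := by
  simp [expand, teich, teichSeries_zero]

/-- The coefficients of `a ∑ [x_i] X^i + b ∑ [y_i] X^i`. -/
noncomputable def combCoeff (q : ((Fin n → ℝ) × (Fin n → ℝ)) × ((Fin n → ℝ) × (Fin n → ℝ)))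
    (j : ℕ) : ℝ :=
  PowerSeries.coeff j
    (series q.1.1 * (∑ i : Fin n, teichSeries (q.2.1 i) * PowerSeries.X ^ (i : ℕ)) +
      series q.1.2 * ∑ i : Fin n, teichSeries (q.2.2 i) * PowerSeries.X ^ (i : ℕ))

theorem continuous_coeff_mul {T : Type*} [TopologicalSpace T] {f g : T → PowerSeries ℝ}
    (hf : ∀ j, Continuous fun t => PowerSeries.coeff j (f t))
    (hg : ∀ j, Continuous fun t => PowerSeries.coeff j (g t)) (j : ℕ) :
    Continuous fun t => PowerSeries.coeff j (f t * g t) := by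
  simp only [PowerSeries.coeff_mul]
  exact continuous_finsetSum _ fun q _ => (hf _).mul (hg _)

theorem continuous_coeff_series {T : Type*} [TopologicalSpace T] {a : T → Fin n → ℝ}
    (ha : Continuous a) (j : ℕ) : Continuous fun t => PowerSeries.coeff j (series (a t)) := by
  simp only [series, PowerSeries.coeff_mk]
  split_ifs with h
  · exact (continuous_apply _).comp ha
  · exact continuous_const

theorem continuous_coeff_expand {T : Type*} [TopologicalSpace T] {x : T → Fin n → ℝ}
    (hx : Continuous x) (j : ℕ) : Continuous fun t => PowerSeries.coeff j
      (∑ i : Fin n, teichSeries (x t i) * PowerSeries.X ^ (i : ℕ)) := by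
  simp only [map_sum]
  refine continuous_finsetSum _ fun i _ => continuous_coeff_mul (fun k => ?_)
    (fun k => continuous_const) j
  simp only [teichSeries, PowerSeries.coeff_mk]
  exact (continuous_teichCoeff k).comp ((continuous_apply i).comp hx)

theorem continuous_combCoeff (j : ℕ) : Continuous fun q => combCoeff (n := n) q j := by
  unfold combCoeff
  simp only [map_add]
  exact (continuous_coeff_mul (continuous_coeff_series (by fun_prop))
    (continuous_coeff_expand (by fun_prop)) j).add
    (continuous_coeff_mul (continuous_coeff_series (by fun_prop))
    (continuous_coeff_expand (by fun_prop)) j)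

theorem ofPowerSeries_sum (x : Fin n → ℝ) : ofPowerSeries n
    (∑ i : Fin n, teichSeries (x i) * PowerSeries.X ^ (i : ℕ)) = expand x := by
  rw [expand, map_sum]
  refine Finset.sum_congr rfl fun i _ => ?_
  rw [map_mul, map_pow, teich]
  congr 2
  refine ext fun k => ?_
  rw [coeff_mk, coeff_ofPowerSeries, Polynomial.coeff_X, PowerSeries.coeff_X]
  simp only [eq_comm]

theorem expand_combCoeff (a b : TruncPoly n) (x y : Fin n → ℝ) :
    expand (fun i : Fin n => teichCoord
      (combCoeff ((fun j => coeff j a, fun j => coeff j b), (x, y))) i) =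
      a * expand x + b * expand y := by
  rw [expand_teichCoord]
  have : PowerSeries.mk (combCoeff ((fun j => coeff j a, fun j => coeff j b), (x, y))) =
    series (fun j => coeff j a) *
      (∑ i : Fin n, teichSeries (x i) * PowerSeries.X ^ (i : ℕ)) +
      series (fun j => coeff j b) *
        ∑ i : Fin n, teichSeries (y i) * PowerSeries.X ^ (i : ℕ) := by
    ext j
    rw [PowerSeries.coeff_mk]
    rfl
  rw [this, map_add, map_mul, map_mul, ofPowerSeries_series, ofPowerSeries_series,
    ofPowerSeries_sum, ofPowerSeries_sum]

theorem abs_coeff_le (z : TruncPoly n) (j : Fin n) : |coeff j z| ≤ ‖z‖ := by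
  rw [norm_eq]
  exact Finset.single_le_sum (f := fun j => |coeff j z|) (fun i _ => abs_nonneg _)
    (Finset.mem_univ j)

/-- The `ℓ^p`-quasinorm is compatible with addition and scalar multiplication. -/
theorem exists_comb_bound (n : ℕ) {p : ℝ} (hp : 0 < p) (R : ℝ) : ∃ C, 0 ≤ C ∧
    ∀ a b : TruncPoly n, ‖a‖ ≤ R → ‖b‖ ≤ R → ∀ x y : Fin n → ℝ, ∃ w : Fin n → ℝ,
      a * expand x + b * expand y = expand w ∧
      ∑ i, |w i| ^ p ≤ C * (∑ i, |x i| ^ p + ∑ i, |y i| ^ p) := by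
  let K : Set (((Fin n → ℝ) × (Fin n → ℝ)) × ((Fin n → ℝ) × (Fin n → ℝ))) :=
    (Metric.closedBall 0 R ×ˢ Metric.closedBall 0 R) ×ˢ
      (Metric.closedBall 0 1 ×ˢ Metric.closedBall 0 1)
  have hK : IsCompact K :=
    ((isCompact_closedBall _ _).prod (isCompact_closedBall _ _)).prod
      ((isCompact_closedBall _ _).prod (isCompact_closedBall _ _))
  have hF : Continuous fun q => ∑ i : Fin n, |teichCoord (combCoeff (n := n) q) i| ^ p :=
    continuous_finsetSum _ fun i _ =>
      ((continuous_teichCoord continuous_combCoeff i).abs).rpow_const fun _ => Or.inr hp.le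
  obtain ⟨C, hC⟩ := (hK.image hF).bddAbove
  refine ⟨|C|, abs_nonneg C, fun a b ha hb x y => ?_⟩
  set c := ∑ i, |x i| ^ p + ∑ i, |y i| ^ p with hc
  have hx0 : 0 ≤ ∑ i, |x i| ^ p := Finset.sum_nonneg fun i _ => by positivity
  have hy0 : 0 ≤ ∑ i, |y i| ^ p := Finset.sum_nonneg fun i _ => by positivity
  have hxc : ∀ i, |x i| ^ p ≤ c := fun i =>
    (Finset.single_le_sum (f := fun i => |x i| ^ p) (fun i _ => by positivity)
      (Finset.mem_univ i)).trans (by linarith)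
  have hyc : ∀ i, |y i| ^ p ≤ c := fun i =>
    (Finset.single_le_sum (f := fun i => |y i| ^ p) (fun i _ => by positivity)
      (Finset.mem_univ i)).trans (by linarith)
  rcases (show 0 ≤ c by linarith).eq_or_lt with h0 | h0
  · have hx : x = 0 := by
      funext i
      have := hxc i
      rw [← h0] at this
      have h := (Real.rpow_eq_zero (abs_nonneg (x i)) hp.ne').1
        (le_antisymm this (by positivity))
      exact abs_eq_zero.1 h
    have hy : y = 0 := by
      funext i
      have := hyc i
      rw [← h0] at this
      have h := (Real.rpow_eq_zero (abs_nonneg (y i)) hp.ne').1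
        (le_antisymm this (by positivity))
      exact abs_eq_zero.1 h
    refine ⟨0, by rw [hx, hy, expand_zero, mul_zero, mul_zero, add_zero], ?_⟩
    rw [← h0]
    simp [hp.ne']
  · set l := c ^ p⁻¹ with hl
    have hl0 : 0 < l := Real.rpow_pos_of_pos h0 _
    have hlp : l ^ p = c := Real.rpow_inv_rpow h0.le hp.ne'
    have key : ∀ u : ℝ, |u| ^ p ≤ c → |l⁻¹ * u| ≤ 1 := by
      intro u hu
      have h1 : |u| ≤ l := by
        rw [← Real.rpow_rpow_inv (abs_nonneg u) hp.ne']
        exact Real.rpow_le_rpow (by positivity) hu (inv_nonneg.2 hp.le)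
      rw [abs_mul, abs_of_pos (inv_pos.2 hl0), inv_mul_le_iff₀ hl0, mul_one]
      exact h1
    let x' : Fin n → ℝ := fun i => l⁻¹ * x i
    let y' : Fin n → ℝ := fun i => l⁻¹ * y i
    let q : ((Fin n → ℝ) × (Fin n → ℝ)) × ((Fin n → ℝ) × (Fin n → ℝ)) :=
      ((fun j => coeff j a, fun j => coeff j b), (x', y'))
    have hR : 0 ≤ R := (_root_.norm_nonneg a).trans ha
    have hq : q ∈ K := by
      refine ⟨⟨?_, ?_⟩, ?_, ?_⟩
      · exact mem_closedBall_zero_iff.2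
          ((pi_norm_le_iff_of_nonneg hR).2 fun j => (abs_coeff_le a j).trans ha)
      · exact mem_closedBall_zero_iff.2
          ((pi_norm_le_iff_of_nonneg hR).2 fun j => (abs_coeff_le b j).trans hb)
      · exact mem_closedBall_zero_iff.2
          ((pi_norm_le_iff_of_nonneg zero_le_one).2 fun i => key _ (hxc i))
      · exact mem_closedBall_zero_iff.2
          ((pi_norm_le_iff_of_nonneg zero_le_one).2 fun i => key _ (hyc i))
    have hmul : ∀ u : Fin n → ℝ, teich n l * expand (fun i => l⁻¹ * u i) = expand u := by
      intro u
      rw [teich_mul_expand]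
      congr 1
      funext i
      rw [mul_inv_cancel_left₀ hl0.ne']
    refine ⟨fun i => l * teichCoord (combCoeff q) i, ?_, ?_⟩
    · rw [← teich_mul_expand, expand_combCoeff, mul_add, mul_left_comm, mul_left_comm _ b,
        hmul, hmul]
    · simp only [abs_mul, abs_of_pos hl0, Real.mul_rpow hl0.le (abs_nonneg _), hlp]
      rw [← Finset.mul_sum, mul_comm]
      exact mul_le_mul_of_nonneg_right ((hC ⟨q, hq, rfl⟩).trans (le_abs_self C)) h0.le

theorem exists_norm_expand_le (n : ℕ) {p : ℝ} (hp : 0 < p) (c : ℝ) : ∃ d, ∀ x : Fin n → ℝ,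
    ∑ i, |x i| ^ p ≤ c → ‖expand x‖ ≤ d := by
  have hF : Continuous fun x : Fin n → ℝ => ‖expand x‖ := by
    simp only [norm_eq, coeff_expand]
    refine continuous_finsetSum _ fun j _ => Continuous.abs (continuous_finsetSum _ fun i _ => ?_)
    split_ifs
    · exact (continuous_teichCoeff _).comp (continuous_apply i)
    · exact continuous_const
  obtain ⟨d, hd⟩ :=
    ((isCompact_closedBall (0 : Fin n → ℝ) (|c| ^ p⁻¹)).image hF).bddAbove
  refine ⟨d, fun x hx => hd ⟨x, ?_, rfl⟩⟩
  refine mem_closedBall_zero_iff.2 ((pi_norm_le_iff_of_nonneg (by positivity)).2 fun i => ?_)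
  have h1 : |x i| ^ p ≤ c :=
    (Finset.single_le_sum (f := fun i => |x i| ^ p) (fun i _ => by positivity)
      (Finset.mem_univ i)).trans hx
  rw [Real.norm_eq_abs, ← Real.rpow_rpow_inv (abs_nonneg (x i)) hp.ne']
  exact Real.rpow_le_rpow (by positivity) (h1.trans (le_abs_self c)) (inv_nonneg.2 hp.le)

theorem exists_lpBall_comb (n : ℕ) {p : ℝ} (hp : 0 < p) (R c d : ℝ) : ∃ e, ∀ (m : ℕ)
    (a b : TruncPoly n), ‖a‖ ≤ R → ‖b‖ ≤ R → ∀ z ∈ lpBall n p (Fin m) c,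
      ∀ w ∈ lpBall n p (Fin m) d, a • z + b • w ∈ lpBall n p (Fin m) e := by
  obtain ⟨C, hC, h⟩ := exists_comb_bound n hp R
  refine ⟨C * (c + d), fun m a b ha hb z hz w hw => ?_⟩
  obtain ⟨x, hx, hx'⟩ := hz
  obtain ⟨y, hy, hy'⟩ := hw
  choose v hv hv' using fun s => h a b ha hb (x s) (y s)
  refine ⟨v, fun s => ?_, (Finset.sum_le_sum fun s _ => hv' s).trans ?_⟩
  · rw [← hv, ← hx, ← hy]
    rfl
  · rw [← Finset.mul_sum, Finset.sum_add_distrib]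
    exact mul_le_mul_of_nonneg_left (add_le_add hx' hy') hC

theorem zero_mem_lpBall (n : ℕ) {p : ℝ} (hp : 0 < p) (m : ℕ) : 0 ∈ lpBall n p (Fin m) 0 :=
  ⟨0, fun _ => expand_zero.symm, by simp [hp.ne']⟩

/-- The gauge of `ℝ[X]/X^n` given by the stable `ℓ^p ≤ c`-subsets. -/
def gauge (n : ℕ) (p : Set.Ioo (0 : ℝ) 1) : Gauge.{u} (TruncPoly n) where
  ball I c := stableBall n p I c
  mono _ _ _ h _ hz m g := by
    obtain ⟨x, hx, hx'⟩ := hz m g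
    exact ⟨x, hx, hx'.trans h⟩
  zero_mem := ⟨0, fun I m g => by
    rw [Finsupp.mapDomain_zero]
    exact zero_mem_lpBall n p.2.1 m⟩
  add_mem c d := by
    obtain ⟨e, he⟩ := exists_lpBall_comb n p.2.1 ‖(1 : TruncPoly n)‖ c d
    refine ⟨e, fun I z hz w hw m g => ?_⟩
    have := he m 1 1 le_rfl le_rfl _ (hz m g) _ (hw m g)
    rwa [one_smul, one_smul, ← Finsupp.mapDomain_add] at this
  coord_mem c := by
    obtain ⟨d, hd⟩ := exists_norm_expand_le n p.2.1 c
    refine ⟨d, fun I _ z hz s => ?_⟩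
    obtain ⟨m, ⟨g⟩⟩ := Finite.exists_equiv_fin I
    obtain ⟨x, hx, hx'⟩ := hz m g
    have h1 := hx (g s)
    rw [Finsupp.mapDomain_apply g.injective] at h1
    rw [h1]
    refine hd _ (le_trans ?_ hx')
    exact Finset.single_le_sum (f := fun s => ∑ i, |x s i| ^ (p : ℝ))
      (fun t _ => Finset.sum_nonneg fun i _ => by positivity) (Finset.mem_univ (g s))
  smul_mem c d := by
    obtain ⟨e, he⟩ := exists_lpBall_comb n p.2.1 |c| d 0
    refine ⟨e, fun I a ha z hz m g => ?_⟩
    have := he m a 0 (le_trans ha (le_abs_self c)) (by simp) _ (hz m g) _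
      (zero_mem_lpBall n p.2.1 m)
    rwa [smul_zero, add_zero, ← Finsupp.mapDomain_smul] at this

/-- For `x ≠ 0` the element `[x]` is a unit. -/
noncomputable def teichUnit (n : ℕ) (x : ℝ) (hx : x ≠ 0) : (TruncPoly n)ˣ where
  val := teich n x
  inv := teich n x⁻¹
  val_inv := by rw [teich, teich, ← map_mul, ← teichSeries_mul, mul_inv_cancel₀ hx, teichSeries_one, map_one]
  inv_val := by rw [teich, teich, ← map_mul, ← teichSeries_mul, inv_mul_cancel₀ hx, teichSeries_one, map_one]

theorem teich_pow (x : ℝ) (k : ℕ) : teich n x ^ k = teich n (x ^ k) := by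
  induction k with
  | zero => rw [pow_zero, pow_zero, teich, teichSeries_one, map_one]
  | succ k ih => rw [pow_succ, ih, pow_succ, teich, teich, teich, teichSeries_mul, map_mul]

theorem summable_teich (n : ℕ) {r r' : Set.Ioo (0 : ℝ) 1} (h : r' < r) :
    Summable fun k : ℕ => ‖(teichUnit n (r' : ℝ) r'.2.1.ne' : TruncPoly n) ^ k‖ *
      ((r : ℝ)⁻¹) ^ k := by
  have hq : ‖(r' : ℝ) / r‖ < 1 := by
    rw [Real.norm_eq_abs, abs_of_pos (div_pos r'.2.1 r.2.1), div_lt_one r.2.1]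
    exact h
  have h1 : Summable fun k : ℕ => ∑ j : Fin n, (|Real.log r'| ^ (j : ℕ) / ((j : ℕ).factorial : ℝ)) *
      ((k : ℝ) ^ (j : ℕ) * ((r' : ℝ) / r) ^ k) :=
    summable_sum fun j _ => (summable_pow_mul_geometric_of_norm_lt_one j hq).mul_left _
  refine h1.congr fun k => ?_
  have hk : (0 : ℝ) < (r' : ℝ) ^ k := pow_pos r'.2.1 k
  change _ = ‖teich n (r' : ℝ) ^ k‖ * _
  rw [teich_pow, norm_eq, Finset.sum_mul]
  refine Finset.sum_congr rfl fun j _ => ?_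
  rw [teich, coeff_ofPowerSeries, teichSeries, PowerSeries.coeff_mk, abs_div, abs_mul,
    abs_of_pos hk, Real.log_pow, abs_pow, abs_mul, Nat.abs_cast, Nat.abs_cast,
    mul_pow, div_pow, inv_pow]
  ring

end TruncPoly

/-! ### The maps `θ` -/

section Theta

variable {r r' : Set.Ioo (0 : ℝ) 1} (h : r' < r)

theorem summable_real {r r' : Set.Ioo (0 : ℝ) 1} (h : r' < r) :
    Summable fun k : ℕ => ‖((Units.mk0 (r' : ℝ) r'.2.1.ne' : ℝˣ) : ℝ) ^ k‖ * ((r : ℝ)⁻¹) ^ k := by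
  have hq : (r' : ℝ) / r < 1 := (div_lt_one r.2.1).2 h
  refine (summable_geometric_of_lt_one (div_pos r'.2.1 r.2.1).le hq).congr fun k => ?_
  rw [Units.val_mk0, norm_pow, Real.norm_eq_abs, abs_of_pos r'.2.1, div_eq_mul_inv, mul_pow]

/-- The ring homomorphism `θ : ℤ((T))_r → ℝ`, `∑ a_k T^k ↦ ∑ a_k r'^k`. -/
noncomputable def theta : ZTr r →+* ℝ := ZTr.eval _ (summable_real h)

/-- The morphism of condensed rings `θ : ℤ((T))_r → ℝ`. -/
noncomputable def condTheta : condRing.{u} (ZTr r) ⟶ condRing.{u} ℝ :=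
  ZTr.condEval _ (summable_real h)

/-- The ring homomorphism `θ_n : ℤ((T))_r → ℝ[X]/X^n`, `∑ a_k T^k ↦ ∑ a_k [r']^k`,
where `[r'] = r'^(1 + X)`. -/
noncomputable def thetaTrunc (n : ℕ) : ZTr r →+* TruncPoly n :=
  ZTr.eval _ (TruncPoly.summable_teich n h)

/-- The morphism of condensed rings `θ_n : ℤ((T))_r → ℝ[X]/X^n`. -/
noncomputable def condThetaTrunc (n : ℕ) : condRing.{u} (ZTr r) ⟶ condRing.{u} (TruncPoly n) :=
  ZTr.condEval _ (TruncPoly.summable_teich n h)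

end Theta

/-! ### Quotients -/

section Quotients

variable {A B : Type} [CommRing A] [TopologicalSpace A] [BallRing A]
  [CommRing B] [TopologicalSpace B] [BallRing B]

/-- Multiplication by the (global) element `f` is injective on the condensed ring. -/
def IsCondNonzerodivisor (f : A) : Prop :=
  ∀ (T : CompHaus.{u}) (a : secRing A T), secRing.const A T f * a = 0 → a = 0

/-- The morphism `α` of condensed rings is surjective (as a map of sheaves) and its kernel consists,
on the sections over each `T`, of the multiples of the (global) element `f`. -/
def IsQuotientMapBy (α : condRing.{u} A ⟶ condRing.{u} B) (f : A) : Prop :=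
  Sheaf.IsLocallySurjective α ∧
    ∀ (T : CompHaus.{u}) (a : secRing A T),
      α.hom.app (op T) (⟨a⟩ : ULift.{u + 1} (secRing A T)) = 0 ↔
        ∃ b : secRing A T, a = secRing.const A T f * b

/-- The condensed module `M / f M`, for `M` the module of measures on `S`. -/
noncomputable def measModulo (G : Gauge.{u} A) (S : Profinite.{u}) (f : A) :
    SheafOfModules.{u + 1} (condRing.{u} A) :=
  cokernel (mulEnd G S f)

/-- A morphism out of `M / f M`, linear over a morphism `α` of condensed rings, is induced by `φ`
if it sends the class of `(∑_{s ∈ S_i} a_{i,s} [s])_i` to `(∑_{s ∈ S_i} φ(a_{i,s}) [s])_i`. -/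
def IsInducedBy (φ : A →+* B) {α : condRing.{u} A ⟶ condRing.{u} B} {G : Gauge.{u} A}
    {G' : Gauge.{u} B} {S : Profinite.{u}} {f : A}
    (e : measModulo G S f ⟶ (SheafOfModules.restrictScalars α).obj (measures G' S)) : Prop :=
  ∀ (T : CompHaus.{u}) (μ : secMod' G S T) (t : T) (i : DiscreteQuotient S) (s : i),
    ((((cokernel.π (mulEnd G S f) ≫ e).val.app (op T) μ : secMod' G' S T).down.1 t).1 i s : B) =
      φ ((μ.down.1 t).1 i s)

end Quotients

end CondensedMeasures

open CondensedMeasures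

/-! The generator. After multiplying by a suitable g, a unit among the real power series that are
absolutely summable at r, the series 1 - T/r' acquires integral coefficients
(`exists_unit_mul_integral`). The result f has constant coefficient 1 and vanishes at r'.
Conversely, a series vanishing at r' is divisible by 1 - T/r' with control of the norm
(`exists_linearSeries_mul_eq`), hence by f. The quotient is integral because f is invertible among
formal power series over ℤ, and its norm is bounded because over ℝ the quotient is g⁻¹ times a
series of bounded norm (`exists_generator`). Since g(r') ≠ 0, the zero at r' is simple, so under T ↦
[r'] the element f becomes X times a unit of ℝ⟦X⟧. Induction on n then gives the kernel of θ_n,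
still with norm control (`exists_pow_mul_eq`).

The exponent p. Multiplication by T^k scales the norm by r^k. On the other side it becomes
multiplication by [r'^k], which replaces ∑ [x_i] X^i by ∑ [r'^k x_i] X^i and so scales ∑ |x_i|^p by
(r'^p)^k = r^k. By this homogeneity norm and quasinorm need only be compared on bounded sets. In one
direction, bounded elements have bounded lifts: for n = 1 by digit expansion in base r', in general
one power of X at a time (`exists_thetaTrunc_eq`, `exists_thetaTrunc_eq_expand`). In the other
direction, a nonzero integer has absolute value at least 1, so only powers of T of controlled size
occur in a, and for them ‖[y]‖ ≤ C y^p when 0 < y ≤ 1; the logarithms in [y] are absorbed because p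
< 1 (`exists_expand_eq_thetaTrunc`).

From estimates to condensed modules. The norm balls of ℤ((T))_r are compact Hausdorff for
coefficientwise convergence. Therefore division by a nonzero element is continuous on bounded sets
(`continuous_of_continuous_mul`), lifts at the finite levels of S assemble to compatible lifts
(`exists_lift_limFree`), and the lifts of a T-family form a compact Hausdorff space surjecting onto
T (`exists_cover_secMod`). Hence multiplication by f^n is the kernel of the coefficientwise map,
which is an epimorphism. In an abelian category an epimorphism is the cokernel of its kernel, and
this is the claimed isomorphism (`exists_iso_measures`). -/

namespace CondensedMeasures

/-! ### Cokernels of multiplication maps on condensed modules of measures -/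

section Generic

variable {A B : Type} [CommRing A] [TopologicalSpace A] [BallRing A]
  [CommRing B] [TopologicalSpace B] [BallRing B]

/-- The map `lim_i A[S_i] → lim_i B[S_i]` induced by a ring homomorphism `A → B`. -/
noncomputable def LimFree.map (φ : A →+* B) (S : Profinite.{u}) : LimFree A S →+ LimFree B S where
  toFun μ := ⟨fun i => Finsupp.mapRange.addMonoidHom φ.toAddMonoidHom (μ.1 i), fun i j h => by
    refine (DFunLike.congr_fun (Finsupp.mapDomain.addMonoidHom_comp_mapRange
      (DiscreteQuotient.ofLE h) φ.toAddMonoidHom) (μ.1 i)).trans ?_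
    exact congrArg (Finsupp.mapRange.addMonoidHom φ.toAddMonoidHom) (μ.2 i j h)⟩
  map_zero' := Subtype.ext (funext fun _ => map_zero _)
  map_add' _ _ := Subtype.ext (funext fun _ => map_add _ _ _)

/-- The map on `T`-valued points induced by a ring homomorphism. -/
noncomputable def secMod.map {φ : A →+* B} (hc : ∀ c, ContinuousOn φ (BallRing.ball c))
    (G : Gauge.{u} A) (G' : Gauge.{u} B)
    (hG : ∀ c, ∃ d, ∀ (I : Type u) [Finite I], ∀ x ∈ G.ball I c,
      Finsupp.mapRange.addMonoidHom φ.toAddMonoidHom x ∈ G'.ball I d)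
    (S : Profinite.{u}) (T : Type u) [TopologicalSpace T] :
    secMod G S T →+ secMod G' S T where
  toFun μ := ⟨fun t => LimFree.map φ S (μ.1 t), fun i s => by
      obtain ⟨c, hμ⟩ := μ.2.2
      obtain ⟨d, hd⟩ := G.coord_mem c
      exact (hc d).comp_continuous (μ.2.1 i s) fun t => hd _ _ (hμ t i) s, by
      obtain ⟨c, hμ⟩ := μ.2.2
      exact (hG c).imp fun d hd t i => hd i _ (hμ t i)⟩
  map_zero' := Subtype.ext (funext fun _ => map_zero _)
  map_add' _ _ := Subtype.ext (funext fun _ => map_add _ _ _)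

variable {φ : A →+* B} (hc : ∀ c, ContinuousOn φ (BallRing.ball c))
  (hb : ∀ c, ∃ d, Set.MapsTo φ (BallRing.ball c) (BallRing.ball d))
  (G : Gauge.{u} A) (G' : Gauge.{u} B)
  (hG : ∀ c, ∃ d, ∀ (I : Type u) [Finite I], ∀ x ∈ G.ball I c,
    Finsupp.mapRange.addMonoidHom φ.toAddMonoidHom x ∈ G'.ball I d)

/-- The morphism of condensed modules of measures induced by a ring homomorphism. -/
noncomputable def measuresMap (S : Profinite.{u}) : measures G S ⟶
    (SheafOfModules.restrictScalars (condRing.map.{u} φ hc hb)).obj (measures G' S) where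
  val := PresheafOfModules.homMk
    { app T := AddCommGrpCat.ofHom
        { toFun := fun μ : secMod' G S T.unop =>
            (⟨secMod.map hc G G' hG S T.unop μ.down⟩ : secMod' G' S T.unop)
          map_zero' := congrArg ULift.up (map_zero (secMod.map hc G G' hG S T.unop))
          map_add' := fun μ ν =>
            congrArg ULift.up (map_add (secMod.map hc G G' hG S T.unop) μ.down ν.down) }
      naturality _ _ _ := rfl }
    (fun T (_ : ULift.{u + 1} (secRing A T.unop)) (_ : secMod' G S T.unop) =>
      congrArg ULift.up (Subtype.ext (funext fun _ => Subtype.ext (funext fun _ =>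
        Finsupp.ext fun _ => map_mul φ _ _))))

theorem measuresMap_apply (S : Profinite.{u}) (T : CompHaus.{u}) (μ : secMod' G S T) (t : T)
    (i : DiscreteQuotient S) (s : i) :
    ((((measuresMap hc hb G G' hG S).val.app (op T) μ : secMod' G' S T).down.1 t).1 i s : B) =
      φ ((μ.down.1 t).1 i s) := rfl

/-- Multiplication by `f` on sections. -/
noncomputable def secMod.mul (f : A) (S : Profinite.{u}) (T : CompHaus.{u}) :
    secMod' G S T →+ secMod' G S T where
  toFun μ := ⟨secRing.const A T f • μ.down⟩
  map_zero' := congrArg ULift.up (smul_zero (secRing.const A T f))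
  map_add' μ ν := congrArg ULift.up (smul_add (secRing.const A T f) μ.down ν.down)

theorem hom_ext_measures {M : SheafOfModules.{u + 1} (condRing.{u} A)}
    {S : Profinite.{u}} {g g' : M ⟶ measures G S}
    (h : ∀ (T : CompHaus.{u}) (m : M.val.obj (op T)),
      (g.val.app (op T) m : secMod' G S T) = g'.val.app (op T) m) :
    g = g' := by
  ext T m
  exact h T.unop m

/-- If multiplication by `f` is injective on sections with image the sections killed by `φ`, then
`f` is a kernel of `measuresMap`. -/
theorem nonempty_isKernel (f : A) (S : Profinite.{u})
    (hinj : ∀ T : CompHaus.{u}, Function.Injective (secMod.mul G f S T))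
    (hker : ∀ (T : CompHaus.{u}) (μ : secMod' G S T),
      secMod.map hc G G' hG S T μ.down = 0 ↔ ∃ ν, secMod.mul G f S T ν = μ) :
    ∃ w : mulEnd G S f ≫ measuresMap hc hb G G' hG S = 0,
      Nonempty (IsLimit (KernelFork.ofι (mulEnd G S f) w)) := by
  have w : mulEnd G S f ≫ measuresMap hc hb G G' hG S = 0 := by
    ext T μ
    exact congrArg ULift.up ((hker T.unop _).2 ⟨μ, rfl⟩)
  have : Mono (mulEnd G S f) := ⟨fun {M} g g' h => hom_ext_measures G fun T m => hinj T
    (congrArg (fun k : M ⟶ measures G S => (k.val.app (op T) m : secMod' G S T)) h)⟩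
  refine ⟨w, ⟨KernelFork.IsLimit.ofι' _ _ fun {M} k hk => ?_⟩⟩
  have key : ∀ (T : CompHaus.{u}) (m : M.val.obj (op T)),
      ∃ ν, secMod.mul G f S T ν = (k.val.app (op T) m : secMod' G S T) := by
    intro T m
    refine (hker T _).1 ?_
    have h1 : (k ≫ measuresMap hc hb G G' hG S).val.app (op T) m = 0 := by
      rw [hk]; rfl
    exact congrArg (ULift.down (α := secMod G' S T)) h1
  -- The preimage under multiplication by f is unique, so additivity, naturality and linearity of
  -- `l` can all be checked after multiplying by f, where they are properties of `k`.
  choose l hl using key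
  refine ⟨⟨PresheafOfModules.homMk
    { app T := AddCommGrpCat.ofHom
        { toFun := fun m : M.val.obj T => (l T.unop m : secMod' G S T.unop)
          map_zero' := hinj _ <| ((hl _ _).trans (map_zero (k.val.app T).hom)).trans
            (map_zero (secMod.mul G f S T.unop)).symm
          map_add' := fun m m' => hinj _ <|
            ((hl _ _).trans (map_add (k.val.app T).hom m m')).trans <|
            (congrArg₂ (fun x y : secMod' G S T.unop => x + y) (hl _ m).symm (hl _ m').symm).trans
            (map_add (secMod.mul G f S T.unop) _ _).symm }
      naturality := fun T T' g => by
        ext m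
        refine hinj _ ?_
        refine (hl _ _).trans ?_
        refine (PresheafOfModules.naturality_apply k.val g m).trans ?_
        exact congrArg (fun x : secMod' G S T.unop => (measuresPresheaf G S).map g x) (hl _ m).symm }
    (fun T b m => hinj _ (by
      refine (hl _ _).trans ?_
      refine ((k.val.app _).hom.map_smul b m).trans ?_
      refine Eq.trans ?_ (congrArg ULift.up (smul_comm (secRing.const A T.unop f)
        (ULift.down (α := secRing A T.unop) b) (l T.unop m).down)).symm
      exact congrArg (fun x : secMod' G S T.unop =>
        (⟨(ULift.down (α := secRing A T.unop) b) • x.down⟩ : secMod' G S T.unop)) (hl _ m).symm))⟩, ?_⟩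
  ext T m
  exact hl _ m

/-- Surjectivity on a cover gives an epimorphism of condensed modules. -/
theorem epi_measuresMap (S : Profinite.{u})
    (hsurj : ∀ (T : CompHaus.{u}) (ν : secMod G' S T), ∃ (T' : CompHaus.{u}) (g : T' ⟶ T)
      (_ : Function.Surjective g) (μ : secMod G S T'),
      secMod.map hc G G' hG S T' μ = secMod.comap G' S g.hom.hom ν) :
    Epi (measuresMap hc hb G G' hG S) := by
  -- Being an epimorphism can be tested on underlying abelian sheaves, where it means local
  -- surjectivity; on compact Hausdorff spaces it suffices to lift sections along one surjection.
  refine (SheafOfModules.toSheaf _).epi_of_epi_map ?_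
  rw [← Sheaf.isLocallySurjective_iff_epi', coherentTopology.isLocallySurjective_iff,
    regularTopology.isLocallySurjective_iff]
  intro T (ν : secMod' G' S T)
  obtain ⟨T', g, hg, μ, h⟩ := hsurj T ν.down
  exact ⟨T', g, ((CompHaus.effectiveEpi_tfae _).out 0 2 :).2 hg, (⟨μ⟩ : secMod' G S T'),
    congrArg ULift.up h⟩

/-- An epimorphism in an abelian category is the cokernel of its kernel, and the kernel of
`measuresMap` is multiplication by f. The comparison of the two cokernels commutes with the
projections, so it is given by φ on coefficients. -/
theorem exists_iso_measures (f : A) (S : Profinite.{u})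
    (hinj : ∀ T : CompHaus.{u}, Function.Injective (secMod.mul G f S T))
    (hker : ∀ (T : CompHaus.{u}) (μ : secMod' G S T),
      secMod.map hc G G' hG S T μ.down = 0 ↔ ∃ ν, secMod.mul G f S T ν = μ)
    (hsurj : ∀ (T : CompHaus.{u}) (ν : secMod G' S T), ∃ (T' : CompHaus.{u}) (g : T' ⟶ T)
      (_ : Function.Surjective g) (μ : secMod G S T'),
      secMod.map hc G G' hG S T' μ = secMod.comap G' S g.hom.hom ν) :
    ∃ e : measModulo G S f ≅ (SheafOfModules.restrictScalars (condRing.map.{u} φ hc hb)).obj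
        (measures G' S), IsInducedBy φ e.hom := by
  obtain ⟨w, ⟨hk⟩⟩ := nonempty_isKernel hc hb G G' hG f S hinj hker
  have := epi_measuresMap hc hb G G' hG S hsurj
  have hcok := Abelian.epiIsCokernelOfKernel _ hk
  refine ⟨(cokernelIsCokernel (mulEnd G S f)).coconePointUniqueUpToIso hcok, ?_⟩
  have h : cokernel.π (mulEnd G S f) ≫
      ((cokernelIsCokernel (mulEnd G S f)).coconePointUniqueUpToIso hcok).hom =
        measuresMap hc hb G G' hG S :=
    (cokernelIsCokernel (mulEnd G S f)).comp_coconePointUniqueUpToIso_hom hcok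
      WalkingParallelPair.one
  intro T μ t i s
  exact (congrArg (fun k => (((k.val.app (op T) μ : secMod' G' S T).down.1 t).1 i s : B)) h).trans
    (measuresMap_apply hc hb G G' hG S T μ t i s)

end Generic

/-! ### Continuity and lifting from compactness of the balls -/

section Compactness

variable {A B : Type} [CommRing A] [TopologicalSpace A] [BallRing A]
  [CommRing B] [TopologicalSpace B]

/-- If the sets `ball c` are compact, division by a nonzerodivisor is continuous on bounded sets. -/
theorem continuous_of_continuous_mul [T2Space A] {f : A} {c : ℝ}
    (hA : IsCompact (BallRing.ball c : Set A)) (hf : ∀ a, f * a = 0 → a = 0)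
    {T : Type*} [TopologicalSpace T] {a : T → A} (ha : ∀ t, a t ∈ BallRing.ball c)
    (h : Continuous fun t => f * a t) : Continuous a := by
  have : CompactSpace (BallRing.ball c : Set A) := isCompact_iff_compactSpace.1 hA
  obtain ⟨d, hd⟩ := BallRing.exists_mem f
  have hm : Continuous fun x : (BallRing.ball c : Set A) => f * (x : A) :=
    (BallRing.continuousOn_mul d c).comp_continuous (continuous_const.prodMk continuous_subtype_val)
      fun x => ⟨hd, x.2⟩
  have hi : Function.Injective fun x : (BallRing.ball c : Set A) => f * (x : A) := by
    intro x y hxy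
    refine Subtype.ext (sub_eq_zero.1 (hf _ ?_))
    rw [mul_sub]
    exact sub_eq_zero.2 hxy
  -- A continuous injection from a compact space to a Hausdorff space is a closed embedding, so
  -- continuity may be tested after multiplying by f.
  have h2 : Continuous fun t => (⟨a t, ha t⟩ : (BallRing.ball c : Set A)) :=
    (hm.isClosedEmbedding hi).isInducing.continuous_iff.2 h
  exact continuous_subtype_val.comp h2

theorem secMod_mul_injective (G : Gauge.{u} A) {f : A} (hf : ∀ a, f * a = 0 → a = 0)
    (S : Profinite.{u}) (T : CompHaus.{u}) : Function.Injective (secMod.mul G f S T) := by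
  refine (injective_iff_map_eq_zero _).2 fun μ h => ?_
  refine congrArg ULift.up (Subtype.ext (funext fun t => Subtype.ext (funext fun i =>
    Finsupp.ext fun s => hf _ ?_)))
  exact congrArg (fun μ : secMod' G S T => (μ.down.1 t).1 i s) h

/-- A compact space with a closed relation to `T` that covers `T` gives a cover of `T`. -/
theorem exists_cover (T : CompHaus.{u}) {K : Type u} [TopologicalSpace K] [CompactSpace K]
    [T2Space K] (Z : Set (T × K)) (hZ : IsClosed Z) (hsurj : ∀ t, ∃ k, (t, k) ∈ Z) :
    ∃ (T' : CompHaus.{u}) (g : T' ⟶ T) (_ : Function.Surjective g) (k : C(T', K)),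
      ∀ t, (g t, k t) ∈ Z := by
  have : CompactSpace Z := isCompact_iff_compactSpace.1 hZ.isCompact
  refine ⟨CompHaus.of Z, CompHausLike.ofHom _
    ⟨fun z => z.1.1, continuous_fst.comp continuous_subtype_val⟩, fun t => ?_,
    ⟨fun z => z.1.2, continuous_snd.comp continuous_subtype_val⟩, fun z => z.2⟩
  obtain ⟨k, hk⟩ := hsurj t
  exact ⟨⟨(t, k), hk⟩, rfl⟩

theorem continuous_mapDomain_apply {I J : Type*} [Finite I] (g : I → J) (s : J) :
    Continuous fun x : I → A => (Finsupp.equivFunOnFinite.symm x).mapDomain g s := by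
  classical
  have : ContinuousAdd A := ⟨BallRing.continuous_add⟩
  have : Fintype I := Fintype.ofFinite I
  have h : ∀ x : I → A, (Finsupp.equivFunOnFinite.symm x).mapDomain g s =
      ∑ a, if g a = s then x a else 0 := by
    intro x
    rw [Finsupp.mapDomain, Finsupp.sum_fintype _ _ (fun _ => Finsupp.single_zero _),
      Finsupp.finsetSum_apply]
    refine Finset.sum_congr rfl fun a _ => ?_
    rw [Finsupp.single_apply]
    rfl
  simp only [h]
  refine continuous_finsetSum _ fun a _ => ?_
  split_ifs
  · exact continuous_apply a
  · exact continuous_const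

/-- Lifts along `φ` at all finite levels give lifts of compatible families. -/
theorem exists_lift_limFree [T2Space A] [T2Space B] {φ : A →+* B} (S : Profinite.{u})
    (Q : ∀ i : DiscreteQuotient S, Set (i → A)) (hQ : ∀ i, IsCompact (Q i))
    (hφ : ∀ (i : DiscreteQuotient S) (s : i), ContinuousOn (fun x : i → A => φ (x s)) (Q i))
    (hpush : ∀ (i j : DiscreteQuotient S) (h : i ≤ j), ∀ x : i →₀ A, ⇑x ∈ Q i →
      ⇑(x.mapDomain (DiscreteQuotient.ofLE h)) ∈ Q j)
    (y : LimFree B S)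
    (hlift : ∀ i : DiscreteQuotient S, ∃ x : i →₀ A, ⇑x ∈ Q i ∧ ∀ s, φ (x s) = y.1 i s) :
    ∃ μ : LimFree A S, ∀ i, ⇑(μ.1 i) ∈ Q i ∧ ∀ s, φ (μ.1 i s) = y.1 i s := by
  classical
  have hcomp : ∀ i, CompactSpace (Q i) := fun i => isCompact_iff_compactSpace.1 (hQ i)
  let K := ∀ i, Q i
  let fs : ∀ i, Q i → (i →₀ A) := fun i x => Finsupp.equivFunOnFinite.symm x.1
  -- Families of lifts that are compatible only from level j to coarser levels. These closed sets
  -- shrink as j is refined, and a point of their intersection is a fully compatible family.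
  let E : DiscreteQuotient S → Set K := fun j =>
    {x | (∀ i s, φ ((x i).1 s) = y.1 i s) ∧
      ∀ k (h : j ≤ k), (fs j (x j)).mapDomain (DiscreteQuotient.ofLE h) = fs k (x k)}
  choose l hl hl' using hlift
  have hne : ∀ j, (E j).Nonempty := by
    intro j
    -- One lift at level j is pushed forward to all coarser levels; elsewhere any lift will do.
    refine ⟨fun k => if h : j ≤ k then ⟨_, hpush j k h (l j) (hl j)⟩ else ⟨_, hl k⟩, ?_, ?_⟩
    · intro i s
      beta_reduce
      split_ifs with h
      · have h1 : (Finsupp.mapRange.addMonoidHom φ.toAddMonoidHom (l j)) = y.1 j :=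
          Finsupp.ext fun s => hl' j s
        have h2 := DFunLike.congr_fun (Finsupp.mapDomain.addMonoidHom_comp_mapRange
          (DiscreteQuotient.ofLE h) φ.toAddMonoidHom) (l j)
        have h3 : Finsupp.mapRange.addMonoidHom φ.toAddMonoidHom
            ((l j).mapDomain (DiscreteQuotient.ofLE h)) = y.1 i :=
          h2.symm.trans ((congrArg (Finsupp.mapDomain (DiscreteQuotient.ofLE h)) h1).trans
            (y.2 j i h))
        exact DFunLike.congr_fun h3 s
      · exact hl' i s
    · intro k h
      have h1 : fs j ⟨_, hpush j j le_rfl (l j) (hl j)⟩ = l j := by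
        refine Finsupp.ext fun s => ?_
        change (l j).mapDomain (DiscreteQuotient.ofLE le_rfl) s = l j s
        rw [DiscreteQuotient.ofLE_refl, Finsupp.mapDomain_id]
      simp only [dif_pos h, dif_pos (le_refl j), h1]
      ext s
      rfl
  have hcl : ∀ j, IsClosed (E j) := by
    intro j
    have hco : ∀ i s, Continuous fun x : K => (x i).1 s := fun i s =>
      (continuous_apply s).comp (continuous_subtype_val.comp (continuous_apply i))
    have h1 : IsClosed {x : K | ∀ i s, φ ((x i).1 s) = y.1 i s} := by
      simp only [Set.ofPred_forall]
      refine isClosed_iInter fun i => isClosed_iInter fun s => isClosed_eq ?_ continuous_const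
      exact (hφ i s).comp_continuous (continuous_subtype_val.comp (continuous_apply i))
        fun x => (x i).2
    have h2 : IsClosed {x : K | ∀ k (h : j ≤ k),
        (fs j (x j)).mapDomain (DiscreteQuotient.ofLE h) = fs k (x k)} := by
      simp only [Set.ofPred_forall, Finsupp.ext_iff]
      refine isClosed_iInter fun k => isClosed_iInter fun h => isClosed_iInter fun s =>
        isClosed_eq ?_ (hco k s)
      exact (continuous_mapDomain_apply _ s).comp
        (continuous_subtype_val.comp (continuous_apply j))
    exact h1.inter h2
  have hdir : Directed (· ⊇ ·) E := by
    intro j j'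
    have key : ∀ i j : DiscreteQuotient S, i ≤ j → E i ⊆ E j := by
      intro i j hij x hx
      refine ⟨hx.1, fun k h => ?_⟩
      rw [← hx.2 j hij, ← hx.2 k (hij.trans h), ← Finsupp.mapDomain_comp,
        DiscreteQuotient.ofLE_comp_ofLE]
    exact ⟨j ⊓ j', key _ _ inf_le_left, key _ _ inf_le_right⟩
  obtain ⟨x, hx⟩ := IsCompact.nonempty_iInter_of_directed_nonempty_isCompact_isClosed E hdir hne
    (fun j => (hcl j).isCompact) hcl
  rw [Set.mem_iInter] at hx
  exact ⟨⟨fun i => fs i (x i), fun i j h => (hx i).2 j h⟩, fun i => ⟨(x i).2, (hx i).1 i⟩⟩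

variable [BallRing B]

/-- Division by f is carried out separately for each point t and each finite level. Uniqueness of
the quotient makes the levels compatible, the uniform bound `d` keeps the result in the module of
measures, and compactness of the balls makes its coordinates continuous in t. -/
theorem secMod_map_eq_zero_iff [T2Space A] {φ : A →+* B}
    (hc : ∀ c, ContinuousOn φ (BallRing.ball c)) (G : Gauge.{u} A) (G' : Gauge.{u} B)
    (hG : ∀ c, ∃ d, ∀ (I : Type u) [Finite I], ∀ x ∈ G.ball I c,
      Finsupp.mapRange.addMonoidHom φ.toAddMonoidHom x ∈ G'.ball I d)
    (hA : ∀ c, IsCompact (BallRing.ball c : Set A)) {f : A} (hf : ∀ a, f * a = 0 → a = 0)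
    (hφf : φ f = 0)
    (hdiv : ∀ c, ∃ d, ∀ (I : Type u) [Finite I], ∀ x ∈ G.ball I c, (∀ s, φ (x s) = 0) →
      ∃ y ∈ G.ball I d, f • y = x)
    (S : Profinite.{u}) (T : CompHaus.{u}) (μ : secMod' G S T) :
    secMod.map hc G G' hG S T μ.down = 0 ↔ ∃ ν, secMod.mul G f S T ν = μ := by
  constructor
  · intro h
    have h0 : ∀ t i s, φ ((μ.down.1 t).1 i s) = 0 := fun t i s =>
      congrArg (fun μ : secMod G' S T => (μ.1 t).1 i s) h
    have hinj : ∀ {I : Type u} (y y' : I →₀ A), f • y = f • y' → y = y' := by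
      intro I y y' h
      ext s
      refine sub_eq_zero.1 (hf _ ?_)
      rw [mul_sub]
      exact sub_eq_zero.2 (DFunLike.congr_fun h s)
    obtain ⟨c, hμ⟩ := μ.down.2.2
    obtain ⟨d, hd⟩ := hdiv c
    choose ν hν hν' using fun t (i : DiscreteQuotient S) => hd i _ (hμ t i) (h0 t i)
    obtain ⟨e, he⟩ := G.coord_mem d
    refine ⟨⟨⟨fun t => ⟨ν t, fun i j hij => hinj _ _ ?_⟩, fun i s => ?_, d, hν⟩⟩, ?_⟩
    · rw [← Finsupp.mapDomain_smul, hν', hν']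
      exact (μ.down.1 t).2 i j hij
    · refine continuous_of_continuous_mul (hA e) hf (fun t => he _ _ (hν t i) s) ?_
      refine (μ.down.2.1 i s).congr fun t => ?_
      exact (DFunLike.congr_fun (hν' t i) s).symm
    · exact congrArg ULift.up (Subtype.ext (funext fun t => Subtype.ext (funext fun i => hν' t i)))
  · rintro ⟨ν, rfl⟩
    refine Subtype.ext (funext fun t => Subtype.ext (funext fun i => Finsupp.ext fun s => ?_))
    exact (map_mul φ f _).trans (by rw [hφf, zero_mul]; rfl)

/-- The pairs (t, a) with a in a fixed compact ball and φ(a) = b(t) form a closed subset of T times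
that ball. It is itself the cover of T on which b has the tautological lift. -/
theorem isLocallySurjective_condRing_map [T2Space A] [T2Space B] {φ : A →+* B}
    (hc : ∀ c, ContinuousOn φ (BallRing.ball c))
    (hb : ∀ c, ∃ d, Set.MapsTo φ (BallRing.ball c) (BallRing.ball d))
    (hA : ∀ c, IsCompact (BallRing.ball c : Set A))
    (hlift : ∀ c, ∃ d, ∀ b ∈ BallRing.ball (A := B) c, ∃ a ∈ BallRing.ball (A := A) d, φ a = b) :
    Sheaf.IsLocallySurjective (condRing.map.{u} φ hc hb) := by
  rw [coherentTopology.isLocallySurjective_iff, regularTopology.isLocallySurjective_iff]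
  intro T (b : ULift.{u + 1} (secRing B T))
  obtain ⟨hbc, c, hbc'⟩ := b.down.2
  obtain ⟨d, hd⟩ := hlift c
  have : CompactSpace (BallRing.ball d : Set A) := isCompact_iff_compactSpace.1 (hA d)
  let K := ULift.{u} (BallRing.ball d : Set A)
  have hval : Continuous fun k : K => (k.down : A) :=
    continuous_subtype_val.comp continuous_uliftDown
  have hφ : Continuous fun k : K => φ k.down :=
    (hc d).comp_continuous hval fun k => k.down.2
  obtain ⟨T', g, hg, k, hk⟩ := exists_cover T {q : T × K | φ q.2.down = b.down.1 q.1}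
    (isClosed_eq (hφ.comp continuous_snd) (hbc.comp continuous_fst)) (fun t => by
      obtain ⟨a, ha, ha'⟩ := hd _ (hbc' t)
      exact ⟨⟨⟨a, ha⟩⟩, ha'⟩)
  refine ⟨T', g, ((CompHaus.effectiveEpi_tfae _).out 0 2 :).2 hg,
    (⟨⟨fun t => (k t).down, hval.comp k.continuous, d, fun t => (k t).down.2⟩⟩ :
      ULift.{u + 1} (secRing A T')), ?_⟩
  exact congrArg ULift.up (Subtype.ext (funext hk))

/-- The cover consists of the pairs of a point t and a compatible family of bounded lifts of ν(t).
It is closed in the product of T with the compact sets `Q i`, and it maps onto T because bounded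
lifts at all finite levels can be made compatible. -/
theorem exists_cover_secMod [T2Space A] [T2Space B] {φ : A →+* B}
    (hc : ∀ c, ContinuousOn φ (BallRing.ball c)) (G : Gauge.{u} A) (G' : Gauge.{u} B)
    (hG : ∀ c, ∃ d, ∀ (I : Type u) [Finite I], ∀ x ∈ G.ball I c,
      Finsupp.mapRange.addMonoidHom φ.toAddMonoidHom x ∈ G'.ball I d)
    (hA : ∀ c, IsCompact (BallRing.ball c : Set A))
    (hclosed : ∀ (I : Type u) [Finite I] (c : ℝ),
      IsClosed {x : I → A | Finsupp.equivFunOnFinite.symm x ∈ G.ball I c})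
    (hpush : ∀ (I J : Type u) (g : I → J) (c : ℝ), ∀ x ∈ G.ball I c, x.mapDomain g ∈ G.ball J c)
    (hlift : ∀ c, ∃ d, ∀ (I : Type u) [Finite I], ∀ y ∈ G'.ball I c,
      ∃ x ∈ G.ball I d, ∀ s, φ (x s) = y s)
    (S : Profinite.{u}) (T : CompHaus.{u}) (ν : secMod G' S T) :
    ∃ (T' : CompHaus.{u}) (g : T' ⟶ T) (_ : Function.Surjective g) (μ : secMod G S T'),
      secMod.map hc G G' hG S T' μ = secMod.comap G' S g.hom.hom ν := by
  obtain ⟨hν, c, hνc⟩ := ν.2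
  obtain ⟨d, hd⟩ := hlift c
  obtain ⟨e, he⟩ := G.coord_mem d
  let Q : ∀ i : DiscreteQuotient S, Set (i → A) := fun i =>
    {x | Finsupp.equivFunOnFinite.symm x ∈ G.ball i d}
  have hmem : ∀ (i : DiscreteQuotient S) (x : i →₀ A), ⇑x ∈ Q i ↔ x ∈ G.ball (↥i) d := by
    intro i x
    change Finsupp.equivFunOnFinite.symm ⇑x ∈ G.ball (↥i) d ↔ _
    rw [Finsupp.equivFunOnFinite_symm_coe]
  have hQ : ∀ i, IsCompact (Q i) := fun i =>
    (isCompact_univ_pi fun _ : i => hA e).of_isClosed_subset (hclosed i d)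
      fun x hx s _ => he _ _ hx s
  have hcomp : ∀ i, CompactSpace (Q i) := fun i => isCompact_iff_compactSpace.1 (hQ i)
  have hφ : ∀ (i : DiscreteQuotient S) (s : i),
      ContinuousOn (fun x : i → A => φ (x s)) (Q i) := fun i s =>
    (hc e).comp (continuous_apply s).continuousOn fun x hx => he _ _ hx s
  let fs : ∀ i, Q i → (i →₀ A) := fun i x => Finsupp.equivFunOnFinite.symm x.1
  have hco : ∀ (i : DiscreteQuotient S) (s : i), Continuous fun x : ∀ i, Q i => (x i).1 s :=
    fun i s => (continuous_apply s).comp (continuous_subtype_val.comp (continuous_apply i))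
  have hφ' : ∀ (i : DiscreteQuotient S) (s : i), Continuous fun x : ∀ i, Q i => φ ((x i).1 s) :=
    fun i s => (hφ i s).comp_continuous (continuous_subtype_val.comp (continuous_apply i))
      fun x => (x i).2
  have h1 : IsClosed {q : T × ∀ i, Q i | ∀ (i j : DiscreteQuotient S) (h : i ≤ j),
      (fs i (q.2 i)).mapDomain (DiscreteQuotient.ofLE h) = fs j (q.2 j)} := by
    simp only [Set.ofPred_forall, Finsupp.ext_iff]
    refine isClosed_iInter fun i => isClosed_iInter fun j => isClosed_iInter fun h =>
      isClosed_iInter fun s => isClosed_eq ?_ ((hco j s).comp continuous_snd)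
    exact (continuous_mapDomain_apply _ s).comp
      (continuous_subtype_val.comp ((continuous_apply i).comp continuous_snd))
  have h2 : IsClosed {q : T × ∀ i, Q i | ∀ (i : DiscreteQuotient S) (s : i),
      φ ((q.2 i).1 s) = (ν.1 q.1).1 i s} := by
    simp only [Set.ofPred_forall]
    exact isClosed_iInter fun i => isClosed_iInter fun s =>
      isClosed_eq ((hφ' i s).comp continuous_snd) ((hν i s).comp continuous_fst)
  obtain ⟨T', g, hg, k, hk⟩ := exists_cover T _ (h1.inter h2) (fun t => by
    obtain ⟨μ, hμ⟩ := exists_lift_limFree S Q hQ hφ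
      (fun i j h x hx => (hmem _ _).2 (hpush _ _ _ _ _ ((hmem _ _).1 hx))) (ν.1 t)
      (fun i => by
        obtain ⟨x, hx, hx'⟩ := hd i _ (hνc t i)
        exact ⟨x, (hmem i x).2 hx, hx'⟩)
    refine ⟨fun i => ⟨_, (hμ i).1⟩, fun i j h => ?_, fun i s => (hμ i).2 s⟩
    change (Finsupp.equivFunOnFinite.symm ⇑(μ.1 i)).mapDomain _ =
      Finsupp.equivFunOnFinite.symm ⇑(μ.1 j)
    rw [Finsupp.equivFunOnFinite_symm_coe, Finsupp.equivFunOnFinite_symm_coe]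
    exact μ.2 i j h)
  refine ⟨T', g, hg, ⟨fun t => ⟨fun i => fs i (k t i), (hk t).1⟩,
    fun i s => (hco i s).comp k.continuous, d, fun t i => (k t i).2⟩, ?_⟩
  exact Subtype.ext (funext fun t => Subtype.ext (funext fun i => Finsupp.ext fun s =>
    (hk t).2 i s))

end Compactness

/-! ### Compactness of the norm balls of ℤ((T))_r -/

namespace ZTr

variable {r : Set.Ioo (0 : ℝ) 1}

theorem ext {a b : ZTr r} (h : ∀ n, a.coeff n = b.coeff n) : a = b :=
  Subtype.ext (HahnSeries.ext (funext h))

theorem isInducing_coeff : IsInducing fun (a : ZTr r) (n : ℤ) => a.coeff n := ⟨rfl⟩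

instance : T2Space (ZTr r) :=
  T2Space.of_injective_continuous (f := fun (a : ZTr r) (n : ℤ) => a.coeff n)
    (fun _ _ h => ext (congrFun h)) isInducing_coeff.continuous

instance : IsDomain (ZTr r) := inferInstanceAs (IsDomain (ztrSubring r))

/-- The element of `ℤ((T))_r` with given coefficients. -/
noncomputable def ofCoeff (x : ℤ → ℤ) (h0 : BddBelow (Function.support x))
    (h : Summable fun n : ℤ => |(x n : ℝ)| * (r : ℝ) ^ n) : ZTr r :=
  ⟨HahnSeries.ofSuppBddBelow x h0, h⟩

theorem coeff_ofCoeff (x : ℤ → ℤ) (h0 : BddBelow (Function.support x))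
    (h : Summable fun n : ℤ => |(x n : ℝ)| * (r : ℝ) ^ n) (n : ℤ) :
    (ofCoeff x h0 h).coeff n = x n := rfl

theorem norm_le_iff (a : ZTr r) (c : ℝ) : a.norm ≤ c ↔
    ∀ F : Finset ℤ, ∑ n ∈ F, |(a.coeff n : ℝ)| * (r : ℝ) ^ n ≤ c :=
  ⟨fun h F => (a.summable.sum_le_tsum F fun n _ => normTerm_nonneg r a.1 n).trans h,
    fun h => a.summable.tsum_le_of_sum_le h⟩

/-- Bounding all finite partial sums of the norm by c is a closed condition on integer sequences,
and it confines each coefficient to a finite interval; Tychonoff's theorem applies. -/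
theorem isCompact_setOf_norm_le (c : ℝ) : IsCompact {a : ZTr r | a.norm ≤ c} := by
  rw [isInducing_coeff.isCompact_iff]
  have himage : (fun (a : ZTr r) (n : ℤ) => a.coeff n) '' {a : ZTr r | a.norm ≤ c} =
      {x : ℤ → ℤ | ∀ F : Finset ℤ, ∑ n ∈ F, |(x n : ℝ)| * (r : ℝ) ^ n ≤ c} := by
    ext x
    constructor
    · rintro ⟨a, ha, rfl⟩
      exact (norm_le_iff a c).1 ha
    · intro hx
      obtain ⟨N, hN⟩ := exists_bound r c
      have hs : Summable fun n : ℤ => |(x n : ℝ)| * (r : ℝ) ^ n :=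
        summable_of_sum_le (fun n => mul_nonneg (abs_nonneg _) (zpow_nonneg r.2.1.le _)) hx
      have hb : BddBelow (Function.support x) := by
        refine ⟨-N, fun n hn => not_lt.1 fun hlt => hn ?_⟩
        by_contra h
        have h1 : (1 : ℝ) ≤ |(x n : ℝ)| := by exact_mod_cast Int.one_le_abs h
        -- A nonzero integer coefficient in degree n contributes at least r^n > c, so the sequence
        -- vanishes in low degrees and is a Laurent series.
        have h2 := hx {n}
        rw [Finset.sum_singleton] at h2
        nlinarith [zpow_pos r.2.1 n, hN n hlt]
      exact ⟨ofCoeff x hb hs, (norm_le_iff _ c).2 hx, rfl⟩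
  rw [himage]
  refine (isCompact_univ_pi fun n : ℤ => (Set.finite_Icc (-⌈c / (r : ℝ) ^ n⌉) ⌈c / (r : ℝ) ^ n⌉)
    |>.isCompact).of_isClosed_subset ?_ fun x hx n _ => ?_
  · simp only [Set.ofPred_forall]
    refine isClosed_iInter fun F => isClosed_le (continuous_finsetSum _ fun n _ => ?_)
      continuous_const
    exact (continuous_of_discreteTopology (f := fun m : ℤ => |(m : ℝ)| * (r : ℝ) ^ n)).comp
      (continuous_apply n)
  · have h2 := hx {n}
    rw [Finset.sum_singleton, ← le_div_iff₀ (zpow_pos r.2.1 n)] at h2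
    have h3 : |x n| ≤ ⌈c / (r : ℝ) ^ n⌉ := by
      exact_mod_cast h2.trans (Int.le_ceil _)
    exact abs_le.1 h3

theorem lowerSemicontinuous_norm : LowerSemicontinuous (norm : ZTr r → ℝ) :=
  lowerSemicontinuous_iff_isClosed_preimage.2 fun c => (isCompact_setOf_norm_le c).isClosed

/-- The element `T^k`. -/
noncomputable def monomial (r : Set.Ioo (0 : ℝ) 1) (k : ℤ) : ZTr r :=
  ofCoeff (Pi.single k 1) ((Set.finite_singleton k).subset Pi.support_single_subset).bddBelow
    (summable_of_ne_finset_zero (s := {k}) fun n hn => by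
      rw [Finset.mem_singleton] at hn
      simp [hn])

theorem norm_monomial (k : ℤ) : (monomial r k).norm = (r : ℝ) ^ k := by
  rw [norm, tsum_eq_single k]
  · simp [monomial, coeff_ofCoeff]
  · intro n hn
    simp [monomial, coeff_ofCoeff, hn]

theorem eval_apply {A : Type} [NormedCommRing A] [CompleteSpace A] (x : Aˣ)
    (hx : Summable fun k : ℕ => ‖(x : A) ^ k‖ * ((r : ℝ)⁻¹) ^ k) (a : ZTr r) :
    eval x hx a = ∑' k : ℤ, a.coeff k • ((x ^ k : Aˣ) : A) := rfl

theorem eval_monomial {A : Type} [NormedCommRing A] [CompleteSpace A] (x : Aˣ)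
    (hx : Summable fun k : ℕ => ‖(x : A) ^ k‖ * ((r : ℝ)⁻¹) ^ k) (k : ℤ) :
    eval x hx (monomial r k) = ((x ^ k : Aˣ) : A) := by
  rw [eval_apply, tsum_eq_single k]
  · simp [monomial, coeff_ofCoeff]
  · intro n hn
    simp [monomial, coeff_ofCoeff, hn]

end ZTr

/-! ### The gauge of ℤ((T))_r: closedness and pushforward -/

section ztrGauge

variable {r : Set.Ioo (0 : ℝ) 1}

theorem mem_ztrGauge_iff {I : Type u} [Fintype I] (x : I →₀ ZTr r) (c : ℝ) :
    x ∈ (ztrGauge.{u} r).ball I c ↔ ∑ s, (x s).norm ≤ c := by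
  change (x.sum fun _ a => a.norm) ≤ c ↔ _
  rw [Finsupp.sum_fintype _ _ fun _ => ZTr.norm_zero]

theorem isClosed_ztrGauge (I : Type u) [Finite I] (c : ℝ) :
    IsClosed {x : I → ZTr r | Finsupp.equivFunOnFinite.symm x ∈ (ztrGauge.{u} r).ball I c} := by
  have := Fintype.ofFinite I
  have h : LowerSemicontinuous fun x : I → ZTr r => ∑ s, (x s).norm :=
    lowerSemicontinuous_sum fun s _ => ZTr.lowerSemicontinuous_norm.comp (continuous_apply s)
  have heq : {x : I → ZTr r | Finsupp.equivFunOnFinite.symm x ∈ (ztrGauge.{u} r).ball I c} =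
      (fun x : I → ZTr r => ∑ s, (x s).norm) ⁻¹' Set.Iic c :=
    Set.ext fun x => mem_ztrGauge_iff _ c
  rw [heq]
  exact lowerSemicontinuous_iff_isClosed_preimage.1 h c

/-- Pushforward adds up coefficients along fibres, so this is the triangle inequality. It is the
reason that no stability condition is needed on the side of ℤ((T))_r. -/
theorem sum_norm_mapDomain_le {I J : Type*} (g : I → J) (x : I →₀ ZTr r) :
    ((x.mapDomain g).sum fun _ a => a.norm) ≤ x.sum fun _ a => a.norm := by
  classical
  have hs1 : ∀ {K : Type _} (s : K) (a : ZTr r),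
      ((Finsupp.single s a).sum fun _ a => a.norm) = a.norm :=
    fun s a => Finsupp.sum_single_index (h := fun _ (a : ZTr r) => a.norm) ZTr.norm_zero
  induction x using Finsupp.induction with
  | zero => simp
  | single_add s a x hs ha ih =>
    have hd : Disjoint (Finsupp.single s a).support x.support := by
      rw [Finsupp.support_single _ ha]
      exact Finset.disjoint_singleton_left.2 hs
    rw [Finsupp.sum_add_index_of_disjoint hd fun _ (a : ZTr r) => a.norm,
      Finsupp.sum_single_index (h := fun _ (a : ZTr r) => a.norm) ZTr.norm_zero,
      Finsupp.mapDomain_add, Finsupp.mapDomain_single]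
    refine (sum_norm_add_le ZTr.norm ZTr.norm_zero ZTr.norm_add_le _ _).trans ?_
    rw [hs1]
    exact add_le_add_right ih _

theorem mapDomain_mem_ztrGauge (I J : Type u) (g : I → J) (c : ℝ) :
    ∀ x ∈ (ztrGauge.{u} r).ball I c, x.mapDomain g ∈ (ztrGauge.{u} r).ball J c :=
  fun x hx => (sum_norm_mapDomain_le g x).trans hx

end ztrGauge

/-! ### Real power series with summable coefficients -/

section RealSeries

open PowerSeries

/-- The condition `∑ |f_n| ρ^n < ∞`. -/
def IsL1 (ρ : ℝ) (f : PowerSeries ℝ) : Prop := Summable fun n => |coeff n f| * ρ ^ n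

/-- The norm `∑ |f_n| ρ^n`. -/
noncomputable def l1norm (ρ : ℝ) (f : PowerSeries ℝ) : ℝ := ∑' n, |coeff n f| * ρ ^ n

theorem l1norm_nonneg {ρ : ℝ} (hρ : 0 ≤ ρ) (f : PowerSeries ℝ) : 0 ≤ l1norm ρ f :=
  tsum_nonneg fun n => mul_nonneg (abs_nonneg _) (pow_nonneg hρ n)

theorem abs_coeff_mul_le {ρ : ℝ} (hρ : 0 ≤ ρ) (f g : PowerSeries ℝ) (n : ℕ) :
    |coeff n (f * g)| * ρ ^ n ≤ ∑ q ∈ Finset.HasAntidiagonal.antidiagonal n,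
      (|coeff q.1 f| * ρ ^ q.1) * (|coeff q.2 g| * ρ ^ q.2) := by
  rw [coeff_mul]
  refine (mul_le_mul_of_nonneg_right (Finset.abs_sum_le_sum_abs _ _) (pow_nonneg hρ n)).trans
    (le_of_eq ?_)
  rw [Finset.sum_mul]
  refine Finset.sum_congr rfl fun q hq => ?_
  rw [← Finset.HasAntidiagonal.mem_antidiagonal.1 hq, abs_mul, pow_add]
  ring

theorem IsL1.mul {ρ : ℝ} (hρ : 0 ≤ ρ) {f g : PowerSeries ℝ} (hf : IsL1 ρ f) (hg : IsL1 ρ g) :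
    IsL1 ρ (f * g) ∧ l1norm ρ (f * g) ≤ l1norm ρ f * l1norm ρ g := by
  have hn : ∀ (f : PowerSeries ℝ) n, ‖|coeff n f| * ρ ^ n‖ = |coeff n f| * ρ ^ n := fun f n =>
    Real.norm_of_nonneg (mul_nonneg (abs_nonneg _) (pow_nonneg hρ n))
  have hf' : Summable fun n => ‖|coeff n f| * ρ ^ n‖ := by simp only [hn]; exact hf
  have hg' : Summable fun n => ‖|coeff n g| * ρ ^ n‖ := by simp only [hn]; exact hg
  have hs := (summable_norm_sum_mul_antidiagonal_of_summable_norm hf' hg').of_norm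
  have h1 : IsL1 ρ (f * g) := Summable.of_nonneg_of_le
    (fun n => mul_nonneg (abs_nonneg _) (pow_nonneg hρ n)) (abs_coeff_mul_le hρ f g) hs
  refine ⟨h1, ?_⟩
  rw [l1norm, l1norm, l1norm, tsum_mul_tsum_eq_tsum_sum_antidiagonal_of_summable_norm hf' hg']
  exact Summable.tsum_le_tsum (abs_coeff_mul_le hρ f g) h1 hs

/-- A power series `1 + w` with `‖w‖ < 1` has an inverse with summable coefficients. -/
theorem exists_inverse {ρ : ℝ} (hρ : 0 ≤ ρ) {w : PowerSeries ℝ} (h0 : constantCoeff w = 0)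
    (hw : IsL1 ρ w) (h1 : l1norm ρ w < 1) : ∃ x, IsL1 ρ x ∧ (1 + w) * x = 1 := by
  have hc : constantCoeff (1 + w) ≠ 0 := by simp [h0]
  refine ⟨(1 + w)⁻¹, ?_, PowerSeries.mul_inv_cancel _ hc⟩
  set x := (1 + w)⁻¹ with hx
  have hx1 : x = 1 - w * x := by
    rw [eq_sub_iff_add_eq]
    have := PowerSeries.mul_inv_cancel _ hc
    rwa [add_mul, one_mul] at this
  have hnn : ∀ n, 0 ≤ |coeff n x| * ρ ^ n := fun n => mul_nonneg (abs_nonneg _) (pow_nonneg hρ n)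
  refine summable_of_sum_range_le (c := (1 - l1norm ρ w)⁻¹) hnn fun n => ?_
  -- For a partial sum s of the norm of x, the equation x = 1 - w x yields s ≤ 1 + s ‖w‖; this
  -- bounds s without assuming that the series converges.
  rw [← one_div, le_div_iff₀ (sub_pos.2 h1), mul_sub, mul_one, sub_le_iff_le_add]
  have hterm : ∀ k, |coeff k x| * ρ ^ k ≤ (if k = 0 then 1 else 0) +
      ∑ q ∈ Finset.HasAntidiagonal.antidiagonal k,
        (|coeff q.1 w| * ρ ^ q.1) * (|coeff q.2 x| * ρ ^ q.2) := by
    intro k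
    refine le_trans ?_ (add_le_add_right (abs_coeff_mul_le hρ w x k) _)
    conv_lhs => rw [hx1]
    rw [map_sub, coeff_one]
    refine (mul_le_mul_of_nonneg_right (abs_sub _ _) (pow_nonneg hρ k)).trans (le_of_eq ?_)
    split_ifs with hk
    · simp [hk]
    · simp
  refine (Finset.sum_le_sum fun k _ => hterm k).trans ?_
  rw [Finset.sum_add_distrib]
  refine add_le_add ?_ ((TruncPoly.sum_antidiagonal_le n (fun q =>
    (|coeff q.1 w| * ρ ^ q.1) * (|coeff q.2 x| * ρ ^ q.2)) fun q => mul_nonneg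
      (mul_nonneg (abs_nonneg _) (pow_nonneg hρ _)) (hnn _)).trans ?_)
  · rw [Finset.sum_ite_eq']
    split_ifs <;> norm_num
  · rw [Finset.sum_product]
    refine (Finset.sum_mul_sum (Finset.range n) (Finset.range n) (fun i => |coeff i w| * ρ ^ i)
      fun i => |coeff i x| * ρ ^ i).symm.le.trans ?_
    rw [mul_comm]
    refine mul_le_mul_of_nonneg_left ?_ (Finset.sum_nonneg fun k _ => hnn k)
    exact hw.sum_le_tsum _ fun k _ => mul_nonneg (abs_nonneg _) (pow_nonneg hρ k)

/-- The coefficients of the correction `w` that makes `h (1 + w)` integral. -/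
noncomputable def correction (h : PowerSeries ℝ) (n : ℕ) : ℝ :=
  ⌈coeff n h + ∑ i : Fin n, correction h i * coeff (n - i) h⌉ -
    (coeff n h + ∑ i : Fin n, correction h i * coeff (n - i) h)
termination_by n
decreasing_by all_goals exact i.2

theorem correction_nonneg (h : PowerSeries ℝ) (n : ℕ) : 0 ≤ correction h n := by
  rw [correction]
  exact sub_nonneg.2 (Int.le_ceil _)

theorem correction_le_one (h : PowerSeries ℝ) (n : ℕ) : correction h n ≤ 1 := by
  rw [correction, sub_le_iff_le_add']
  exact (Int.ceil_lt_add_one (_ : ℝ)).le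

/-- Because h has constant coefficient 1, the n-th correction enters the n-th coefficient of the
product with factor 1, and it was chosen to round the remaining terms up. -/
theorem coeff_mul_correction {h : PowerSeries ℝ} (h0 : coeff 0 h = 1) (n : ℕ) :
    ∃ m : ℤ, coeff n (h * (1 + PowerSeries.mk (correction h))) = (m : ℝ) := by
  refine ⟨⌈coeff n h + ∑ i : Fin n, correction h i * coeff (n - i) h⌉, ?_⟩
  have h1 : coeff n (h * (1 + PowerSeries.mk (correction h))) =
      coeff n h + (∑ i : Fin n, correction h i * coeff (n - i) h + correction h n) := by
    rw [mul_add, mul_one, map_add, mul_comm, coeff_mul,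
      Finset.Nat.sum_antidiagonal_eq_sum_range_succ
        (fun i j => coeff i (PowerSeries.mk (correction h)) * coeff j h), Finset.sum_range_succ,
      Finset.sum_range, Nat.sub_self, h0, mul_one]
    simp only [coeff_mk]
  rw [h1]
  conv_lhs => rw [correction.eq_def h n]
  ring

theorem correction_eq_zero {h : PowerSeries ℝ} {K : ℕ}
    (hK : ∀ n < K, ∃ m : ℤ, coeff n h = (m : ℝ)) : ∀ n < K, correction h n = 0 := by
  intro n
  induction n using Nat.strong_induction_on with
  | _ n ih =>
    intro hn
    have h1 : ∑ i : Fin n, correction h i * coeff (n - i) h = 0 :=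
      Finset.sum_eq_zero fun i _ => by rw [ih i i.2 (i.2.trans hn), zero_mul]
    obtain ⟨m, hm⟩ := hK n hn
    rw [correction, h1, add_zero, hm, Int.ceil_intCast, sub_self]

/-- Finitely many coefficients are rounded up one after the other by factors 1 + v X^(K+1) with 0 ≤
v ≤ 1. Each factor is invertible because v ρ^(K+1) < 1, and it leaves the lower coefficients alone.
-/
theorem exists_unit_of_lt {ρ : ℝ} (hρ : 0 < ρ) (hρ1 : ρ < 1) {l : PowerSeries ℝ}
    (hl : coeff 0 l = 1) (K : ℕ) : ∃ u u' : PowerSeries ℝ, IsL1 ρ u ∧ IsL1 ρ u' ∧ u * u' = 1 ∧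
      coeff 0 u = 1 ∧ ∀ n < K + 1, ∃ m : ℤ, coeff n (l * u) = (m : ℝ) := by
  have hone : IsL1 ρ 1 := summable_of_ne_finset_zero (s := {0}) fun n hn => by
    rw [Finset.mem_singleton] at hn
    simp [coeff_one, hn]
  induction K with
  | zero =>
    refine ⟨1, 1, hone, hone, one_mul 1, by simp, fun n hn => ⟨1, ?_⟩⟩
    obtain rfl : n = 0 := by omega
    simp [hl]
  | succ K ih =>
    obtain ⟨u, u', hu, hu', huu, hu0, hint⟩ := ih
    set s := coeff (K + 1) (l * u) with hs
    set v : ℝ := ⌈s⌉ - s with hv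
    have hv0 : 0 ≤ v := sub_nonneg.2 (Int.le_ceil _)
    have hv1 : v ≤ 1 := by linarith [Int.ceil_lt_add_one s]
    set w : PowerSeries ℝ := C v * X ^ (K + 1) with hw
    have hwc : ∀ n, n ≠ K + 1 → |coeff n w| * ρ ^ n = 0 := fun n hn => by
      rw [hw, coeff_C_mul_X_pow, if_neg hn, abs_zero, zero_mul]
    have hw1 : IsL1 ρ w := summable_of_ne_finset_zero (s := {K + 1}) fun n hn =>
      hwc n (by simpa using hn)
    have hw0 : constantCoeff w = 0 := by
      rw [← coeff_zero_eq_constantCoeff_apply, hw, coeff_C_mul_X_pow, if_neg (by omega)]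
    have hwn : l1norm ρ w < 1 := by
      rw [l1norm, tsum_eq_single (K + 1) hwc, hw, coeff_C_mul_X_pow, if_pos rfl, abs_of_nonneg hv0]
      calc v * ρ ^ (K + 1) ≤ 1 * ρ ^ (K + 1) :=
            mul_le_mul_of_nonneg_right hv1 (pow_nonneg hρ.le _)
        _ < 1 := by rw [one_mul]; exact pow_lt_one₀ hρ.le hρ1 (by omega)
    obtain ⟨x, hx, hx1⟩ := exists_inverse hρ.le hw0 hw1 hwn
    have h1w : IsL1 ρ (1 + w) := Summable.of_nonneg_of_le
      (fun n => mul_nonneg (abs_nonneg _) (pow_nonneg hρ.le n)) (fun n => by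
        rw [map_add, ← add_mul]
        exact mul_le_mul_of_nonneg_right (abs_add_le _ _) (pow_nonneg hρ.le n)) (hone.add hw1)
    refine ⟨u * (1 + w), u' * x, (hu.mul hρ.le h1w).1, (hu'.mul hρ.le hx).1, ?_, ?_, ?_⟩
    · rw [mul_mul_mul_comm, huu, hx1, one_mul]
    · rw [coeff_zero_eq_constantCoeff_apply] at hu0 ⊢
      rw [map_mul, map_add, hw0, hu0]
      simp
    · intro n hn
      rw [← mul_assoc, mul_add, mul_one, map_add, hw,
        show l * u * (C v * X ^ (K + 1)) = C v * (l * u) * X ^ (K + 1) by ring, coeff_mul_X_pow']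
      rcases Nat.lt_succ_iff_lt_or_eq.1 hn with h | h
      · rw [if_neg (by omega), add_zero]
        exact hint n h
      · rw [if_pos h.ge, h, Nat.sub_self, ← hs, coeff_C_mul, coeff_zero_eq_constantCoeff_apply,
          map_mul, ← coeff_zero_eq_constantCoeff_apply, ← coeff_zero_eq_constantCoeff_apply, hl,
          hu0]
        exact ⟨⌈s⌉, by rw [hv]; ring⟩

/-- A power series with constant coefficient `1` becomes integral after multiplication by a
unit. -/
theorem exists_unit_mul_integral {ρ : ℝ} (hρ : 0 < ρ) (hρ1 : ρ < 1) {l : PowerSeries ℝ}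
    (hl : coeff 0 l = 1) : ∃ g g' : PowerSeries ℝ, IsL1 ρ g ∧ IsL1 ρ g' ∧ g * g' = 1 ∧
      coeff 0 g = 1 ∧ ∀ n, ∃ m : ℤ, coeff n (l * g) = (m : ℝ) := by
  -- The correction of all coefficients at once has coefficients in [0, 1], so its norm is known to
  -- be less than 1 only if it starts in degree K with ρ^K / (1 - ρ) < 1. The lower degrees are made
  -- integral beforehand.
  obtain ⟨K, hK⟩ := exists_pow_lt_of_lt_one (sub_pos.2 hρ1) hρ1
  obtain ⟨u, u', hu, hu', huu, hu0, hint⟩ := exists_unit_of_lt hρ hρ1 hl K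
  set h := l * u with hh
  have hh0 : coeff 0 h = 1 := by
    rw [hh, coeff_zero_eq_constantCoeff_apply, map_mul, ← coeff_zero_eq_constantCoeff_apply,
      ← coeff_zero_eq_constantCoeff_apply, hl, hu0, one_mul]
  set w := PowerSeries.mk (correction h) with hw
  have hz := correction_eq_zero hint
  have hgeo : Summable fun n => ρ ^ (n + K) :=
    (summable_nat_add_iff K).2 (summable_geometric_of_lt_one hρ.le hρ1)
  have hle : ∀ n, |coeff n w| * ρ ^ n ≤ ρ ^ n := fun n => by
    rw [hw, coeff_mk, abs_of_nonneg (correction_nonneg h n)]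
    exact mul_le_of_le_one_left (pow_nonneg hρ.le n) (correction_le_one h n)
  have hw1 : IsL1 ρ w := Summable.of_nonneg_of_le
    (fun n => mul_nonneg (abs_nonneg _) (pow_nonneg hρ.le n)) hle
    (summable_geometric_of_lt_one hρ.le hρ1)
  have hw0 : constantCoeff w = 0 := by
    rw [← coeff_zero_eq_constantCoeff_apply, hw, coeff_mk, hz 0 (by omega)]
  have hwn : l1norm ρ w < 1 := by
    rw [l1norm, ← hw1.sum_add_tsum_nat_add K, Finset.sum_eq_zero, zero_add]
    · calc ∑' n, |coeff (n + K) w| * ρ ^ (n + K) ≤ ∑' n, ρ ^ (n + K) :=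
            Summable.tsum_le_tsum (fun n => hle _) ((summable_nat_add_iff K).2 hw1) hgeo
        _ = ρ ^ K * (1 - ρ)⁻¹ := by
            simp only [pow_add, mul_comm _ (ρ ^ K)]
            rw [tsum_mul_left, tsum_geometric_of_lt_one hρ.le hρ1]
        _ < 1 := by
            rw [← div_eq_mul_inv, div_lt_one (sub_pos.2 hρ1)]
            exact hK
    · intro n hn
      rw [hw, coeff_mk, hz n (by rw [Finset.mem_range] at hn; omega), abs_zero, zero_mul]
  obtain ⟨x, hx, hx1⟩ := exists_inverse hρ.le hw0 hw1 hwn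
  have hone : IsL1 ρ 1 := summable_of_ne_finset_zero (s := {0}) fun n hn => by
    rw [Finset.mem_singleton] at hn
    simp [coeff_one, hn]
  have h1w : IsL1 ρ (1 + w) := Summable.of_nonneg_of_le
    (fun n => mul_nonneg (abs_nonneg _) (pow_nonneg hρ.le n)) (fun n => by
      rw [map_add, ← add_mul]
      exact mul_le_mul_of_nonneg_right (abs_add_le _ _) (pow_nonneg hρ.le n)) (hone.add hw1)
  refine ⟨u * (1 + w), u' * x, (hu.mul hρ.le h1w).1, (hu'.mul hρ.le hx).1, ?_, ?_, fun n => ?_⟩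
  · rw [mul_mul_mul_comm, huu, hx1, one_mul]
  · rw [coeff_zero_eq_constantCoeff_apply] at hu0 ⊢
    rw [map_mul, map_add, hw0, hu0]
    simp
  · rw [← mul_assoc]
    exact coeff_mul_correction hh0 n

end RealSeries

/-! ### Division by 1 - x⁻¹ X with norm control -/

section Division

open PowerSeries

/-- The power series `1 - x⁻¹ X`, which vanishes at `x`. -/
noncomputable def linearSeries (x : ℝ) : PowerSeries ℝ := 1 - C x⁻¹ * X

theorem coeff_zero_linearSeries_mul (x : ℝ) (b : PowerSeries ℝ) :
    coeff 0 (linearSeries x * b) = coeff 0 b := by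
  rw [linearSeries, sub_mul, one_mul, map_sub, mul_assoc, coeff_C_mul, mul_comm X,
    coeff_zero_mul_X, mul_zero, sub_zero]

theorem coeff_succ_linearSeries_mul (x : ℝ) (b : PowerSeries ℝ) (n : ℕ) :
    coeff (n + 1) (linearSeries x * b) = coeff (n + 1) b - x⁻¹ * coeff n b := by
  rw [linearSeries, sub_mul, one_mul, map_sub, mul_assoc, coeff_C_mul, coeff_succ_X_mul]

theorem summable_coeff_mul_pow {ρ x : ℝ} (hx : 0 ≤ x) (hxρ : x ≤ ρ) {a : PowerSeries ℝ}
    (ha : IsL1 ρ a) : Summable fun n => coeff n a * x ^ n := by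
  refine Summable.of_norm (Summable.of_nonneg_of_le (fun _ => norm_nonneg _) (fun n => ?_) ha)
  rw [norm_mul, Real.norm_eq_abs, norm_pow, Real.norm_of_nonneg hx]
  exact mul_le_mul_of_nonneg_left (pow_le_pow_left₀ hx hxρ n) (abs_nonneg _)

/-- A series vanishing at `x` is divisible by `1 - x⁻¹ X`, with control of the norm. -/
theorem exists_linearSeries_mul_eq {ρ x : ℝ} (hx : 0 < x) (hxρ : x < ρ) {a : PowerSeries ℝ}
    (ha : IsL1 ρ a) (h0 : ∑' n, coeff n a * x ^ n = 0) : ∃ b, linearSeries x * b = a ∧ IsL1 ρ b ∧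
      l1norm ρ b ≤ 2 * (x / ρ) / (1 - x / ρ) * l1norm ρ a := by
  have hρ : 0 < ρ := hx.trans hxρ
  have hxn : x ≠ 0 := hx.ne'
  have hs := summable_coeff_mul_pow hx.le hxρ.le ha
  -- The formal quotient: (1 - X/x)⁻¹ is the geometric series, so its coefficients are partial sums
  -- of a(x) divided by x^n.
  set b : PowerSeries ℝ := PowerSeries.mk fun n =>
    (∑ k ∈ Finset.range (n + 1), coeff k a * x ^ k) / x ^ n with hb
  have hq1 : x / ρ < 1 := (div_lt_one hρ).2 hxρ
  have hq0 : 0 < x / ρ := div_pos hx hρ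
  set N := l1norm ρ a with hN
  have hlb : linearSeries x * b = a := by
    ext n
    rcases n with _ | n
    · rw [coeff_zero_linearSeries_mul, hb, coeff_mk]
      simp
    · rw [coeff_succ_linearSeries_mul, hb, coeff_mk, coeff_mk, Finset.sum_range_succ]
      field_simp
      ring
  -- As a(x) = 0, the partial sum is minus the tail, which is at most (x/ρ)^n N.
  have htail : ∀ n, |coeff n b| * ρ ^ n ≤ N := by
    intro n
    have h1 := hs.sum_add_tsum_nat_add (n + 1)
    rw [h0] at h1
    have h2 : ∑ k ∈ Finset.range (n + 1), coeff k a * x ^ k =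
        -∑' k, coeff (k + (n + 1)) a * x ^ (k + (n + 1)) := by linarith
    have h3 : |∑ k ∈ Finset.range (n + 1), coeff k a * x ^ k| ≤ (x / ρ) ^ n * N := by
      rw [h2, abs_neg, ← Real.norm_eq_abs]
      have h4 : Summable fun k => (x / ρ) ^ n * (|coeff (k + (n + 1)) a| * ρ ^ (k + (n + 1))) :=
        ((summable_nat_add_iff (n + 1)).2 ha).mul_left _
      refine (tsum_of_norm_bounded h4.hasSum fun k => ?_).trans ?_
      · rw [norm_mul, Real.norm_eq_abs, Real.norm_of_nonneg (pow_nonneg hx.le _), mul_left_comm]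
        refine mul_le_mul_of_nonneg_left ?_ (abs_nonneg _)
        calc x ^ (k + (n + 1)) = (x / ρ) ^ (k + (n + 1)) * ρ ^ (k + (n + 1)) := by
              rw [div_pow, div_mul_cancel₀ _ (pow_ne_zero _ hρ.ne')]
          _ ≤ (x / ρ) ^ n * ρ ^ (k + (n + 1)) :=
              mul_le_mul_of_nonneg_right (pow_le_pow_of_le_one hq0.le hq1.le (by omega))
                (pow_nonneg hρ.le _)
      · rw [tsum_mul_left]
        refine mul_le_mul_of_nonneg_left ?_ (pow_nonneg hq0.le n)
        rw [hN, l1norm, ← (show Summable fun n => |coeff n a| * ρ ^ n from ha).sum_add_tsum_nat_add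
          (n + 1)]
        exact le_add_of_nonneg_left (Finset.sum_nonneg fun k _ =>
          mul_nonneg (abs_nonneg _) (pow_nonneg hρ.le k))
    rw [hb, coeff_mk, abs_div, abs_of_pos (pow_pos hx n), div_mul_eq_mul_div,
      div_le_iff₀ (pow_pos hx n)]
    refine (mul_le_mul_of_nonneg_right h3 (pow_nonneg hρ.le n)).trans (le_of_eq ?_)
    rw [div_pow]
    have := hρ.ne'
    field_simp
  have hrec : ∀ n, |coeff n b| * ρ ^ n ≤
      x / ρ * (|coeff (n + 1) b| * ρ ^ (n + 1) + |coeff (n + 1) a| * ρ ^ (n + 1)) := by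
    intro n
    have h1 : coeff n b = x * (coeff (n + 1) b - coeff (n + 1) a) := by
      conv_rhs => rw [← hlb, coeff_succ_linearSeries_mul]
      field_simp
      ring
    rw [h1, abs_mul, abs_of_pos hx, ← add_mul, pow_succ]
    have h2 := abs_sub (coeff (n + 1) b) (coeff (n + 1) a)
    calc x * |coeff (n + 1) b - coeff (n + 1) a| * ρ ^ n
        ≤ x * (|coeff (n + 1) b| + |coeff (n + 1) a|) * ρ ^ n := by gcongr
      _ = _ := by field_simp
  -- With q = x/ρ, summing the recursion gives S ≤ q (S + N + boundary term). The boundary term is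
  -- at most N by `htail`, whence S ≤ 2qN / (1 - q).
  have hbd : ∀ M, ∑ n ∈ Finset.range M, |coeff n b| * ρ ^ n ≤
      2 * (x / ρ) / (1 - x / ρ) * N := by
    intro M
    have h1 := Finset.sum_le_sum fun n (_ : n ∈ Finset.range M) => hrec n
    rw [← Finset.mul_sum, Finset.sum_add_distrib] at h1
    have h2 := Finset.sum_range_succ (fun n => |coeff n b| * ρ ^ n) M
    rw [Finset.sum_range_succ'] at h2
    have h3 := Finset.sum_range_succ' (fun n => |coeff n a| * ρ ^ n) M
    have h4 : ∑ n ∈ Finset.range (M + 1), |coeff n a| * ρ ^ n ≤ N :=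
      ha.sum_le_tsum _ fun k _ => mul_nonneg (abs_nonneg _) (pow_nonneg hρ.le k)
    have h5 : 0 ≤ |coeff 0 a| * ρ ^ 0 := by positivity
    have h6 : 0 ≤ |coeff 0 b| * ρ ^ 0 := by positivity
    rw [div_mul_eq_mul_div, le_div_iff₀ (sub_pos.2 hq1)]
    have h7 := htail M
    set S := ∑ n ∈ Finset.range M, |coeff n b| * ρ ^ n
    set S' := ∑ n ∈ Finset.range M, |coeff (n + 1) b| * ρ ^ (n + 1)
    set A' := ∑ n ∈ Finset.range M, |coeff (n + 1) a| * ρ ^ (n + 1)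
    have h8 : x / ρ * (S' + A') ≤ x / ρ * (S + 2 * N) :=
      mul_le_mul_of_nonneg_left (by linarith) hq0.le
    nlinarith
  have hbs : IsL1 ρ b := summable_of_sum_range_le
    (fun n => mul_nonneg (abs_nonneg _) (pow_nonneg hρ.le n)) hbd
  exact ⟨b, hlb, hbs, Real.tsum_le_of_sum_range_le
    (fun n => mul_nonneg (abs_nonneg _) (pow_nonneg hρ.le n)) hbd⟩

end Division

/-! ### Integral power series inside ℤ((T))_r -/

namespace ZTr

variable {r : Set.Ioo (0 : ℝ) 1}

theorem coeff_ofPowerSeries_neg (p : PowerSeries ℤ) {n : ℤ} (hn : n < 0) :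
    (HahnSeries.ofPowerSeries ℤ ℤ p).coeff n = 0 := by
  rw [PowerSeries.coeff_coe, if_pos hn]

/-- The terms `F` are left general so that the norm, the value at r' and the derivative at r' are
all transferred from sums over ℕ to sums over ℤ at once. -/
theorem hasSum_ofPowerSeries {M : Type*} [AddCommMonoid M] [TopologicalSpace M] (p : PowerSeries ℤ)
    (F : ℤ → ℤ → M) (hF : ∀ n, F 0 n = 0) (m : M) :
    HasSum (fun n : ℕ => F (PowerSeries.coeff n p) n) m ↔
      HasSum (fun n : ℤ => F ((HahnSeries.ofPowerSeries ℤ ℤ p).coeff n) n) m := by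
  have h : (fun n : ℕ => F (PowerSeries.coeff n p) n) =
      (fun n : ℤ => F ((HahnSeries.ofPowerSeries ℤ ℤ p).coeff n) n) ∘ Nat.cast := by
    funext n
    simp only [Function.comp]
    rw [HahnSeries.ofPowerSeries_apply_coeff]
  rw [h]
  refine Nat.cast_injective.hasSum_iff fun n hn => ?_
  rw [coeff_ofPowerSeries_neg p, hF]
  by_contra h
  exact hn ⟨n.toNat, by simpa using h⟩

/-- A power series with integral coefficients, as an element of `ℤ((T))_r`. -/
noncomputable def ofPowerSeries (p : PowerSeries ℤ)
    (hp : IsL1 r (p.map (Int.castRingHom ℝ))) : ZTr r :=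
  ⟨HahnSeries.ofPowerSeries ℤ ℤ p, by
    obtain ⟨m, hm⟩ := hp
    simp only [PowerSeries.coeff_map] at hm
    exact ((hasSum_ofPowerSeries p (fun a n => |(a : ℝ)| * (r : ℝ) ^ n) (by simp) m).1
      (by simpa using hm)).summable⟩

theorem hasSum_ofPowerSeries' {M : Type*} [AddCommMonoid M] [TopologicalSpace M] {p : PowerSeries ℤ}
    (hp : IsL1 r (p.map (Int.castRingHom ℝ))) (F : ℤ → ℤ → M) (hF : ∀ n, F 0 n = 0) {m : M}
    (h : HasSum (fun n : ℕ => F (PowerSeries.coeff n p) n) m) :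
    HasSum (fun n : ℤ => F ((ofPowerSeries p hp).coeff n) n) m :=
  (hasSum_ofPowerSeries p F hF m).1 h

theorem norm_ofPowerSeries {p : PowerSeries ℤ} (hp : IsL1 r (p.map (Int.castRingHom ℝ))) :
    (ofPowerSeries p hp).norm = l1norm r (p.map (Int.castRingHom ℝ)) := by
  refine (hasSum_ofPowerSeries' hp (fun a n => |(a : ℝ)| * (r : ℝ) ^ n) (by simp) ?_).tsum_eq
  simpa [l1norm] using Summable.hasSum hp

theorem monomial_val (k : ℤ) : (monomial r k).1 = HahnSeries.single k 1 := by
  ext n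
  change (Pi.single k 1 : ℤ → ℤ) n = _
  rw [HahnSeries.coeff_single, Pi.single_apply]
  congr

theorem monomial_mul_monomial (k l : ℤ) : monomial r k * monomial r l = monomial r (k + l) := by
  refine Subtype.ext ?_
  change (monomial r k).1 * (monomial r l).1 = _
  rw [monomial_val, monomial_val, monomial_val, HahnSeries.single_mul_single, one_mul]

theorem monomial_zero : monomial r 0 = 1 := by
  refine Subtype.ext ?_
  rw [monomial_val]
  rfl

theorem norm_monomial_mul_le (k : ℤ) (a : ZTr r) : (monomial r k * a).norm ≤ (r : ℝ) ^ k * a.norm :=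
  (norm_mul_le _ _).trans_eq (by rw [norm_monomial])

/-- Extracting the lowest power of T reduces division in ℤ((T))_r to power series, since T^k is a
unit with explicit norm and explicit image under θ. -/
theorem exists_eq_monomial_mul (a : ZTr r) : ∃ (k : ℤ) (p : PowerSeries ℤ)
    (hp : IsL1 r (p.map (Int.castRingHom ℝ))), a = monomial r k * ofPowerSeries p hp := by
  let k := a.1.order
  have h1 := LaurentSeries.ofPowerSeries_powerSeriesPart a.1
  have h2 := LaurentSeries.single_order_mul_powerSeriesPart a.1
  have hmem : HahnSeries.ofPowerSeries ℤ ℤ (LaurentSeries.powerSeriesPart a.1) ∈ ztrSubring r := by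
    rw [h1, ← monomial_val]
    exact mul_mem (monomial r (-k)).2 a.2
  have hp : IsL1 r ((LaurentSeries.powerSeriesPart a.1).map (Int.castRingHom ℝ)) := by
    obtain ⟨m, hm⟩ := hmem
    have := ((hasSum_ofPowerSeries (LaurentSeries.powerSeriesPart a.1)
      (fun a n => |(a : ℝ)| * (r : ℝ) ^ n) (by simp) m).2 hm).summable
    unfold IsL1
    simpa using this
  refine ⟨k, LaurentSeries.powerSeriesPart a.1, hp, Subtype.ext ?_⟩
  change a.1 = (monomial r k).1 * HahnSeries.ofPowerSeries ℤ ℤ (LaurentSeries.powerSeriesPart a.1)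
  rw [monomial_val]
  exact h2.symm

end ZTr

/-! ### The generator of the kernel of θ -/

section Generator

variable {r r' : Set.Ioo (0 : ℝ) 1} (h : r' < r)

theorem hasSum_theta (a : ZTr r) :
    HasSum (fun k : ℤ => (a.coeff k : ℝ) * (r' : ℝ) ^ k) (theta h a) := by
  have h1 := (ZTr.summable_eval _ (summable_real h) a).of_norm.hasSum
  have h2 : ∀ k : ℤ, a.coeff k • ((Units.mk0 (r' : ℝ) r'.2.1.ne' ^ k : ℝˣ) : ℝ) =
      (a.coeff k : ℝ) * (r' : ℝ) ^ k := fun k => by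
    rw [zsmul_eq_mul, Units.val_zpow_eq_zpow_val, Units.val_mk0]
  have h3 : theta h a = ∑' k : ℤ, (a.coeff k : ℝ) * (r' : ℝ) ^ k := tsum_congr h2
  rw [h3]
  simp only [h2] at h1
  exact h1

theorem theta_monomial (k : ℤ) : theta h (ZTr.monomial r k) = (r' : ℝ) ^ k := by
  refine (ZTr.eval_monomial _ (summable_real h) k).trans ?_
  simp

theorem theta_ofPowerSeries {p : PowerSeries ℤ}
    (hp : IsL1 r (p.map (Int.castRingHom ℝ))) : theta h (ZTr.ofPowerSeries p hp) =
      ∑' n, PowerSeries.coeff n (p.map (Int.castRingHom ℝ)) * (r' : ℝ) ^ n := by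
  refine (hasSum_theta h _).unique (ZTr.hasSum_ofPowerSeries' hp
    (fun a n => (a : ℝ) * (r' : ℝ) ^ n) (by simp) ?_)
  have := (summable_coeff_mul_pow r'.2.1.le (le_of_lt h) hp).hasSum
  simpa using this

open PowerSeries in
/-- Evaluation of a product of real power series. -/
theorem tsum_coeff_mul {ρ x : ℝ} (hx : 0 ≤ x) (hxρ : x ≤ ρ) {f g : PowerSeries ℝ}
    (hf : IsL1 ρ f) (hg : IsL1 ρ g) : ∑' n, coeff n (f * g) * x ^ n =
      (∑' n, coeff n f * x ^ n) * ∑' n, coeff n g * x ^ n := by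
  rw [tsum_mul_tsum_eq_tsum_sum_antidiagonal_of_summable_norm
    (summable_coeff_mul_pow hx hxρ hf).norm (summable_coeff_mul_pow hx hxρ hg).norm]
  refine tsum_congr fun n => ?_
  rw [coeff_mul, Finset.sum_mul]
  refine Finset.sum_congr rfl fun q hq => ?_
  rw [← Finset.HasAntidiagonal.mem_antidiagonal.1 hq, pow_add]
  ring

open PowerSeries in
theorem hasSum_linearSeries_mul {x : ℝ} (hx : x ≠ 0) {g : PowerSeries ℝ}
    (hg : Summable fun n => coeff n g * x ^ n) :
    HasSum (fun n => coeff n (linearSeries x * g) * x ^ n) 0 := by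
  rw [← hasSum_nat_add_iff' 1, Finset.sum_range_one, coeff_zero_linearSeries_mul, zero_sub]
  have h1 := ((hasSum_nat_add_iff' 1).2 hg.hasSum).sub hg.hasSum
  rw [Finset.sum_range_one, sub_sub_cancel_left] at h1
  convert h1 using 2 with n
  rw [coeff_succ_linearSeries_mul]
  field_simp
  ring

-- This is x d/dx of (1 - X/x) g at the point x: by the product rule only the derivative of the
-- linear factor survives. Termwise, it is a telescoping sum.
open PowerSeries in
theorem hasSum_linearSeries_mul_derivative {x : ℝ} (hx : x ≠ 0) {g : PowerSeries ℝ}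
    (hg : Summable fun n => coeff n g * x ^ n)
    (hg' : Summable fun n : ℕ => coeff n g * (n * x ^ n)) :
    HasSum (fun n : ℕ => coeff n (linearSeries x * g) * (n * x ^ n))
      (-∑' n, coeff n g * x ^ n) := by
  rw [← hasSum_nat_add_iff' 1, Finset.sum_range_one, Nat.cast_zero, zero_mul, mul_zero, sub_zero]
  have h1 := (((hasSum_nat_add_iff' 1).2 hg'.hasSum).sub hg'.hasSum).sub hg.hasSum
  rw [Finset.sum_range_one, Nat.cast_zero, zero_mul, mul_zero, sub_zero, sub_self, zero_sub] at h1
  convert h1 using 2 with n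
  rw [coeff_succ_linearSeries_mul]
  push_cast
  field_simp
  ring

/-- The generator of the kernel of `θ`. -/
theorem exists_generator : ∃ f : ZTr r, f ≠ 0 ∧ theta h f = 0 ∧
    ∑' k : ℤ, (f.coeff k : ℝ) * (k * (r' : ℝ) ^ k) ≠ 0 ∧
    ∃ C, 0 ≤ C ∧ ∀ a, theta h a = 0 → ∃ b, a = f * b ∧ b.norm ≤ C * a.norm := by
  have hr' : (r' : ℝ) ≠ 0 := r'.2.1.ne'
  obtain ⟨g, g', hg, hg', hgg, hg0, hint⟩ := exists_unit_mul_integral r.2.1 r.2.2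
    (l := linearSeries r') (by
      have := coeff_zero_linearSeries_mul (r' : ℝ) 1
      rw [mul_one] at this
      simpa using this)
  choose c hc using hint
  set φ := PowerSeries.map (Int.castRingHom ℝ) with hφ
  set F : PowerSeries ℤ := PowerSeries.mk c with hF
  have hφinj : Function.Injective φ := PowerSeries.map_injective _ Int.cast_injective
  have hFr : φ F = linearSeries r' * g := by
    ext n
    rw [hc, hφ, PowerSeries.coeff_map, hF, PowerSeries.coeff_mk]
    rfl
  have hc0 : c 0 = 1 := by
    have := hc 0
    rw [coeff_zero_linearSeries_mul, hg0] at this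
    exact_mod_cast this.symm
  -- The inverse of F is only formal, as F vanishes at r'. It serves to make quotients by F
  -- integral.
  have hFu : F * PowerSeries.invOfUnit F 1 = 1 := PowerSeries.mul_invOfUnit _ _ (by
    rw [← PowerSeries.coeff_zero_eq_constantCoeff_apply, hF, PowerSeries.coeff_mk, hc0]; rfl)
  have hl : IsL1 r (linearSeries r') := by
    refine summable_of_ne_finset_zero (s := {0, 1}) fun n hn => ?_
    simp only [Finset.mem_insert, Finset.mem_singleton, not_or] at hn
    have : PowerSeries.coeff n (linearSeries r') = 0 := by
      simp [linearSeries, PowerSeries.coeff_one, PowerSeries.coeff_X, hn.1, hn.2]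
    simp [this]
  have hFl : IsL1 r (φ F) := by
    rw [hFr]
    exact (hl.mul r.2.1.le hg).1
  have hgs := summable_coeff_mul_pow r'.2.1.le (le_of_lt h) hg
  -- The factor n (r'/r)^n is bounded, by the sum of all such factors, so the strict inequality r' <
  -- r pays for the derivative.
  have hgd : Summable fun n : ℕ => PowerSeries.coeff n g * (n * (r' : ℝ) ^ n) := by
    have hq : ‖(r' : ℝ) / r‖ < 1 := by
      rw [Real.norm_of_nonneg (div_nonneg r'.2.1.le r.2.1.le)]
      exact (div_lt_one r.2.1).2 h
    have hnn : ∀ n : ℕ, 0 ≤ (n : ℝ) ^ 1 * ((r' : ℝ) / r) ^ n := fun n =>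
      mul_nonneg (by positivity) (pow_nonneg (div_nonneg r'.2.1.le r.2.1.le) n)
    have h1 := summable_pow_mul_geometric_of_norm_lt_one 1 hq
    refine Summable.of_norm (Summable.of_nonneg_of_le (fun _ => norm_nonneg _) (fun n => ?_)
      ((show Summable fun n => |PowerSeries.coeff n g| * (r : ℝ) ^ n from hg).mul_right
        (∑' n : ℕ, (n : ℝ) ^ 1 * ((r' : ℝ) / r) ^ n)))
    have h2 := h1.le_tsum n fun m _ => hnn m
    calc ‖PowerSeries.coeff n g * (n * (r' : ℝ) ^ n)‖
        = |PowerSeries.coeff n g| * (r : ℝ) ^ n * ((n : ℝ) ^ 1 * ((r' : ℝ) / r) ^ n) := by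
          have := r.2.1.ne'
          rw [Real.norm_eq_abs, abs_mul, abs_of_nonneg
            (mul_nonneg n.cast_nonneg (pow_nonneg r'.2.1.le n)), div_pow]
          field_simp
      _ ≤ _ := mul_le_mul_of_nonneg_left h2
          (mul_nonneg (abs_nonneg _) (pow_nonneg r.2.1.le n))
  refine ⟨ZTr.ofPowerSeries F hFl, ?_, ?_, ?_, ?_⟩
  · intro h0
    have h1 : (ZTr.ofPowerSeries F hFl).coeff (0 : ℕ) = 0 := by rw [h0]; rfl
    have h2 : (ZTr.ofPowerSeries F hFl).coeff (0 : ℕ) = 1 := by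
      refine (HahnSeries.ofPowerSeries_apply_coeff _ _).trans ?_
      rw [hF, PowerSeries.coeff_mk, hc0]
    omega
  · rw [theta_ofPowerSeries, ← hφ, hFr]
    exact (hasSum_linearSeries_mul hr' hgs).tsum_eq
  · have h1 := hasSum_linearSeries_mul_derivative hr' hgs hgd
    rw [← hFr] at h1
    have h2 := ZTr.hasSum_ofPowerSeries' hFl (fun a n => (a : ℝ) * (n * (r' : ℝ) ^ n)) (by simp)
      (by simpa [hφ] using h1)
    rw [h2.tsum_eq, neg_ne_zero]
    intro h3
    -- The derivative is -g(r'), and g(r') g'(r') = 1 excludes that it vanishes.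
    have h4 := tsum_coeff_mul r'.2.1.le (le_of_lt h) hg hg'
    rw [h3, zero_mul, hgg, tsum_eq_single 0 (fun n hn => by
      rw [PowerSeries.coeff_one, if_neg hn, zero_mul])] at h4
    simp at h4
  · set q := (r' : ℝ) / r with hq
    have hq1 : q < 1 := (div_lt_one r.2.1).2 h
    have hq0 : 0 < q := div_pos r'.2.1 r.2.1
    have hC0 : 0 ≤ 2 * q / (1 - q) := div_nonneg (by linarith) (by linarith)
    have hC1 := l1norm_nonneg r.2.1.le g'
    -- One factor for multiplication by g⁻¹, the other for division by 1 - X/r'.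
    refine ⟨l1norm r g' * (2 * q / (1 - q)), mul_nonneg hC1 hC0, fun a ha => ?_⟩
    obtain ⟨k, p, hp, rfl⟩ := ZTr.exists_eq_monomial_mul a
    rw [map_mul, theta_monomial, mul_eq_zero, or_iff_right (zpow_ne_zero k hr'),
      theta_ofPowerSeries] at ha
    obtain ⟨b, hb, hb1, hb2⟩ := exists_linearSeries_mul_eq r'.2.1 h hp ha
    set Q := PowerSeries.invOfUnit F 1 * p with hQ
    have hFQ : F * Q = p := by rw [hQ, ← mul_assoc, hFu, one_mul]
    have hF0 : φ F ≠ 0 := by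
      intro h0
      have h1 : F = 0 := hφinj (h0.trans (map_zero φ).symm)
      rw [h1, zero_mul] at hFu
      exact zero_ne_one hFu
    -- The two descriptions of p / F: the formal one is integral, and the one over ℝ has bounded
    -- norm.
    have hQr : φ Q = g' * b := by
      refine mul_left_cancel₀ hF0 ?_
      rw [← map_mul, hFQ, hFr, ← hb]
      calc linearSeries r' * b = linearSeries r' * (g * g') * b := by rw [hgg, mul_one]
        _ = _ := by ring
    obtain ⟨hQ1, hQ2⟩ := hg'.mul r.2.1.le hb1
    rw [← hQr] at hQ1 hQ2
    refine ⟨ZTr.monomial r k * ZTr.ofPowerSeries Q hQ1, ?_, ?_⟩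
    · rw [mul_left_comm]
      congr 1
      refine Subtype.ext ?_
      change _ = HahnSeries.ofPowerSeries ℤ ℤ F * HahnSeries.ofPowerSeries ℤ ℤ Q
      rw [← map_mul, hFQ]
      rfl
    · refine (ZTr.norm_monomial_mul_le _ _).trans ?_
      rw [ZTr.norm_ofPowerSeries]
      have h5 : (ZTr.ofPowerSeries p hp).norm ≤
          (r : ℝ) ^ (-k) * (ZTr.monomial r k * ZTr.ofPowerSeries p hp).norm := by
        have := ZTr.norm_monomial_mul_le (-k) (ZTr.monomial r k * ZTr.ofPowerSeries p hp)
        rwa [← mul_assoc, ZTr.monomial_mul_monomial, neg_add_cancel, ZTr.monomial_zero,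
          one_mul] at this
      rw [ZTr.norm_ofPowerSeries] at h5
      have hrk : 0 < (r : ℝ) ^ k := zpow_pos r.2.1 k
      calc (r : ℝ) ^ k * l1norm r (φ Q) ≤ (r : ℝ) ^ k * (l1norm r g' * (2 * q / (1 - q) *
            ((r : ℝ) ^ (-k) * (ZTr.monomial r k * ZTr.ofPowerSeries p hp).norm))) := by
            refine mul_le_mul_of_nonneg_left (hQ2.trans (mul_le_mul_of_nonneg_left
              (hb2.trans (mul_le_mul_of_nonneg_left h5 hC0)) hC1)) hrk.le
        _ = _ := by
            rw [zpow_neg]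
            field_simp

end Generator

/-! ### Estimates in ℝ[X]/X^n -/

namespace TruncPoly

variable {n : ℕ}

theorem continuous_coeff (j : Fin n) : Continuous (coeff j) := by
  refine AddMonoidHomClass.continuous_of_bound (coeff j) 1 fun z => ?_
  rw [one_mul]
  exact abs_coeff_le z j

theorem coeff_teich (x : ℝ) (j : Fin n) : coeff j (teich n x) = teichCoeff j x := by
  rw [teich, coeff_ofPowerSeries, teichSeries, PowerSeries.coeff_mk, teichCoeff]

theorem teich_mul (x y : ℝ) : teich n (x * y) = teich n x * teich n y := by
  rw [teich, teichSeries_mul, map_mul, teich, teich]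

theorem teich_one : teich n 1 = 1 := by rw [teich, teichSeries_one, map_one]

theorem teichUnit_zpow (x : ℝ) (hx : x ≠ 0) (k : ℤ) :
    ((teichUnit n x hx ^ k : (TruncPoly n)ˣ) : TruncPoly n) = teich n (x ^ k) := by
  have h : ∀ k : ℕ, ((teichUnit n x hx ^ k : (TruncPoly n)ˣ) : TruncPoly n) = teich n (x ^ k) :=
    fun k => by rw [Units.val_pow_eq_pow_val]; exact teich_pow x k
  obtain ⟨k, rfl | rfl⟩ := k.eq_nat_or_neg
  · rw [zpow_natCast, zpow_natCast, h]
  · rw [zpow_neg, zpow_neg, zpow_natCast, zpow_natCast]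
    refine Units.inv_eq_of_mul_eq_one_right ?_
    rw [h, ← teich_mul, mul_inv_cancel₀ (pow_ne_zero k hx), teich_one]

theorem expand_one_zero (hn : 0 < n) : expand (Pi.single (⟨0, hn⟩ : Fin n) (1 : ℝ)) = 1 := by
  rw [expand, Finset.sum_eq_single ⟨0, hn⟩]
  · rw [Pi.single_eq_same, teich_one]
    simp
  · intro i _ hi
    rw [Pi.single_eq_of_ne hi, teich, teichSeries_zero, map_zero, zero_mul]
  · intro hi
    exact absurd (Finset.mem_univ _) hi

/-- On bounded sets the `ℓ^p`-quasinorm is bounded. -/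
theorem exists_expand_bound (n : ℕ) {p : ℝ} (hp : 0 < p) (R : ℝ) : ∃ C, 0 ≤ C ∧
    ∀ z : TruncPoly n, ‖z‖ ≤ R → ∃ x : Fin n → ℝ, z = expand x ∧ ∑ i, |x i| ^ p ≤ C := by
  rcases Nat.eq_zero_or_pos n with rfl | hn
  · exact ⟨0, le_rfl, fun z _ => ⟨0, ext fun j => j.elim0, by simp⟩⟩
  obtain ⟨C, hC, h⟩ := exists_comb_bound n hp (max R 0)
  set e : Fin n → ℝ := Pi.single (⟨0, hn⟩ : Fin n) (1 : ℝ)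
  -- Here z is written as z · 1 + 0 · 1, with 1 expanded by the basis vector e, so that the bound
  -- for linear combinations applies.
  refine ⟨C * (∑ i, |e i| ^ p + ∑ i, |e i| ^ p), by positivity, fun z hz => ?_⟩
  obtain ⟨w, hw, hw'⟩ := h z 0 (hz.trans (le_max_left _ _)) (by simp) e e
  rw [expand_one_zero, mul_one, zero_mul, add_zero] at hw
  exact ⟨w, hw, hw'⟩

/-- Split y = y^(1-p) y^p. The first factor absorbs the logarithms, since u (log u)^j is bounded on
[0, 1] and log y = log(y^(1-p)) / (1 - p). -/
theorem exists_abs_mul_log_le {p : ℝ} (hp : p < 1) (j : ℕ) : ∃ C, ∀ y : ℝ, 0 < y → y ≤ 1 →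
    |y * Real.log |y| ^ j| ≤ C * y ^ p := by
  have hp' : 0 < 1 - p := sub_pos.2 hp
  obtain ⟨C, hC⟩ := ((isCompact_Icc (a := (0 : ℝ)) (b := 1)).image
    (continuous_mul_log_pow j).abs).bddAbove
  refine ⟨C / (1 - p) ^ j, fun y hy hy1 => ?_⟩
  have h1 : |y ^ (1 - p) * Real.log |y ^ (1 - p)| ^ j| ≤ C :=
    hC ⟨y ^ (1 - p), ⟨Real.rpow_nonneg hy.le _, Real.rpow_le_one hy.le hy1 hp'.le⟩, rfl⟩
  rw [abs_of_pos (Real.rpow_pos_of_pos hy _), Real.log_rpow hy, mul_pow, abs_mul, abs_mul,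
    abs_of_pos (Real.rpow_pos_of_pos hy _), abs_of_pos (pow_pos hp' j)] at h1
  have h2 : y = y ^ (1 - p) * y ^ p := by
    rw [← Real.rpow_add hy, sub_add_cancel, Real.rpow_one]
  have h3 : |y * Real.log |y| ^ j| = y ^ (1 - p) * y ^ p * |Real.log y ^ j| := by
    rw [abs_mul, abs_of_pos hy, ← h2]
  rw [h3, div_mul_eq_mul_div, le_div_iff₀ (pow_pos hp' j)]
  have := mul_le_mul_of_nonneg_right h1 (Real.rpow_nonneg hy.le p)
  linarith

theorem exists_norm_teich_le (n : ℕ) {p : ℝ} (hp : p < 1) : ∃ C, 0 ≤ C ∧ ∀ y : ℝ, 0 < y → y ≤ 1 →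
    ‖teich n y‖ ≤ C * y ^ p := by
  choose C hC using fun j : Fin n => exists_abs_mul_log_le hp j
  refine ⟨|∑ j : Fin n, C j / ((j : ℕ).factorial : ℝ)|, abs_nonneg _, fun y hy hy1 => ?_⟩
  refine le_trans ?_ (mul_le_mul_of_nonneg_right (le_abs_self _) (Real.rpow_nonneg hy.le p))
  rw [norm_eq, Finset.sum_mul]
  refine Finset.sum_le_sum fun j _ => ?_
  rw [coeff_teich, teichCoeff, abs_div, Nat.abs_cast, div_mul_eq_mul_div]
  exact div_le_div_of_nonneg_right (hC j y hy hy1) (Nat.cast_nonneg _)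

end TruncPoly

/-! ### The limit of the maps θ_n in ℝ⟦X⟧ -/

section ThetaSeries

variable {r r' : Set.Ioo (0 : ℝ) 1} (h : r' < r)

theorem hasSum_thetaTrunc (n : ℕ) (a : ZTr r) :
    HasSum (fun k : ℤ => a.coeff k • TruncPoly.teich n ((r' : ℝ) ^ k)) (thetaTrunc h n a) := by
  have h1 := (ZTr.summable_eval _ (TruncPoly.summable_teich n h) a).of_norm.hasSum
  have h2 : ∀ k : ℤ, a.coeff k • ((TruncPoly.teichUnit n (r' : ℝ) r'.2.1.ne' ^ k :
      (TruncPoly n)ˣ) : TruncPoly n) = a.coeff k • TruncPoly.teich n ((r' : ℝ) ^ k) :=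
    fun k => by rw [TruncPoly.teichUnit_zpow]
  have h3 : thetaTrunc h n a = ∑' k : ℤ, a.coeff k • TruncPoly.teich n ((r' : ℝ) ^ k) :=
    tsum_congr h2
  rw [h3]
  simp only [h2] at h1
  exact h1

theorem thetaTrunc_monomial (n : ℕ) (k : ℤ) :
    thetaTrunc h n (ZTr.monomial r k) = TruncPoly.teich n ((r' : ℝ) ^ k) :=
  (ZTr.eval_monomial _ (TruncPoly.summable_teich n h) k).trans (TruncPoly.teichUnit_zpow _ _ k)

theorem hasSum_coeff_thetaTrunc {n : ℕ} (j : Fin n) (a : ZTr r) :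
    HasSum (fun k : ℤ => (a.coeff k : ℝ) * teichCoeff j ((r' : ℝ) ^ k))
      (TruncPoly.coeff j (thetaTrunc h n a)) := by
  have h1 := (hasSum_thetaTrunc h n a).map (TruncPoly.coeff j) (TruncPoly.continuous_coeff j)
  have h2 : (TruncPoly.coeff j ∘ fun k : ℤ => a.coeff k • TruncPoly.teich n ((r' : ℝ) ^ k)) =
      fun k : ℤ => (a.coeff k : ℝ) * teichCoeff j ((r' : ℝ) ^ k) := by
    funext k
    simp only [Function.comp]
    rw [map_zsmul, TruncPoly.coeff_teich, zsmul_eq_mul]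
  rwa [h2] at h1

theorem coeff_zero_thetaTrunc {n : ℕ} (hn : 0 < n) (a : ZTr r) :
    TruncPoly.coeff (⟨0, hn⟩ : Fin n) (thetaTrunc h n a) = theta h a := by
  refine (hasSum_coeff_thetaTrunc h _ a).unique ?_
  simpa [teichCoeff] using hasSum_theta h a

/-- The power series `∑ a_k [r']^k` for `a ∈ ℤ((T))_r`. -/
noncomputable def thetaSeries (a : ZTr r) : PowerSeries ℝ :=
  PowerSeries.mk fun j => TruncPoly.coeff (Fin.last j) (thetaTrunc h (j + 1) a)

theorem ofPowerSeries_thetaSeries (n : ℕ) (a : ZTr r) :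
    TruncPoly.ofPowerSeries n (thetaSeries h a) = thetaTrunc h n a := by
  refine TruncPoly.ext fun j => ?_
  rw [TruncPoly.coeff_ofPowerSeries, thetaSeries, PowerSeries.coeff_mk]
  exact (hasSum_coeff_thetaTrunc h _ a).unique (hasSum_coeff_thetaTrunc h _ a)

/-- The j-th coefficient is read off modulo X^(j+1), where `thetaTrunc` is a ring homomorphism. -/
theorem thetaSeries_mul (a b : ZTr r) :
    thetaSeries h (a * b) = thetaSeries h a * thetaSeries h b := by
  ext j
  have h1 := congrArg (TruncPoly.coeff (Fin.last j)) (ofPowerSeries_thetaSeries h (j + 1) (a * b))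
  rw [map_mul, ← ofPowerSeries_thetaSeries, ← ofPowerSeries_thetaSeries, ← map_mul,
    TruncPoly.coeff_ofPowerSeries, TruncPoly.coeff_ofPowerSeries] at h1
  exact h1

theorem coeff_zero_thetaSeries (a : ZTr r) :
    PowerSeries.coeff 0 (thetaSeries h a) = theta h a := by
  rw [thetaSeries, PowerSeries.coeff_mk]
  exact coeff_zero_thetaTrunc h _ a

/-- The linear coefficient of [r'^k] is k log(r') r'^k. This links the order of vanishing in X to
the derivative at r'. -/
theorem coeff_one_thetaSeries (a : ZTr r) : PowerSeries.coeff 1 (thetaSeries h a) =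
    Real.log r' * ∑' k : ℤ, (a.coeff k : ℝ) * (k * (r' : ℝ) ^ k) := by
  rw [thetaSeries, PowerSeries.coeff_mk, ← (hasSum_coeff_thetaTrunc h _ a).tsum_eq,
    ← tsum_mul_left]
  refine tsum_congr fun k => ?_
  have : |(r' : ℝ) ^ k| = (r' : ℝ) ^ k := abs_of_pos (zpow_pos r'.2.1 k)
  rw [teichCoeff, this, Real.log_zpow]
  simp
  ring

theorem TruncPoly.ofPowerSeries_eq_zero_iff (n : ℕ) (g : PowerSeries ℝ) :
    TruncPoly.ofPowerSeries n g = 0 ↔ PowerSeries.X ^ n ∣ g := by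
  rw [PowerSeries.X_pow_dvd_iff]
  constructor
  · intro h j hj
    have := TruncPoly.coeff_ofPowerSeries ⟨j, hj⟩ g
    rw [h, map_zero] at this
    exact this.symm
  · intro h
    refine TruncPoly.ext fun j => ?_
    rw [TruncPoly.coeff_ofPowerSeries, map_zero, h j j.2]

theorem thetaTrunc_eq_zero_iff (n : ℕ) (a : ZTr r) :
    thetaTrunc h n a = 0 ↔ PowerSeries.X ^ n ∣ thetaSeries h a := by
  rw [← ofPowerSeries_thetaSeries, TruncPoly.ofPowerSeries_eq_zero_iff]

/-- A simple zero at r' is a simple zero in X, because log r' ≠ 0; so the cofactor has nonzero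
constant coefficient. -/
theorem exists_thetaSeries_eq {f : ZTr r} (hf : theta h f = 0)
    (hf' : ∑' k : ℤ, (f.coeff k : ℝ) * (k * (r' : ℝ) ^ k) ≠ 0) :
    ∃ v v' : PowerSeries ℝ, v * v' = 1 ∧ thetaSeries h f = PowerSeries.X * v := by
  obtain ⟨v, hv⟩ : PowerSeries.X ∣ thetaSeries h f := by
    rw [PowerSeries.X_dvd_iff, ← PowerSeries.coeff_zero_eq_constantCoeff_apply,
      coeff_zero_thetaSeries, hf]
  refine ⟨v, v⁻¹, PowerSeries.mul_inv_cancel v ?_, hv⟩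
  rw [← PowerSeries.coeff_zero_eq_constantCoeff_apply, ← PowerSeries.coeff_succ_X_mul 0 v, ← hv,
    zero_add, coeff_one_thetaSeries]
  exact mul_ne_zero (Real.log_neg r'.2.1 r'.2.2).ne hf'

/-- Division by the powers of the generator, with control of the norm. -/
theorem exists_pow_mul_eq {f : ZTr r} (hf : theta h f = 0)
    (hf' : ∑' k : ℤ, (f.coeff k : ℝ) * (k * (r' : ℝ) ^ k) ≠ 0) {C : ℝ} (hC : 0 ≤ C)
    (hdiv : ∀ a, theta h a = 0 → ∃ b, a = f * b ∧ b.norm ≤ C * a.norm) (n : ℕ) :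
    ∀ a, thetaTrunc h n a = 0 → ∃ b, a = f ^ n * b ∧ b.norm ≤ C ^ n * a.norm := by
  obtain ⟨v, v', hv, hfv⟩ := exists_thetaSeries_eq h hf hf'
  induction n with
  | zero => exact fun a _ => ⟨a, by simp, by simp⟩
  | succ n ih =>
    intro a ha
    obtain ⟨b, rfl, hb⟩ := hdiv a (by
      rw [← coeff_zero_thetaTrunc h (Nat.succ_pos n), ha, map_zero])
    -- Cancelling X and then the unit v lowers the order of vanishing by one.
    rw [thetaTrunc_eq_zero_iff, thetaSeries_mul, hfv, pow_succ', mul_assoc,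
      mul_dvd_mul_iff_left PowerSeries.X_ne_zero] at ha
    have ha' : PowerSeries.X ^ n ∣ thetaSeries h b := by
      have := ha.mul_left v'
      rwa [← mul_assoc, mul_comm v', hv, one_mul] at this
    obtain ⟨c, hc, hc'⟩ := ih b ((thetaTrunc_eq_zero_iff h n b).2 ha')
    refine ⟨c, by rw [pow_succ', mul_assoc, ← hc], hc'.trans ?_⟩
    rw [pow_succ, mul_assoc]
    exact mul_le_mul_of_nonneg_left hb (pow_nonneg hC n)

theorem thetaTrunc_pow_eq_zero {f : ZTr r} (hf : theta h f = 0) (n : ℕ) :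
    thetaTrunc h n (f ^ n) = 0 := by
  have h1 : PowerSeries.X ∣ thetaSeries h f := by
    rw [PowerSeries.X_dvd_iff, ← PowerSeries.coeff_zero_eq_constantCoeff_apply,
      coeff_zero_thetaSeries, hf]
  rw [map_pow, ← ofPowerSeries_thetaSeries, ← map_pow,
    TruncPoly.ofPowerSeries_eq_zero_iff]
  exact pow_dvd_pow_of_dvd h1 n

end ThetaSeries

/-! ### Comparison of the norm with the ℓ^p-quasinorm -/

section Lift

variable {r r' : Set.Ioo (0 : ℝ) 1} (h : r' < r)

/-- The remainders of the expansion of `y` in base `x`. -/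
noncomputable def remainder (x y : ℝ) : ℕ → ℝ
  | 0 => y
  | n + 1 => (remainder x y n - ⌊remainder x y n⌋) / x

theorem remainder_bound {x : ℝ} (hx : 0 < x) (y : ℝ) (n : ℕ) :
    |remainder x y n| ≤ |y| + x⁻¹ := by
  rcases n with _ | n
  · exact le_add_of_nonneg_right (inv_nonneg.2 hx.le)
  · rw [remainder, Int.self_sub_floor, abs_of_nonneg (div_nonneg (Int.fract_nonneg _) hx.le),
      div_eq_mul_inv]
    have := mul_le_mul_of_nonneg_right (Int.fract_lt_one (remainder x y n)).le (inv_nonneg.2 hx.le)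
    linarith [abs_nonneg y]

theorem sum_digits {x : ℝ} (hx : x ≠ 0) (y : ℝ) (n : ℕ) :
    ∑ k ∈ Finset.range n, (⌊remainder x y k⌋ : ℝ) * x ^ k + remainder x y n * x ^ n = y := by
  induction n with
  | zero => simp [remainder]
  | succ n ih =>
    rw [Finset.sum_range_succ, remainder]
    conv_rhs => rw [← ih]
    field_simp
    ring

/-- Bounded real numbers lift to elements of bounded norm, by expansion in base `r'`. -/
theorem exists_theta_eq (R : ℝ) :
    ∃ C, 0 ≤ C ∧ ∀ y : ℝ, |y| ≤ R → ∃ a, theta h a = y ∧ a.norm ≤ C := by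
  have hr := r.2.1
  have hr' := r'.2.1
  have hgeo := summable_geometric_of_lt_one hr.le r.2.2
  -- The digits are bounded by |R| + 1/r' + 1, where the 1 accounts for taking the floor; the second
  -- factor is the geometric series in r.
  refine ⟨(|R| + (r' : ℝ)⁻¹ + 1) * (1 - (r : ℝ))⁻¹, mul_nonneg (by positivity)
    (inv_nonneg.2 (sub_nonneg.2 r.2.2.le)), fun y hy => ?_⟩
  set p : PowerSeries ℤ := PowerSeries.mk fun n => ⌊remainder (r' : ℝ) y n⌋ with hp
  have hb : ∀ n, |PowerSeries.coeff n (p.map (Int.castRingHom ℝ))| * (r : ℝ) ^ n ≤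
      (|R| + (r' : ℝ)⁻¹ + 1) * (r : ℝ) ^ n := by
    intro n
    refine mul_le_mul_of_nonneg_right ?_ (pow_nonneg hr.le n)
    rw [PowerSeries.coeff_map, hp, PowerSeries.coeff_mk, eq_intCast]
    have h1 := remainder_bound hr' y n
    have h2 := Int.self_sub_floor (remainder (r' : ℝ) y n)
    have h3 := Int.fract_lt_one (remainder (r' : ℝ) y n)
    have h4 := Int.fract_nonneg (remainder (r' : ℝ) y n)
    have h5 := le_abs_self R
    rw [abs_le] at h1 ⊢
    constructor <;> linarith
  have hl : IsL1 r (p.map (Int.castRingHom ℝ)) := Summable.of_nonneg_of_le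
    (fun n => mul_nonneg (abs_nonneg _) (pow_nonneg hr.le n)) hb (hgeo.mul_left _)
  refine ⟨ZTr.ofPowerSeries p hl, ?_, ?_⟩
  · rw [theta_ofPowerSeries]
    refine tendsto_nhds_unique
      (summable_coeff_mul_pow hr'.le (le_of_lt h) hl).hasSum.tendsto_sum_nat ?_
    have h1 : ∀ n, ∑ k ∈ Finset.range n,
        PowerSeries.coeff k (p.map (Int.castRingHom ℝ)) * (r' : ℝ) ^ k =
          y - remainder (r' : ℝ) y n * (r' : ℝ) ^ n := by
      intro n
      rw [eq_sub_iff_add_eq, ← sum_digits hr'.ne' y n]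
      simp [hp, sum_digits hr'.ne' y n]
    simp only [h1]
    have h2 : Filter.Tendsto (fun n => remainder (r' : ℝ) y n * (r' : ℝ) ^ n) Filter.atTop
        (𝓝 0) := by
      refine squeeze_zero_norm (a := fun n => (|y| + (r' : ℝ)⁻¹) * (r' : ℝ) ^ n) (fun n => ?_) ?_
      · rw [norm_mul, Real.norm_eq_abs, norm_pow, Real.norm_of_nonneg hr'.le]
        exact mul_le_mul_of_nonneg_right (remainder_bound hr' y n) (pow_nonneg hr'.le n)
      · simpa using (tendsto_pow_atTop_nhds_zero_of_lt_one hr'.le r'.2.2).const_mul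
          (|y| + (r' : ℝ)⁻¹)
    simpa using h2.const_sub y
  · rw [ZTr.norm_ofPowerSeries, l1norm, ← tsum_geometric_of_lt_one hr.le r.2.2, ← tsum_mul_left]
    exact Summable.tsum_le_tsum hb hl (hgeo.mul_left _)

theorem exists_norm_thetaTrunc_le (n : ℕ) (C : ℝ) :
    ∃ D, ∀ a : ZTr r, a.norm ≤ C → ‖thetaTrunc h n a‖ ≤ D :=
  ZTr.eval_mapsTo _ (TruncPoly.summable_teich n h) C

/-- Bounded elements of `ℝ[X]/X^n` lift to elements of bounded norm. -/
theorem exists_thetaTrunc_eq (n : ℕ) (R : ℝ) : ∃ C, 0 ≤ C ∧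
    ∀ z : TruncPoly n, ‖z‖ ≤ R → ∃ a, thetaTrunc h n a = z ∧ a.norm ≤ C := by
  obtain ⟨f, -, hf, hf', -⟩ := exists_generator h
  obtain ⟨v, v', hv, hfv⟩ := exists_thetaSeries_eq h hf hf'
  induction n generalizing R with
  | zero =>
    exact ⟨0, le_rfl, fun z _ => ⟨0, TruncPoly.ext fun j => j.elim0, ZTr.norm_zero.le⟩⟩
  | succ n ih =>
    obtain ⟨C, hC, hlift⟩ := exists_theta_eq h R
    obtain ⟨D, hD⟩ := exists_norm_thetaTrunc_le h (n + 1) C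
    -- Once the constant term is lifted by a, the error has the form X s', and X is v' times the
    -- image of f. So v' s' is lifted modulo X^n to some b, and a + f b is the lift; the radius
    -- bounds the norm of v' s'.
    obtain ⟨C', hC', hlift'⟩ := ih (‖TruncPoly.ofPowerSeries n v'‖ * (R + D))
    refine ⟨C + f.norm * C', add_nonneg hC (mul_nonneg f.norm_nonneg hC'), fun z hz => ?_⟩
    obtain ⟨a, ha, haC⟩ := hlift (TruncPoly.coeff 0 z) ((TruncPoly.abs_coeff_le z 0).trans hz)
    set y := z - thetaTrunc h (n + 1) a with hy
    have hyn : ‖y‖ ≤ R + D := (norm_sub_le _ _).trans (add_le_add hz (hD a haC))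
    have hy0 : TruncPoly.coeff 0 y = 0 := by
      rw [hy, map_sub, sub_eq_zero, ← ha]
      exact (coeff_zero_thetaTrunc h (Nat.succ_pos n) a).symm
    set s := TruncPoly.series fun j => TruncPoly.coeff j y with hs
    have hsy : TruncPoly.ofPowerSeries (n + 1) s = y := TruncPoly.ofPowerSeries_series y
    obtain ⟨s', hs'⟩ : PowerSeries.X ∣ s := by
      rw [PowerSeries.X_dvd_iff, ← PowerSeries.coeff_zero_eq_constantCoeff_apply]
      exact (TruncPoly.coeff_series _ (0 : Fin (n + 1))).trans hy0
    have hs'n : ‖TruncPoly.ofPowerSeries n s'‖ ≤ ‖y‖ := by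
      rw [TruncPoly.norm_eq, TruncPoly.norm_eq, Fin.sum_univ_succ]
      refine le_add_of_nonneg_of_le (abs_nonneg _) (Finset.sum_le_sum fun j _ => ?_)
      rw [TruncPoly.coeff_ofPowerSeries, ← hsy, TruncPoly.coeff_ofPowerSeries, hs', Fin.val_succ,
        PowerSeries.coeff_succ_X_mul]
    obtain ⟨b, hb, hbC⟩ := hlift' (TruncPoly.ofPowerSeries n (v' * s')) (by
      rw [map_mul]
      exact (norm_mul_le _ _).trans
        (mul_le_mul_of_nonneg_left (hs'n.trans hyn) (norm_nonneg _)))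
    refine ⟨a + f * b, ?_, (ZTr.norm_add_le _ _).trans (add_le_add haC
      ((ZTr.norm_mul_le _ _).trans (mul_le_mul_of_nonneg_left hbC f.norm_nonneg)))⟩
    rw [map_add, ← eq_sub_iff_add_eq', ← hy, ← hsy, ← ofPowerSeries_thetaSeries, thetaSeries_mul,
      hfv, ← sub_eq_zero, ← map_sub, TruncPoly.ofPowerSeries_eq_zero_iff, hs', mul_assoc,
      ← mul_sub, pow_succ', mul_dvd_mul_iff_left PowerSeries.X_ne_zero]
    have h1 : PowerSeries.X ^ n ∣ thetaSeries h b - v' * s' := by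
      rw [← TruncPoly.ofPowerSeries_eq_zero_iff, map_sub, ofPowerSeries_thetaSeries, hb, sub_self]
    have h2 : v * thetaSeries h b - s' = v * (thetaSeries h b - v' * s') := by
      rw [mul_sub, ← mul_assoc, hv, one_mul]
    rw [h2]
    exact h1.mul_left v

/-- This is the sole use of the relation between p, r and r': T^k scales norm and quasinorm by the
same factor. -/
theorem zpow_rpow_eq {p : ℝ} (hrp : (r' : ℝ) ^ p = r) (k : ℤ) : ((r' : ℝ) ^ k) ^ p = (r : ℝ) ^ k := by
  rw [← Real.rpow_intCast, ← Real.rpow_mul r'.2.1.le, mul_comm, Real.rpow_mul r'.2.1.le, hrp,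
    Real.rpow_intCast]

/-- Elements of `ℝ[X]/X^n` lift to elements whose norm is controlled by the `ℓ^p`-quasinorm. -/
theorem exists_thetaTrunc_eq_expand {p : ℝ} (hp : 0 < p) (hrp : (r' : ℝ) ^ p = r) (n : ℕ) :
    ∃ C, 0 ≤ C ∧ ∀ x : Fin n → ℝ, ∃ a : ZTr r,
    thetaTrunc h n a = TruncPoly.expand x ∧ a.norm ≤ C * ∑ i, |x i| ^ p := by
  obtain ⟨d, hd⟩ := TruncPoly.exists_norm_expand_le n hp 1
  obtain ⟨C, hC, hlift⟩ := exists_thetaTrunc_eq h n d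
  refine ⟨C * (r : ℝ)⁻¹, mul_nonneg hC (inv_nonneg.2 r.2.1.le), fun x => ?_⟩
  set Q := ∑ i, |x i| ^ p with hQ
  have hQ0 : 0 ≤ Q := Finset.sum_nonneg fun i _ => by positivity
  rcases hQ0.eq_or_lt with h0 | h0
  · have hx : x = 0 := by
      funext i
      have h1 := (Finset.sum_eq_zero_iff_of_nonneg (fun i _ => by positivity)).1
        (hQ.symm.trans h0.symm) i (Finset.mem_univ i)
      exact abs_eq_zero.1 ((Real.rpow_eq_zero (abs_nonneg (x i)) hp.ne').1 h1)
    refine ⟨0, by rw [hx, TruncPoly.expand_zero, map_zero], ?_⟩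
    rw [ZTr.norm_zero, ← h0, mul_zero]
  · obtain ⟨k, hk1, hk2⟩ := exists_mem_Ioc_zpow h0 ((one_lt_inv₀ r.2.1).2 r.2.2)
    have hrk := zpow_pos r.2.1 (k + 1)
    rw [inv_zpow'] at hk1 hk2
    obtain ⟨a, ha, ha'⟩ := hlift (TruncPoly.expand fun i => (r' : ℝ) ^ (k + 1) * x i) (by
      refine hd _ ?_
      simp only [abs_mul, abs_of_pos (zpow_pos r'.2.1 (k + 1))]
      simp only [Real.mul_rpow (zpow_pos r'.2.1 (k + 1)).le (abs_nonneg _),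
        zpow_rpow_eq hrp]
      rw [← Finset.mul_sum, ← hQ]
      calc (r : ℝ) ^ (k + 1) * Q ≤ (r : ℝ) ^ (k + 1) * (r : ℝ) ^ (-(k + 1)) :=
            mul_le_mul_of_nonneg_left hk2 hrk.le
        _ = 1 := by rw [← zpow_add₀ r.2.1.ne', add_neg_cancel, zpow_zero])
    refine ⟨ZTr.monomial r (-(k + 1)) * a, ?_, ?_⟩
    · rw [map_mul, thetaTrunc_monomial, ha, TruncPoly.teich_mul_expand]
      congr 1
      funext i
      rw [← mul_assoc, ← zpow_add₀ r'.2.1.ne', neg_add_cancel, zpow_zero, one_mul]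
    · refine (ZTr.norm_monomial_mul_le _ _).trans ?_
      have h1 : (r : ℝ) ^ (-(k + 1)) = (r : ℝ)⁻¹ * (r : ℝ) ^ (-k) := by
        rw [neg_add_rev, zpow_add₀ r.2.1.ne', zpow_neg_one]
      rw [h1]
      calc (r : ℝ)⁻¹ * (r : ℝ) ^ (-k) * a.norm ≤ (r : ℝ)⁻¹ * Q * C :=
            mul_le_mul (mul_le_mul_of_nonneg_left hk1.le (inv_nonneg.2 r.2.1.le)) ha' a.norm_nonneg
              (mul_nonneg (inv_nonneg.2 r.2.1.le) hQ0)
        _ = _ := by ring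

/-- The `ℓ^p`-quasinorm of the image of `a` in `ℝ[X]/X^n` is controlled by the norm of `a`. -/
theorem exists_expand_eq_thetaTrunc {p : ℝ} (hp : 0 < p) (hp1 : p < 1) (hrp : (r' : ℝ) ^ p = r)
    (n : ℕ) : ∃ C, 0 ≤ C ∧ ∀ a : ZTr r,
    ∃ x : Fin n → ℝ, thetaTrunc h n a = TruncPoly.expand x ∧ ∑ i, |x i| ^ p ≤ C * a.norm := by
  obtain ⟨C, hC, hteich⟩ := TruncPoly.exists_norm_teich_le n hp1
  obtain ⟨C', hC', hexp⟩ := TruncPoly.exists_expand_bound n hp C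
  refine ⟨C', hC', fun a => ?_⟩
  rcases a.norm_nonneg.eq_or_lt with h0 | h0
  · have ha : a = 0 := by
      refine ZTr.ext fun k => ?_
      have h1 := ZTr.abs_coeff_mul_le a k
      rw [← h0] at h1
      have h2 : |(a.coeff k : ℝ)| ≤ 0 := by
        by_contra h3
        have := mul_pos (not_le.1 h3) (zpow_pos r.2.1 k)
        linarith
      have h3 : (a.coeff k : ℝ) = 0 := abs_eq_zero.1 (le_antisymm h2 (abs_nonneg _))
      exact_mod_cast h3
    refine ⟨0, by rw [ha, map_zero, TruncPoly.expand_zero], ?_⟩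
    simp [hp.ne', ← h0]
  -- Multiplying by [l⁻¹] normalises a to norm 1 in the quasinorm scale. Unlike the powers of T,
  -- this is available only in ℝ[X]/X^n, so it is applied to the image of a.
  · set l := a.norm ^ p⁻¹ with hl
    have hl0 : 0 < l := Real.rpow_pos_of_pos h0 _
    have hlp : l ^ p = a.norm := Real.rpow_inv_rpow h0.le hp.ne'
    have h1 := (hasSum_thetaTrunc h n a).mul_left (TruncPoly.teich n l⁻¹)
    obtain ⟨w, hw, hw'⟩ := hexp (TruncPoly.teich n l⁻¹ * thetaTrunc h n a) (by
      have h2 := ((a.summable.hasSum).mul_left (C * a.norm⁻¹))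
      have h3 : C * a.norm⁻¹ * (∑' k : ℤ, |(a.coeff k : ℝ)| * (r : ℝ) ^ k) = C :=
        inv_mul_cancel_right₀ h0.ne' C
      rw [h3] at h2
      rw [← h1.tsum_eq]
      refine tsum_of_norm_bounded h2 fun k => ?_
      rw [mul_smul_comm, ← TruncPoly.teich_mul]
      rcases eq_or_ne (a.coeff k) 0 with hk | hk
      · simp [hk]
      · have hy0 : 0 < l⁻¹ * (r' : ℝ) ^ k := mul_pos (inv_pos.2 hl0) (zpow_pos r'.2.1 k)
        have hyp : (l⁻¹ * (r' : ℝ) ^ k) ^ p = a.norm⁻¹ * (r : ℝ) ^ k := by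
          rw [Real.mul_rpow (inv_pos.2 hl0).le (zpow_pos r'.2.1 k).le, zpow_rpow_eq hrp,
            Real.inv_rpow hl0.le, hlp]
        -- Integrality enters here: a nonzero coefficient has absolute value at least 1, hence r^k ≤
        -- ‖a‖.
        have hy1 : l⁻¹ * (r' : ℝ) ^ k ≤ 1 := by
          rw [← Real.rpow_le_rpow_iff hy0.le zero_le_one hp, hyp, Real.one_rpow,
            inv_mul_le_iff₀ h0, mul_one]
          refine le_trans ?_ (ZTr.abs_coeff_mul_le a k)
          have h4 : (1 : ℝ) ≤ |(a.coeff k : ℝ)| := by exact_mod_cast Int.one_le_abs hk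
          exact le_mul_of_one_le_left (zpow_pos r.2.1 k).le h4
        refine (norm_zsmul_le _ _).trans ?_
        rw [Int.norm_eq_abs]
        calc |(a.coeff k : ℝ)| * ‖TruncPoly.teich n (l⁻¹ * (r' : ℝ) ^ k)‖
            ≤ |(a.coeff k : ℝ)| * (C * (a.norm⁻¹ * (r : ℝ) ^ k)) := by
              rw [← hyp]
              exact mul_le_mul_of_nonneg_left (hteich _ hy0 hy1) (abs_nonneg _)
          _ = _ := by ring)
    refine ⟨fun i => l * w i, ?_, ?_⟩
    · rw [← TruncPoly.teich_mul_expand, ← hw, ← mul_assoc, ← TruncPoly.teich_mul,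
        mul_inv_cancel₀ hl0.ne', TruncPoly.teich_one, one_mul]
    · simp only [abs_mul, abs_of_pos hl0, Real.mul_rpow hl0.le (abs_nonneg _), hlp]
      rw [← Finset.mul_sum, mul_comm]
      exact mul_le_mul_of_nonneg_right hw' h0.le

end Lift

/-! ### From estimates to quotients of condensed rings and modules -/

section Quotient

variable {r : Set.Ioo (0 : ℝ) 1} {B : Type} [CommRing B] [TopologicalSpace B] [BallRing B]
  [T2Space B] {φ : ZTr r →+* B} (hc : ∀ c, ContinuousOn φ (BallRing.ball c))
  (hb : ∀ c, ∃ d, Set.MapsTo φ (BallRing.ball c) (BallRing.ball d))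

theorem ZTr.isCompact_ball (c : ℝ) : IsCompact (BallRing.ball c : Set (ZTr r)) :=
  ZTr.isCompact_setOf_norm_le c

theorem ZTr.mul_left_eq_zero {g : ZTr r} (hg : g ≠ 0) (a : ZTr r) (h : g * a = 0) : a = 0 :=
  (mul_eq_zero.1 h).resolve_left hg

theorem isCondNonzerodivisor_of_ne_zero {g : ZTr r} (hg : g ≠ 0) : IsCondNonzerodivisor.{u} g :=
  fun _ _ h => Subtype.ext (funext fun t =>
    ZTr.mul_left_eq_zero hg _ (congrFun (congrArg Subtype.val h) t))

/-- Local surjectivity comes from bounded lifts. For the kernel, the pointwise quotients by g are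
uniformly bounded, and compactness of the balls makes them continuous. -/
theorem isQuotientMapBy_of_lift {g : ZTr r} (hg : g ≠ 0) (hφg : φ g = 0) {C : ℝ} (hC : 0 ≤ C)
    (hdiv : ∀ a, φ a = 0 → ∃ b, a = g * b ∧ b.norm ≤ C * a.norm)
    (hlift : ∀ c, ∃ d, ∀ b ∈ BallRing.ball (A := B) c, ∃ a : ZTr r, φ a = b ∧ a.norm ≤ d) :
    IsQuotientMapBy (condRing.map.{u} φ hc hb) g := by
  refine ⟨isLocallySurjective_condRing_map hc hb ZTr.isCompact_ball fun c => ?_, fun T a => ?_⟩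
  · obtain ⟨d, hd⟩ := hlift c
    refine ⟨d, fun b hb => ?_⟩
    obtain ⟨a, ha, ha'⟩ := hd b hb
    exact ⟨a, ha', ha⟩
  · constructor
    · intro h
      have h0 : ∀ t, φ (a.1 t) = 0 := fun t =>
        congrArg (fun b : ULift.{u + 1} (secRing B T) => b.down.1 t) h
      choose b hb hb' using fun t => hdiv _ (h0 t)
      obtain ⟨ha, c, hac⟩ := a.2
      have hbC : ∀ t, b t ∈ BallRing.ball (A := ZTr r) (C * c) := fun t =>
        (hb' t).trans (mul_le_mul_of_nonneg_left (hac t) hC)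
      refine ⟨⟨b, ?_, C * c, hbC⟩, Subtype.ext (funext hb)⟩
      exact continuous_of_continuous_mul (ZTr.isCompact_ball _) (ZTr.mul_left_eq_zero hg) hbC
        (ha.congr hb)
    · rintro ⟨b, rfl⟩
      refine congrArg ULift.up (Subtype.ext (funext fun t => ?_))
      exact (map_mul φ g _).trans (by rw [hφg, zero_mul]; rfl)

/-- This criterion covers both kinds of coefficients, ℝ and ℝ[X]/X^n. Given division with norm
control in the ring, only the comparison of the two gauges on finite sets remains to be supplied,
uniformly in the set. -/
theorem exists_iso_measures_of_lift {g : ZTr r} (hg : g ≠ 0) (hφg : φ g = 0) {C : ℝ} (hC : 0 ≤ C)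
    (hdiv : ∀ a, φ a = 0 → ∃ b, a = g * b ∧ b.norm ≤ C * a.norm) (G' : Gauge.{u} B)
    (hG : ∀ c, ∃ d, ∀ (I : Type u) [Fintype I] (x : I →₀ ZTr r), ∑ s, (x s).norm ≤ c →
      Finsupp.mapRange.addMonoidHom φ.toAddMonoidHom x ∈ G'.ball I d)
    (hlift : ∀ c, ∃ d, ∀ (I : Type u) [Fintype I], ∀ y ∈ G'.ball I c,
      ∃ x : I → ZTr r, (∀ s, φ (x s) = y s) ∧ ∑ s, (x s).norm ≤ d) (S : Profinite.{u}) :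
    ∃ e : measModulo (ztrGauge r) S g ≅
        (SheafOfModules.restrictScalars (condRing.map.{u} φ hc hb)).obj (measures G' S),
      IsInducedBy φ e.hom := by
  have hG' : ∀ c, ∃ d, ∀ (I : Type u) [Finite I], ∀ x ∈ (ztrGauge r).ball I c,
      Finsupp.mapRange.addMonoidHom φ.toAddMonoidHom x ∈ G'.ball I d := by
    intro c
    obtain ⟨d, hd⟩ := hG c
    refine ⟨d, fun I _ x hx => ?_⟩
    have := Fintype.ofFinite I
    exact hd I x ((mem_ztrGauge_iff x c).1 hx)
  refine exists_iso_measures hc hb (ztrGauge r) G' hG' g S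
    (secMod_mul_injective _ (ZTr.mul_left_eq_zero hg) S)
    (secMod_map_eq_zero_iff hc _ G' hG' ZTr.isCompact_ball (ZTr.mul_left_eq_zero hg) hφg ?_ S)
    (exists_cover_secMod hc _ G' hG' ZTr.isCompact_ball isClosed_ztrGauge mapDomain_mem_ztrGauge
      ?_ S)
  · refine fun c => ⟨C * c, fun I _ x hx h0 => ?_⟩
    have := Fintype.ofFinite I
    choose y hy hy' using fun s => hdiv _ (h0 s)
    refine ⟨Finsupp.equivFunOnFinite.symm y, (mem_ztrGauge_iff _ _).2 ?_,
      Finsupp.ext fun s => (hy s).symm⟩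
    refine (Finset.sum_le_sum fun s _ => hy' s).trans ?_
    rw [← Finset.mul_sum]
    exact mul_le_mul_of_nonneg_left ((mem_ztrGauge_iff x c).1 hx) hC
  · intro c
    obtain ⟨d, hd⟩ := hlift c
    refine ⟨d, fun I _ y hy => ?_⟩
    have := Fintype.ofFinite I
    obtain ⟨x, hx, hx'⟩ := hd I y hy
    exact ⟨Finsupp.equivFunOnFinite.symm x, (mem_ztrGauge_iff _ _).2 hx', hx⟩

end Quotient

/-! ### Comparison of gauges on finite sets -/

section Gauges

variable {r r' : Set.Ioo (0 : ℝ) 1} (h : r' < r) {p : Set.Ioo (0 : ℝ) 1}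

theorem exists_rpow_eq (h : r' < r) : ∃ p : Set.Ioo (0 : ℝ) 1, (r' : ℝ) ^ (p : ℝ) = r := by
  have h1 : Real.log r' < 0 := Real.log_neg r'.2.1 r'.2.2
  have h2 : Real.log r < 0 := Real.log_neg r.2.1 r.2.2
  have h3 : Real.log r' < Real.log r := Real.log_lt_log r'.2.1 h
  refine ⟨⟨Real.log r / Real.log r', div_pos_of_neg_of_neg h2 h1, (div_lt_one_of_neg h1).2 h3⟩, ?_⟩
  rw [Real.rpow_def_of_pos r'.2.1, mul_div_cancel₀ _ h1.ne, Real.exp_log r.2.1]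

/-- Pushforward commutes with θ_n and does not increase the norm on the side of ℤ((T))_r, so one
constant serves for all images; this yields the stability condition. -/
theorem mapRange_mem_stableBall (hrp : (r' : ℝ) ^ (p : ℝ) = r) (n : ℕ) (c : ℝ) :
    ∃ d, ∀ (I : Type u) [Fintype I] (x : I →₀ ZTr r), ∑ s, (x s).norm ≤ c →
      Finsupp.mapRange.addMonoidHom (thetaTrunc h n).toAddMonoidHom x ∈
        (TruncPoly.gauge.{u} n p).ball I d := by
  obtain ⟨C, hC, hx⟩ := exists_expand_eq_thetaTrunc h p.2.1 p.2.2 hrp n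
  refine ⟨C * c, fun I _ x hxc m g => ?_⟩
  have h1 := DFunLike.congr_fun (Finsupp.mapDomain.addMonoidHom_comp_mapRange g
    (thetaTrunc h n).toAddMonoidHom) x
  have h2 : Finsupp.mapDomain g (Finsupp.mapRange.addMonoidHom (thetaTrunc h n).toAddMonoidHom x) =
      Finsupp.mapRange.addMonoidHom (thetaTrunc h n).toAddMonoidHom (Finsupp.mapDomain g x) := h1
  rw [h2]
  choose w hw hw' using hx
  refine ⟨fun t => w (x.mapDomain g t), fun t => hw _, (Finset.sum_le_sum fun t _ => hw' _).trans ?_⟩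
  rw [← Finset.mul_sum]
  refine mul_le_mul_of_nonneg_left ?_ hC
  have h3 := sum_norm_mapDomain_le g x
  rw [Finsupp.sum_fintype _ _ fun _ => ZTr.norm_zero,
    Finsupp.sum_fintype _ _ fun _ => ZTr.norm_zero] at h3
  exact h3.trans hxc

/-- Lifting is done coordinate by coordinate, and stability is needed only for a bijection from I to
a standard finite set. -/
theorem exists_lift_stableBall (hrp : (r' : ℝ) ^ (p : ℝ) = r) (n : ℕ) (c : ℝ) :
    ∃ d, ∀ (I : Type u) [Fintype I], ∀ y ∈ (TruncPoly.gauge.{u} n p).ball I c,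
      ∃ x : I → ZTr r, (∀ s, thetaTrunc h n (x s) = y s) ∧ ∑ s, (x s).norm ≤ d := by
  obtain ⟨C, hC, hx⟩ := exists_thetaTrunc_eq_expand h p.2.1 hrp n
  refine ⟨C * c, fun I _ y hy => ?_⟩
  obtain ⟨x, hxy, hxc⟩ := hy _ (Fintype.equivFin I)
  choose a ha ha' using hx
  refine ⟨fun s => a (x (Fintype.equivFin I s)), fun s => ?_,
    (Finset.sum_le_sum fun s _ => ha' _).trans ?_⟩
  · rw [ha, ← hxy, Finsupp.mapDomain_apply (Fintype.equivFin I).injective]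
  · rw [← Finset.mul_sum, Equiv.sum_comp (Fintype.equivFin I) fun s => ∑ i, |x s i| ^ (p : ℝ)]
    exact mul_le_mul_of_nonneg_left hxc hC

theorem coeff_zero_expand (x : Fin 1 → ℝ) : TruncPoly.coeff 0 (TruncPoly.expand x) = x 0 := by
  simp [TruncPoly.coeff_expand, teichCoeff]

theorem mem_lpGauge_iff {I : Type u} [Fintype I] (x : I →₀ ℝ) (c : ℝ) :
    x ∈ (lpGauge.{u} p).ball I c ↔ ∑ s, |x s| ^ (p : ℝ) ≤ c := by
  change (x.sum fun _ a => |a| ^ (p : ℝ)) ≤ c ↔ _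
  rw [Finsupp.sum_fintype _ _ fun _ => by simp [p.2.1.ne']]

/-- The case n = 1 of the estimate in ℝ[X]/X^n, where the expansion has the single term [x_0] with
constant coefficient x_0. -/
theorem mapRange_mem_lpGauge (hrp : (r' : ℝ) ^ (p : ℝ) = r) (c : ℝ) :
    ∃ d, ∀ (I : Type u) [Fintype I] (x : I →₀ ZTr r), ∑ s, (x s).norm ≤ c →
      Finsupp.mapRange.addMonoidHom (theta h).toAddMonoidHom x ∈ (lpGauge.{u} p).ball I d := by
  obtain ⟨C, hC, hx⟩ := exists_expand_eq_thetaTrunc h p.2.1 p.2.2 hrp 1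
  refine ⟨C * c, fun I _ x hxc => (mem_lpGauge_iff _ _).2 ?_⟩
  refine le_trans ?_ (mul_le_mul_of_nonneg_left hxc hC)
  rw [Finset.mul_sum]
  refine Finset.sum_le_sum fun s _ => ?_
  obtain ⟨w, hw, hw'⟩ := hx (x s)
  change |theta h (x s)| ^ (p : ℝ) ≤ _
  rw [← coeff_zero_thetaTrunc h zero_lt_one, hw]
  rw [Fin.sum_univ_one] at hw'
  exact (congrArg (fun y : ℝ => |y| ^ (p : ℝ)) (coeff_zero_expand w)).le.trans hw'

theorem exists_lift_lpGauge (hrp : (r' : ℝ) ^ (p : ℝ) = r) (c : ℝ) :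
    ∃ d, ∀ (I : Type u) [Fintype I], ∀ y ∈ (lpGauge.{u} p).ball I c,
      ∃ x : I → ZTr r, (∀ s, theta h (x s) = y s) ∧ ∑ s, (x s).norm ≤ d := by
  obtain ⟨C, hC, hx⟩ := exists_thetaTrunc_eq_expand h p.2.1 hrp 1
  refine ⟨C * c, fun I _ y hy => ?_⟩
  choose a ha ha' using fun y : ℝ => hx fun _ => y
  refine ⟨fun s => a (y s), fun s => ?_, (Finset.sum_le_sum fun s _ => ha' _).trans ?_⟩
  · rw [← coeff_zero_thetaTrunc h zero_lt_one, ha]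
    exact coeff_zero_expand _
  · simp only [Fin.sum_univ_one]
    rw [← Finset.mul_sum]
    exact mul_le_mul_of_nonneg_left ((mem_lpGauge_iff y c).1 hy) hC

end Gauges

end CondensedMeasures

/-! ### The quotients of ℤ((T))_r and of its measures by the powers of f -/

theorem mainTheorem6 (r r' : Set.Ioo (0 : ℝ) 1) (h : r' < r) :
    Function.Surjective (theta h) ∧ Sheaf.IsLocallySurjective (condTheta.{u} h) ∧
    ∃ f : ZTr r,
      (f ∈ nonZeroDivisors (ZTr r) ∧ RingHom.ker (theta h) = Ideal.span {f}) ∧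
      (IsCondNonzerodivisor.{u} f ∧ IsQuotientMapBy (condTheta.{u} h) f) ∧
      ∃ p : Set.Ioo (0 : ℝ) 1, (r' : ℝ) ^ (p : ℝ) = r ∧
        (∀ S : Profinite.{u},
          ∃ e : measModulo (ztrGauge r) S f ≅
              (SheafOfModules.restrictScalars (condTheta.{u} h)).obj (measures (lpGauge p) S),
            IsInducedBy (theta h) e.hom) ∧
        ∀ n : ℕ, 1 ≤ n →
          (Function.Surjective (thetaTrunc h n) ∧
            RingHom.ker (thetaTrunc h n) = Ideal.span {f} ^ n) ∧
          IsQuotientMapBy (condThetaTrunc.{u} h n) (f ^ n) ∧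
          ∀ S : Profinite.{u},
            ∃ e : measModulo (ztrGauge r) S (f ^ n) ≅
                (SheafOfModules.restrictScalars (condThetaTrunc.{u} h n)).obj
                  (measures (TruncPoly.gauge n p) S),
              IsInducedBy (thetaTrunc h n) e.hom := by
  obtain ⟨f, hf0, hf, hf', C, hC, hdiv⟩ := exists_generator h
  obtain ⟨p, hrp⟩ := exists_rpow_eq h
  have hquot : IsQuotientMapBy (condTheta.{u} h) f :=
    isQuotientMapBy_of_lift (ZTr.eval_continuousOn _ (summable_real h))
      (ZTr.eval_mapsTo _ (summable_real h)) hf0 hf hC hdiv fun c => by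
        obtain ⟨d, -, hd⟩ := exists_theta_eq h c
        exact ⟨d, hd⟩
  have hdivn := exists_pow_mul_eq h hf hf' hC hdiv
  refine ⟨fun y => ?_, hquot.1, f, ⟨mem_nonZeroDivisors_of_ne_zero hf0, ?_⟩,
    ⟨isCondNonzerodivisor_of_ne_zero hf0, hquot⟩, p, hrp, fun S => ?_, fun n _ =>
    ⟨⟨fun z => ?_, ?_⟩, ?_, fun S => ?_⟩⟩
  · obtain ⟨_, -, hd⟩ := exists_theta_eq h |y|
    obtain ⟨a, ha, -⟩ := hd y le_rfl
    exact ⟨a, ha⟩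
  · ext a
    rw [RingHom.mem_ker, Ideal.mem_span_singleton]
    constructor
    · intro ha
      obtain ⟨b, hb, -⟩ := hdiv a ha
      exact ⟨b, hb⟩
    · rintro ⟨b, rfl⟩
      rw [map_mul, hf, zero_mul]
  · exact exists_iso_measures_of_lift (ZTr.eval_continuousOn _ (summable_real h))
      (ZTr.eval_mapsTo _ (summable_real h)) hf0 hf hC hdiv (lpGauge p)
      (mapRange_mem_lpGauge h hrp) (exists_lift_lpGauge h hrp) S
  · obtain ⟨_, -, hd⟩ := exists_thetaTrunc_eq h n ‖z‖
    obtain ⟨a, ha, -⟩ := hd z le_rfl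
    exact ⟨a, ha⟩
  · ext a
    rw [RingHom.mem_ker, Ideal.span_singleton_pow, Ideal.mem_span_singleton]
    constructor
    · intro ha
      obtain ⟨b, hb, -⟩ := hdivn n a ha
      exact ⟨b, hb⟩
    · rintro ⟨b, rfl⟩
      rw [map_mul, thetaTrunc_pow_eq_zero h hf, zero_mul]
  · exact isQuotientMapBy_of_lift (ZTr.eval_continuousOn _ (TruncPoly.summable_teich n h))
      (ZTr.eval_mapsTo _ (TruncPoly.summable_teich n h)) (pow_ne_zero n hf0)
      (thetaTrunc_pow_eq_zero h hf n) (pow_nonneg hC n) (hdivn n) fun c => by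
        obtain ⟨d, -, hd⟩ := exists_thetaTrunc_eq h n c
        exact ⟨d, hd⟩
  · exact exists_iso_measures_of_lift (ZTr.eval_continuousOn _ (TruncPoly.summable_teich n h))
      (ZTr.eval_mapsTo _ (TruncPoly.summable_teich n h)) (pow_ne_zero n hf0)
      (thetaTrunc_pow_eq_zero h hf n) (pow_nonneg hC n) (hdivn n) (TruncPoly.gauge n p)
      (mapRange_mem_stableBall h hrp n) (exists_lift_stableBall h hrp n) S
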